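/- Let $s>1/2$ and $E_{\max},h_0,\varepsilon_0>0$. For each $h\in(0,h_0]$ let $E(h)\in[-E_{\max},E_{\max}]$, and let $\alpha(\cdot,h),\beta(\cdot,h),b_0(\cdot,h),b_1(\cdot,h),V_1(\cdot,h):\mathbb R\to\mathbb R$ and a finite signed Borel measure $V_0(h)$ on $\mathbb R$ be given, such that $\alpha,\beta,b_1,V_1$ have bounded variation, $\inf\alpha>0$, $\inf\beta>0$ and $b_0\in L^1(\mathbb R)\cap L^2(\mathbb R)$. Put $b=b_0+b_1$, $V=V_0+V_1$, $D_x=-i\partial_x$, and let $$P(h)=\beta\big(-h^2\partial_x(\alpha\,\partial_x)+hbD_x+hD_xb\big)+V$$ with domain $\mathcal D$ the set of $u\in H^1(\mathbb R)$ such that $h\alpha u'+ibu$ belongs to $L^\infty(\mathbb R)$ and has locally bounded variation, and such that $$P(h)u:=\beta\,d(-h^2\alpha u'-ihbu)+h\beta b\,D_xu+u_cV,$$ a measure on bounded Borel sets, belongs to $L^2(\mathbb R)$. Here $u_c$ is the continuous representative of $u$, and $df$ is the measure that is the distributional derivative of a function $f$ of (locally) bounded variation. For a finite signed measure $\mu$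 write $\|\mu\|=|\mu|(\mathbb R)$. Assume: 1. $\|V_1(\cdot,h)\|_{L^\infty}$, $\|dV_1(h)\|$, $\|b_1(\cdot,h)\|_{L^\infty}$, $\|db_1(h)\|$, $\|d\alpha(h)\|$, $\|d\beta(h)\|$, $\sup\alpha(\cdot,h)$ and $\sup\beta(\cdot,h)$ are bounded uniformly for $h\in(0,h_0]$; 2. there is $c>0$ independent of $h$ with $\inf\alpha(\cdot,h),\ \inf\beta(\cdot,h)>c$ for all $h\in(0,h_0]$; 3. there is $R_1>0$ independent of $h$ with $$\inf_{h\in(0,h_0],\,|x|\ge R_1}\big(\beta^{-1}(x,h)\alpha(x,h)(E(h)-V_1(x,h))+b_1^2(x,h)\big)>0;$$ 4. $\|V_0(h)\|$, $\|b_0(\cdot,h)\|_{L^1}$ and $\|b_0(\cdot,h)\|_{L^2}$ are bounded uniformly for $h\in(0,h_0]$. Then there is $C_1>0$, independent of $h$ and $\varepsilon$, such that for all $h\in(0,h_0]$ and all real $\varepsilon\ne0$ with $|\varepsilon|\le\varepsilon_0$ the resolvent $(P(h)-E(h)-i\varepsilon)^{-1}$ exists as a bounded operator on $L^2(\mathbb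 R)$, and $$\big\|\langle x\rangle^{-s}(P(h)-E(h)-i\varepsilon)^{-1}\langle x\rangle^{-s}\big\|_{L^2(\mathbb R)\to L^2(\mathbb R)}\le e^{C_1/h},\qquad \langle x\rangle=(1+|x|^2)^{1/2}.$$ -/

import Mathlib

open MeasureTheory Set
open scoped ENNReal NNReal ContDiff

noncomputable section

namespace MagSchro

/-- The complex Hilbert space `L²(ℝ; dx)`. -/
abbrev L2 : Type := Lp ℂ 2 (volume : Measure ℝ)

/-- The coefficients of a one-dimensional magnetic Schrödinger operator (at one value of `h`):
`V = V₀ + V₁` with `V₀` a finite signed Borel measure, `b = b₀ + b₁` with `b₀ ∈ L¹ ∩ L²`,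
the functions `V₁, b₁, α, β` of bounded variation, and `α, β` bounded below by positive constants.
All coefficients are real. -/
structure Coefficients where
  /-- the coefficient of the second order term -/
  α : ℝ → ℝ
  /-- the density -/
  β : ℝ → ℝ
  /-- the short range part of the magnetic potential -/
  b₀ : ℝ → ℝ
  /-- the long range part of the magnetic potential -/
  b₁ : ℝ → ℝ
  /-- the short range part of the electric potential -/
  V₀ : SignedMeasure ℝ
  /-- the long range part of the electric potential -/
  V₁ : ℝ → ℝ
  b₀_L1 : MemLp b₀ 1 volume
  b₀_L2 : MemLp b₀ 2 volume
  V₁_bv : BoundedVariationOn V₁ univ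
  b₁_bv : BoundedVariationOn b₁ univ
  α_bv : BoundedVariationOn α univ
  β_bv : BoundedVariationOn β univ
  α_inf : ∃ m > 0, ∀ x, m ≤ α x
  β_inf : ∃ m > 0, ∀ x, m ≤ β x

/-- The magnetic potential `b = b₀ + b₁`. -/
def Coefficients.b (c : Coefficients) (x : ℝ) : ℝ := c.b₀ x + c.b₁ x

/-- `‖μ‖ = |μ|(ℝ)`, where `|μ|` is the sum of the positive and the negative variations of `μ`. -/
def totalMass (μ : SignedMeasure ℝ) : ℝ≥0∞ := μ.totalVariation univ

/-- The finite signed Borel measure `df` of a real function `f` of bounded variation: it gives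
`(x₁, x₂]` the mass `f(x₂+) - f(x₁+)`. -/
def dBV {f : ℝ → ℝ} (hf : BoundedVariationOn f univ) : SignedMeasure ℝ := hf.vectorMeasure

/-- The function that equals `F` on `[-r, r]` and is constant on either side (for `0 ≤ r`). -/
def truncate (r : ℝ) (F : ℝ → ℂ) (x : ℝ) : ℂ := F (max (-r) (min x r))

theorem truncate_bv {F : ℝ → ℂ} (hF : LocallyBoundedVariationOn F univ) (r : ℝ) :
    BoundedVariationOn (truncate r F) univ := by
  have hmono : MonotoneOn (fun x : ℝ => max (-r) (min x r)) univ := by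
    intro x _ y _ hxy
    exact max_le_max le_rfl (min_le_min hxy le_rfl)
  have hmaps : MapsTo (fun x : ℝ => max (-r) (min x r)) univ
      (univ ∩ Icc (-r) (max (-r) r)) := by
    intro x _
    exact ⟨mem_univ _, le_max_left _ _, max_le_max le_rfl (min_le_right _ _)⟩
  have h := eVariationOn.comp_le_of_monotoneOn F (fun x : ℝ => max (-r) (min x r)) hmono hmaps
  exact ne_top_of_le_ne_top (hF (-r) (max (-r) r) (mem_univ _) (mem_univ _)) h

/-- For `F` of locally bounded variation, a complex measure which on Borel subsets of the bounded
interval `(-r, r)` is `dF`, the distributional derivative of `F`. (What it does off that interval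
is irrelevant.) -/
def dLoc {F : ℝ → ℂ} (hF : LocallyBoundedVariationOn F univ) (r : ℝ) : ComplexMeasure ℝ :=
  (truncate_bv hF r).vectorMeasure

/-- `u'` is the weak (distributional) derivative of `u` on `ℝ`. -/
def HasWeakDeriv (u u' : ℝ → ℂ) : Prop :=
  LocallyIntegrable u volume ∧ LocallyIntegrable u' volume ∧
    ∀ φ : ℝ → ℝ, ContDiff ℝ ∞ φ → HasCompactSupport φ →
      ∫ x, ((deriv φ x : ℝ) : ℂ) * u x = -∫ x, ((φ x : ℝ) : ℂ) * u' x

/-- The graph of `P(h) = β(-h²∂ₓ(α∂ₓ) + h b Dₓ + h Dₓ b) + V` on its domain `𝒟`, where `Dₓ = -i∂ₓ`: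
`P.Graph h u g` says that `u ∈ 𝒟` and `P(h)u = g ∈ L²`.  In detail, `u ∈ H¹(ℝ)`, with
continuous representative `uc` and weak derivative `u'`; the function `hαu' + ibu` is bounded and
of locally bounded variation, `F` being a representative; and
`β d(-h²αu' - ihbu) + hβb Dₓu + u_c V = g dx` as measures on bounded Borel sets
(note `-h²αu' - ihbu = -hF`). -/
def Coefficients.Graph (c : Coefficients) (h : ℝ) (u g : L2) : Prop :=
  ∃ uc u' F : ℝ → ℂ,
    Continuous uc ∧ uc =ᵐ[volume] u ∧ MemLp u' 2 volume ∧ HasWeakDeriv uc u' ∧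
    F =ᵐ[volume] (fun x => (h : ℂ) * c.α x * u' x + Complex.I * c.b x * uc x) ∧
    MemLp F ∞ volume ∧
    ∃ hF : LocallyBoundedVariationOn F univ,
      ∀ r : ℝ, ∀ A : Set ℝ, MeasurableSet A → A ⊆ Ioo (-r) r →
        -(h : ℂ) * (∫ᵛ x in A, c.β x ∂•(dLoc hF r))
          + (∫ x in A, (h : ℂ) * c.β x * c.b x * (-Complex.I * u' x))
          + ((∫ᵛ x in A, uc x ∂<•c.V₀) + ∫ x in A, uc x * (c.V₁ x : ℂ))
        = ∫ x in A, g x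

/-- The bounded operator `R` on `L²(ℝ)` is the resolvent `(P(h) - z)⁻¹`: it is a two-sided inverse
of `P(h) - z : 𝒟 → L²(ℝ)`, i.e. `R f = u` exactly when `u ∈ 𝒟` and `P(h)u = f + z u`. -/
def Coefficients.IsResolvent (c : Coefficients) (h : ℝ) (z : ℂ) (R : L2 →L[ℂ] L2) : Prop :=
  ∀ f u : L2, R f = u ↔ c.Graph h u (f + z • u)

/-- `⟨x⟩^{-s}`, where `⟨x⟩ = (1 + |x|²)^{1/2}`. -/
def weight (s x : ℝ) : ℝ := (Real.sqrt (1 + |x| ^ 2)) ^ (-s)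

theorem weight_memLp {s : ℝ} (hs : 1 / 2 < s) :
    MemLp (fun x : ℝ => (weight s x : ℂ)) ∞ volume := by
  refine memLp_top_of_bound (C := 1) ?_ ?_
  · refine Measurable.aestronglyMeasurable ?_
    unfold weight
    fun_prop
  · refine Filter.Eventually.of_forall fun x => ?_
    have h1 : 1 ≤ Real.sqrt (1 + |x| ^ 2) := by
      rw [Real.one_le_sqrt]
      nlinarith [sq_nonneg |x|]
    rw [Complex.norm_real, Real.norm_of_nonneg (by unfold weight; positivity)]
    exact Real.rpow_le_one_of_one_le_of_nonpos h1 (by linarith)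

/-- Multiplication by `⟨x⟩^{-s}` as a bounded operator on `L²(ℝ)`. -/
def mulWeight {s : ℝ} (hs : 1 / 2 < s) : L2 →L[ℂ] L2 :=
  (ContinuousLinearMap.mul ℂ ℂ).holderL volume ∞ 2 2 (weight_memLp hs).toLp

end MagSchro

end

open Filter Topology
open MagSchro

/-! Put Φ = hαu' + ibu - wu with a real function w to be chosen. Then (P(h) - E - iε)u = f becomes a
first order system for (u, Φ) whose coefficients are functions: no derivative of b occurs, and the
measure V₀ is absorbed by w. Choose w so that h dw is V₀/β minus its moving average over windows of
length h². Then ∫|w| = O(h), while the averaged density and w²/α have integrals O(1). Write the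
zeroth order coefficient as aP + r with a = 1/α. Here P is a moving average, at unit scale, of
β⁻¹α(E - V₁) + b₁² with the values on |x| < R₁ replaced by 1. Thus P is bounded below by a positive
constant, ∫|P'| = O(1), and everything discarded on the way goes into r with ∫|r| = O(1), by bounded
variation and because the replacement happens on a bounded interval (`exists_system_bounded`).

In the derivative of the energy |Φ|² + P|u|² the terms with b and with aP cancel. What remains is at
most k times the energy plus a source, with ∫k = O(1/h). The energy of a square integrable solution
is integrable, so Grönwall's inequality can be started at infinity
(`IsPrimitive.le_exp_mul_integral`) and costs a factor e^{O(1/h)}. The source is h⁻¹(|ε||u||Φ| +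
|f||Φ|). To remove ε, integrate the derivative of ūΦ over the line: the imaginary part bounds
|ε|∫|u|² by ∫|f||u|, the real part bounds ∫|Φ|², and together |ε|∫|u||Φ| = O(h⁻²)∫|f||u|. The
supremum S of the energy therefore satisfies S ≤ e^{O(1/h)} ‖f‖₁ √S, so that sup|u| ≤ e^{O(1/h)}
‖f‖₁ uniformly in ε (`exists_exp_bound`). Since ⟨x⟩^{-s} is square integrable, this bound from L¹ to
L^∞ gives the weighted L² bound.

For ε ≠ 0 the imaginary part of the same identity gives uniqueness and boundedness of the solution
operator. Existence is a form argument on H¹: the imaginary part of the form controls u, after which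
the real part controls u' (`isUnit_of_form`, `exists_weak_solution`). The system is equivalent to
the equation between measures in `Graph` by `Graph.exists_isSolution` and `graph_of_isSolution`;
these rest on dividing that equation by β and on integrating by parts against V₀. -/

/-! ### Calculus of locally absolutely continuous functions. -/

/-- `u` is a primitive of the locally integrable function `u'`, that is, `u` is locally absolutely
continuous with almost everywhere derivative `u'`. -/
def IsPrimitive {E : Type*} [NormedAddCommGroup E] [NormedSpace ℝ E] (u u' : ℝ → E) : Prop :=
  (∀ a b, IntervalIntegrable u' volume a b) ∧ ∀ a b, ∫ x in a..b, u' x = u b - u a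

namespace IsPrimitive

variable {E F : Type*} [NormedAddCommGroup E] [NormedSpace ℝ E] [CompleteSpace E]
  [NormedAddCommGroup F] [NormedSpace ℝ F] [CompleteSpace F] {u u' v v' : ℝ → E}

omit [CompleteSpace E] in
theorem congr_deriv (h : IsPrimitive u u') (hv : u' =ᵐ[volume] v') : IsPrimitive u v' := by
  refine ⟨fun a b => (h.1 a b).congr_ae (ae_restrict_of_ae hv), fun a b => ?_⟩
  rw [← h.2 a b]
  refine intervalIntegral.integral_congr_ae ?_
  filter_upwards [hv] with x hx _ using hx.symm

omit [CompleteSpace E] in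
theorem locallyIntegrable (h : IsPrimitive u u') : LocallyIntegrable u' volume := by
  rw [MeasureTheory.locallyIntegrable_iff]
  intro k hk
  obtain ⟨a, b, hab⟩ : ∃ a b : ℝ, k ⊆ Ioc a b := by
    obtain ⟨r, hr⟩ := hk.isBounded.subset_ball 0
    refine ⟨-r, r, fun x hx => ?_⟩
    have := hr hx
    rw [Real.ball_eq_Ioo] at this
    exact ⟨by linarith [this.1], by linarith [this.2]⟩
  exact ((h.1 a b).1).mono_set hab

omit [CompleteSpace E] in
theorem _root_.isPrimitive_intervalIntegral (h : LocallyIntegrable u' volume) (c : ℝ) :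
    IsPrimitive (fun x => ∫ t in c..x, u' t) u' := by
  have hi : ∀ a b, IntervalIntegrable u' volume a b := fun a b =>
    (h.integrableOn_isCompact isCompact_uIcc).intervalIntegrable
  refine ⟨hi, fun a b => ?_⟩
  rw [intervalIntegral.integral_interval_sub_left (hi _ _) (hi _ _)]

omit [CompleteSpace E] in
theorem absolutelyContinuous (h : IsPrimitive u u') (a b : ℝ) :
    AbsolutelyContinuousOnInterval u a b := by
  have hr := (h.1 a b).norm.absolutelyContinuousOnInterval_intervalIntegral (c := a) (by simp)
  refine squeeze_zero (fun t => Finset.sum_nonneg fun _ _ => dist_nonneg) (fun t => ?_) hr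
  refine Finset.sum_le_sum fun i _ => ?_
  rw [dist_comm, dist_eq_norm, ← h.2, dist_comm, Real.dist_eq,
    intervalIntegral.integral_interval_sub_left (h.1 _ _).norm (h.1 _ _).norm]
  exact intervalIntegral.norm_integral_le_abs_integral_norm

omit [CompleteSpace E] in
theorem continuous (h : IsPrimitive u u') : Continuous u := by
  rw [continuous_iff_continuousAt]
  intro x
  have := (h.absolutelyContinuous (x - 1) (x + 1)).continuousOn
  rw [uIcc_of_le (by linarith)] at this
  exact this.continuousAt (Icc_mem_nhds (by linarith) (by linarith))

theorem ae_hasDerivAt (h : IsPrimitive u u') : ∀ᵐ x, HasDerivAt u (u' x) x := by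
  filter_upwards [_root_.LocallyIntegrable.ae_hasDerivAt_integral h.locallyIntegrable] with x hx
  have := (hx 0).add_const (u 0)
  refine this.congr_of_eventuallyEq (Eventually.of_forall fun y => ?_)
  simp [h.2 0 y]

/-- Subtracting the integral of `u'` leaves an absolutely continuous function with derivative zero
almost everywhere, hence a constant. Products and exponentials are treated through this criterion.
-/
theorem of_absolutelyContinuous (hac : ∀ a b, AbsolutelyContinuousOnInterval u a b)
    (hu : ∀ᵐ x, HasDerivAt u (u' x) x) (hi : LocallyIntegrable u' volume) :
    IsPrimitive u u' := by
  have hp := isPrimitive_intervalIntegral hi 0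
  refine ⟨hp.1, fun a b => ?_⟩
  have hg : AbsolutelyContinuousOnInterval (fun x => u x - ∫ t in (0 : ℝ)..x, u' t) a b :=
    (hac a b).fun_sub (hp.absolutelyContinuous a b)
  obtain ⟨C, hC⟩ := hg.const_of_ae_hasDerivAt_zero (by
    filter_upwards [hu, hp.ae_hasDerivAt] with x h1 h2 _
    simpa using h1.fun_sub h2)
  have h1 := hC a (by simp)
  have h2 := hC b (by simp)
  rw [hp.2 a b]
  rw [← h1] at h2
  rw [sub_eq_sub_iff_sub_eq_sub] at h2
  exact h2.symm

omit [CompleteSpace E] in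
theorem add (h : IsPrimitive u u') (h' : IsPrimitive v v') :
    IsPrimitive (fun x => u x + v x) (fun x => u' x + v' x) := by
  refine ⟨fun a b => (h.1 a b).add (h'.1 a b), fun a b => ?_⟩
  rw [intervalIntegral.integral_add (h.1 a b) (h'.1 a b), h.2, h'.2]; exact (add_sub_add_comm _ _ _ _).symm

omit [CompleteSpace E] in
theorem sub (h : IsPrimitive u u') (h' : IsPrimitive v v') :
    IsPrimitive (fun x => u x - v x) (fun x => u' x - v' x) := by
  refine ⟨fun a b => (h.1 a b).sub (h'.1 a b), fun a b => ?_⟩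
  rw [intervalIntegral.integral_sub (h.1 a b) (h'.1 a b), h.2, h'.2]; exact sub_sub_sub_comm _ _ _ _

theorem clm_comp (L : E →L[ℝ] F) (h : IsPrimitive u u') :
    IsPrimitive (fun x => L (u x)) (fun x => L (u' x)) := by
  refine ⟨fun a b => ⟨L.integrable_comp (h.1 a b).1, L.integrable_comp (h.1 a b).2⟩,
    fun a b => ?_⟩
  rw [L.intervalIntegral_comp_comm (h.1 a b), h.2, map_sub]

theorem mul {A : Type*} [NormedRing A] [NormedAlgebra ℝ A] [NormMulClass A] [CompleteSpace A]
    {u u' v v' : ℝ → A}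
    (h : IsPrimitive u u') (h' : IsPrimitive v v') :
    IsPrimitive (fun x => u x * v x) (fun x => u' x * v x + u x * v' x) := by
  refine of_absolutelyContinuous
    (fun a b => (h.absolutelyContinuous a b).fun_smul (h'.absolutelyContinuous a b)) ?_ ?_
  · filter_upwards [h.ae_hasDerivAt, h'.ae_hasDerivAt] with x h1 h2 using h1.mul h2
  · rw [MeasureTheory.locallyIntegrable_iff]
    intro k hk
    have h1 := h.locallyIntegrable.integrableOn_isCompact hk
    have h2 := h'.locallyIntegrable.integrableOn_isCompact hk
    exact (h1.mul_continuousOn h'.continuous.continuousOn hk).add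
      (h2.continuousOn_mul h.continuous.continuousOn hk)

theorem norm_sq {u u' : ℝ → ℂ} (h : IsPrimitive u u') :
    IsPrimitive (fun x => ‖u x‖ ^ 2) (fun x => 2 * (starRingEnd ℂ (u x) * u' x).re) := by
  have h1 := (h.clm_comp (Complex.conjCLE : ℂ →L[ℝ] ℂ)).mul h
  have h2 := h1.clm_comp Complex.reCLM
  convert h2 using 2 with x x
  · simp [Complex.sq_norm, Complex.normSq_apply]
  · simp; ring

/-- Composition with the exponential keeps absolute continuity on an interval because `K` is bounded
there, by `C` say, and the exponential is Lipschitz with constant e^C on (-∞, C]. -/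
theorem exp {k K : ℝ → ℝ} (h : IsPrimitive K k) :
    IsPrimitive (fun x => Real.exp (K x)) (fun x => k x * Real.exp (K x)) := by
  refine of_absolutelyContinuous (fun a b => ?_) ?_ ?_
  · have hac := h.absolutelyContinuous a b
    obtain ⟨C, hC⟩ := hac.exists_bound
    have h0 := hac.const_mul (Real.exp C)
    refine squeeze_zero' (Eventually.of_forall fun t => Finset.sum_nonneg fun _ _ => dist_nonneg)
      ?_ h0
    filter_upwards [mem_inf_of_right (mem_principal_self _)] with t ht
    refine Finset.sum_le_sum fun i hi => ?_
    rw [Real.dist_eq, Real.dist_eq, ← mul_sub, abs_mul, abs_of_pos (Real.exp_pos C)]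
    have key : ∀ p q : ℝ, p ≤ C → q ≤ C → |Real.exp p - Real.exp q| ≤ Real.exp C * |p - q| := by
      have key1 : ∀ p q : ℝ, p ≤ C → q ≤ p →
          |Real.exp p - Real.exp q| ≤ Real.exp C * |p - q| := by
        intro p q hp hqp
        rw [abs_of_nonneg (by simpa using hqp), abs_of_nonneg (by linarith)]
        have h1 : Real.exp q = Real.exp p * Real.exp (q - p) := by
          rw [← Real.exp_add]; ring_nf
        have h2 := Real.add_one_le_exp (q - p)
        have h3 : Real.exp p ≤ Real.exp C := Real.exp_le_exp.2 hp
        have h4 := Real.exp_pos p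
        nlinarith
      intro p q hp hq
      rcases le_total q p with h | h
      · exact key1 p q hp h
      · rw [abs_sub_comm, abs_sub_comm p]; exact key1 q p hq h
    exact key _ _ ((le_abs_self _).trans (hC _ (ht.1 i hi).1))
      ((le_abs_self _).trans (hC _ (ht.1 i hi).2))
  · filter_upwards [h.ae_hasDerivAt] with x hx
    simpa [mul_comm] using hx.exp
  · rw [MeasureTheory.locallyIntegrable_iff]
    intro k hk
    exact (h.locallyIntegrable.integrableOn_isCompact hk).mul_continuousOn
      (Real.continuous_exp.comp h.continuous).continuousOn hk

end IsPrimitive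

/-! ### Integrable functions on the whole line and Grönwall's inequality from infinity. -/

/-- An integrable nonnegative function on the line has arbitrarily small values arbitrarily far to
the right. -/
theorem exists_lt_of_integrable {e : ℝ → ℝ} (hi : Integrable e)
    {δ : ℝ} (hδ : 0 < δ) (x : ℝ) : ∃ X, x ≤ X ∧ e X < δ := by
  by_contra! hcon
  have h1 : IntegrableOn (fun _ : ℝ => δ) (Ici x) := by
    refine (hi.integrableOn (s := Ici x)).mono' (by fun_prop) ?_
    rw [ae_restrict_iff' measurableSet_Ici]
    exact Eventually.of_forall fun y hy => by
      rw [Real.norm_of_nonneg hδ.le]; exact hcon y hy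
  rw [integrableOn_const_iff] at h1
  simp [hδ.ne'] at h1

/-- Grönwall's inequality from infinity. -/
theorem IsPrimitive.le_exp_mul_integral {e e' k g : ℝ → ℝ} (h : IsPrimitive e e')
    (hi : Integrable e) (he : ∀ x, 0 ≤ e x) (hk : Integrable k) (hk0 : 0 ≤ᵐ[volume] k)
    (hg : Integrable g) (hg0 : 0 ≤ᵐ[volume] g)
    (hle : ∀ᵐ x, |e' x| ≤ k x * e x + g x) (x : ℝ) :
    e x ≤ Real.exp (∫ t, k t) * ∫ t, g t := by
  refine le_of_forall_pos_lt_add fun δ hδ => ?_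
  set I := ∫ t, k t
  have hI := Real.exp_pos I
  -- The value at X serves as initial value; it is small enough to stay below δ after multiplication
  -- by the full Grönwall factor.
  obtain ⟨X, hxX, hX⟩ := exists_lt_of_integrable hi (δ := δ / Real.exp I) (by positivity) x
  have hK := isPrimitive_intervalIntegral hk.locallyIntegrable x
  -- The integrating factor is the exponential of the integral of `k` from x, equal to 1 at x. The
  -- derivative of its product with `e` is at least -exp(I) g on [x, X].
  have hp := hK.exp.mul h
  have hKle : ∀ t, x ≤ t → ∫ s in x..t, k s ≤ I := fun t ht => by
    rw [intervalIntegral.integral_of_le ht]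
    exact setIntegral_le_integral hk hk0
  have hKnn : ∀ t, x ≤ t → 0 ≤ ∫ s in x..t, k s := fun t ht => by
    rw [intervalIntegral.integral_of_le ht]
    exact setIntegral_nonneg_of_ae hk0
  have h2 := hp.2 x X
  have h3 : ∫ t in x..X, -(Real.exp I * g t) ≤ _ := intervalIntegral.integral_mono_ae_restrict
    hxX ((hg.const_mul _).neg.intervalIntegrable) (hp.1 x X) (by
      rw [EventuallyLE, ae_restrict_iff' measurableSet_Icc]
      filter_upwards [hle, hg0] with t ht hgt htI
      have h4 := Real.exp_le_exp.2 (hKle t htI.1)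
      have h5 : 1 ≤ Real.exp (∫ s in x..t, k s) := Real.one_le_exp (hKnn t htI.1)
      have h6 := (abs_le.1 ht).1
      simp only [Pi.zero_apply] at hgt
      have h7 : Real.exp (∫ s in x..t, k s) * (-(k t * e t + g t))
          ≤ Real.exp (∫ s in x..t, k s) * e' t := by gcongr
      nlinarith)
  rw [h2] at h3
  have h8 : ∫ t in x..X, g t ≤ ∫ t, g t := by
    rw [intervalIntegral.integral_of_le hxX]
    exact setIntegral_le_integral hg hg0
  rw [intervalIntegral.integral_neg, intervalIntegral.integral_const_mul] at h3
  simp only [intervalIntegral.integral_same, Real.exp_zero, one_mul] at h3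
  have h9 : Real.exp (∫ s in x..X, k s) * e X ≤ Real.exp I * e X :=
    mul_le_mul_of_nonneg_right (Real.exp_le_exp.2 (hKle X hxX)) (he X)
  have h10 : Real.exp I * e X < δ := by
    rw [lt_div_iff₀ hI] at hX; linarith
  have h11 : Real.exp I * ∫ t in x..X, g t ≤ Real.exp I * ∫ t, g t := by gcongr
  linarith

/-- If an integrable function has an integrable derivative then the latter has integral zero. -/
theorem IsPrimitive.integral_eq_zero {E : Type*} [NormedAddCommGroup E] [NormedSpace ℝ E]
    [CompleteSpace E] {w w' : ℝ → E} (h : IsPrimitive w w')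
    (hw : Integrable w) (hw' : Integrable w') : ∫ x, w' x = 0 := by
  have hlim : ∀ x, w x = w 0 + ∫ t in (0 : ℝ)..x, w' t := fun x => by rw [h.2]; abel
  have hT := intervalIntegral_tendsto_integral_Ioi 0 (hw'.integrableOn) tendsto_id
  have hB := intervalIntegral_tendsto_integral_Iic 0 (hw'.integrableOn) tendsto_id
  -- The limit of `w` at either end exists because `w'` is integrable. It is zero, since otherwise
  -- |w| would exceed half its size on a set of infinite measure.
  have key : ∀ (l : Filter ℝ) (L : E), Tendsto w l (𝓝 L) →
      (∀ A ∈ l, volume A = ⊤) → L = 0 := by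
    intro l L hL hA
    by_contra hne
    have hpos : 0 < ‖L‖ / 2 := by have := norm_pos_iff.2 hne; linarith
    have hev : {x | ‖L‖ / 2 < ‖w x‖} ∈ l := by
      have := hL.norm
      exact this.eventually (lt_mem_nhds (by linarith))
    have h1 := hw.norm.measure_gt_lt_top hpos
    rw [hA _ hev] at h1
    exact lt_irrefl _ h1
  have hTop : w 0 + ∫ t in Ioi 0, w' t = 0 := by
    refine key atTop _ ?_ ?_
    · rw [show w = fun x => w 0 + ∫ t in (0 : ℝ)..x, w' t from funext hlim]
      simpa using hT.const_add (w 0)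
    · intro A hA
      obtain ⟨x, hx⟩ := mem_atTop_sets.1 hA
      refine top_le_iff.1 ?_
      calc ⊤ = volume (Ici x) := by simp
        _ ≤ volume A := measure_mono hx
  have hBot : w 0 - ∫ t in Iic 0, w' t = 0 := by
    refine key atBot _ ?_ ?_
    · have : w = fun x => w 0 - ∫ t in x..(0 : ℝ), w' t := by
        funext x; rw [h.2]; abel
      rw [this]
      simpa using hB.const_sub (w 0)
    · intro A hA
      obtain ⟨x, hx⟩ := mem_atBot_sets.1 hA
      refine top_le_iff.1 ?_
      calc ⊤ = volume (Iic x) := by simp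
        _ ≤ volume A := measure_mono hx
  have h1 := intervalIntegral.integral_Iic_add_Ioi (hw'.integrableOn (s := Iic 0))
    (hw'.integrableOn (s := Ioi 0))
  rw [← h1]
  have h2 := sub_eq_zero.1 hBot
  rw [← h2, hTop]

/-! ### Weak derivatives on the line. -/

theorem isPrimitive_ofReal_of_contDiff {φ : ℝ → ℝ} (hφ : ContDiff ℝ ∞ φ) :
    IsPrimitive (fun x => (φ x : ℂ)) (fun x => ((deriv φ x : ℝ) : ℂ)) := by
  have hc : Continuous (deriv φ) := hφ.continuous_deriv (by simp)
  have h : IsPrimitive φ (deriv φ) := by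
    refine ⟨fun a b => hc.intervalIntegrable a b, fun a b => ?_⟩
    exact intervalIntegral.integral_deriv_eq_sub
      (fun x _ => (hφ.differentiable (by simp)).differentiableAt) (hc.intervalIntegrable a b)
  exact h.clm_comp Complex.ofRealCLM

theorem integrable_ofReal_mul {φ : ℝ → ℝ} (hφ : Continuous φ) (hs : HasCompactSupport φ)
    {u : ℝ → ℂ} (hu : LocallyIntegrable u volume) : Integrable fun x => (φ x : ℂ) * u x := by
  simpa using hu.integrable_smul_left_of_hasCompactSupport hφ hs


/-- The product of `u` with a test function is integrable with integrable derivative, so the latter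
has integral zero. -/
theorem IsPrimitive.hasWeakDeriv {u u' : ℝ → ℂ} (h : IsPrimitive u u') : HasWeakDeriv u u' := by
  refine ⟨h.continuous.locallyIntegrable, h.locallyIntegrable, fun φ hφ hs => ?_⟩
  have hc : Continuous (deriv φ) := hφ.continuous_deriv (by simp)
  have h1 := integrable_ofReal_mul hc hs.deriv h.continuous.locallyIntegrable
  have h2 := integrable_ofReal_mul hφ.continuous hs h.locallyIntegrable
  have h3 := integrable_ofReal_mul hφ.continuous hs h.continuous.locallyIntegrable
  have h4 := ((isPrimitive_ofReal_of_contDiff hφ).mul h).integral_eq_zero h3 (h1.add h2)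
  rw [integral_add h1 h2] at h4
  exact eq_neg_of_add_eq_zero_left h4

/-- A smooth function of compact support and mean zero is the derivative of such a function. -/
theorem exists_deriv_eq_of_integral_eq_zero {ψ : ℝ → ℝ} (hψ : ContDiff ℝ ∞ ψ)
    (hs : HasCompactSupport ψ) (h0 : ∫ x, ψ x = 0) :
    ∃ φ : ℝ → ℝ, ContDiff ℝ ∞ φ ∧ HasCompactSupport φ ∧ deriv φ = ψ := by
  obtain ⟨r, hr⟩ := hs.isCompact.isBounded.subset_closedBall 0
  rw [Real.closedBall_eq_Icc] at hr
  have hzero : ∀ x, x ∉ Icc (0 - r) (0 + r) → ψ x = 0 := fun x hx =>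
    image_eq_zero_of_notMem_tsupport fun h => hx (hr h)
  have hd : ∀ x, HasDerivAt (fun x => ∫ t in (0 - r)..x, ψ t) (ψ x) x := fun x =>
    intervalIntegral.integral_hasDerivAt_right (hψ.continuous.intervalIntegrable _ _)
      (hψ.continuous.stronglyMeasurableAtFilter _ _) hψ.continuous.continuousAt
  have hderiv : deriv (fun x => ∫ t in (0 - r)..x, ψ t) = ψ := funext fun x => (hd x).deriv
  refine ⟨fun x => ∫ t in (0 - r)..x, ψ t, ?_, ?_, hderiv⟩
  · rw [contDiff_infty_iff_deriv, hderiv]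
    exact ⟨fun x => (hd x).differentiableAt, hψ⟩
  · refine HasCompactSupport.of_support_subset_isCompact (K := Icc (0 - r) (0 + r))
      isCompact_Icc fun x hx => ?_
    by_contra hxn
    refine hx ?_
    rcases lt_or_ge x (0 - r) with hlt | hge
    · change ∫ t in (0 - r)..x, ψ t = 0
      rw [intervalIntegral.integral_of_ge hlt.le, setIntegral_eq_zero_of_ae_eq_zero, neg_zero]
      have : ∀ᵐ t : ℝ, t ≠ 0 - r := by simp [ae_iff]
      filter_upwards [this] with t ht hmem
      exact hzero t fun h => ht (le_antisymm hmem.2 h.1)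
    · have hxr : 0 + r < x := by
        by_contra! h; exact hxn ⟨hge, h⟩
      change ∫ t in (0 - r)..x, ψ t = 0
      rw [intervalIntegral.integral_of_le hge]
      refine (setIntegral_eq_integral_of_ae_compl_eq_zero ?_).trans h0
      have : ∀ᵐ t : ℝ, t ≠ 0 - r := by simp [ae_iff]
      filter_upwards [this] with t ht hmem
      refine hzero t fun h => hmem ⟨lt_of_le_of_ne h.1 ht.symm, h.2.trans hxr.le⟩

/-- The lemma of du Bois-Reymond. -/
theorem exists_ae_eq_const {v : ℝ → ℂ} (hv : LocallyIntegrable v volume)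
    (h : ∀ φ : ℝ → ℝ, ContDiff ℝ ∞ φ → HasCompactSupport φ →
      ∫ x, ((deriv φ x : ℝ) : ℂ) * v x = 0) : ∃ c : ℂ, ∀ᵐ x, v x = c := by
  let f : ContDiffBump (0 : ℝ) := default
  set η : ℝ → ℝ := f.normed volume
  have hη : ContDiff ℝ ∞ η := f.contDiff_normed
  have hηs : HasCompactSupport η := f.hasCompactSupport_normed
  have hη1 : ∫ x, η x = 1 := f.integral_normed
  refine ⟨∫ x, (η x : ℂ) * v x, ?_⟩
  refine ae_eq_of_integral_contDiff_smul_eq hv (locallyIntegrable_const _) fun ψ hψ hψs => ?_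
  set m := ∫ x, ψ x
  -- Since η has integral one, ψ minus its mean times η has mean zero, hence is the derivative of a
  -- test function. This forces the constant to be ∫ηv.
  obtain ⟨φ, h1, h2, h3⟩ := exists_deriv_eq_of_integral_eq_zero
    (ψ := fun x => ψ x - m * η x) (hψ.sub (contDiff_const.mul hη)) (hψs.sub hηs.mul_left) (by
      rw [integral_sub (hψ.continuous.integrable_of_hasCompactSupport hψs)
        ((hη.continuous.integrable_of_hasCompactSupport hηs).const_mul _),
        integral_const_mul, hη1]
      simp [m])
  have h4 := h φ h1 h2
  rw [h3] at h4
  have i1 := integrable_ofReal_mul hψ.continuous hψs hv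
  have i2 := integrable_ofReal_mul hη.continuous hηs hv
  have h5 : ∀ x, ((ψ x - m * η x : ℝ) : ℂ) * v x = (ψ x : ℂ) * v x - m * ((η x : ℂ) * v x) := by
    intro x; push_cast; ring
  simp_rw [h5] at h4
  rw [integral_sub i1 (i2.const_mul _), integral_const_mul, sub_eq_zero] at h4
  simp only [Complex.real_smul]
  rw [h4, integral_mul_const]
  congr 1
  exact integral_ofReal.symm

/-- A function with a weak derivative agrees almost everywhere with a primitive of the latter. -/
theorem MagSchro.HasWeakDeriv.exists_isPrimitive {u u' : ℝ → ℂ} (h : HasWeakDeriv u u') :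
    ∃ v, IsPrimitive v u' ∧ u =ᵐ[volume] v := by
  have hp := isPrimitive_intervalIntegral h.2.1 0
  have hp' := hp.hasWeakDeriv
  obtain ⟨c, hc⟩ := exists_ae_eq_const (v := fun x => u x - ∫ t in (0 : ℝ)..x, u' t)
    (h.1.sub hp'.1) fun φ hφ hs => by
      have hc : Continuous (deriv φ) := hφ.continuous_deriv (by simp)
      simp_rw [mul_sub]
      rw [integral_sub (integrable_ofReal_mul hc hs.deriv h.1)
        (integrable_ofReal_mul hc hs.deriv hp'.1), h.2.2 φ hφ hs, hp'.2.2 φ hφ hs, sub_self]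
  refine ⟨fun x => (∫ t in (0 : ℝ)..x, u' t) + c, ⟨hp.1, fun a b => ?_⟩, ?_⟩
  · rw [hp.2]; exact (add_sub_add_right_eq_sub _ _ _).symm
  · filter_upwards [hc] with x hx
    rw [← hx]; ring

theorem MagSchro.HasWeakDeriv.isPrimitive {u u' : ℝ → ℂ} (h : HasWeakDeriv u u')
    (hu : Continuous u) : IsPrimitive u u' := by
  obtain ⟨v, hv, huv⟩ := h.exists_isPrimitive
  rwa [(hu.ae_eq_iff_eq volume hv.continuous).1 huv]

/-- The elementary Sobolev inequality `‖u‖_∞² ≤ 2 ‖u‖ ‖u'‖`, before Cauchy-Schwarz. -/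
theorem IsPrimitive.norm_sq_le {u u' : ℝ → ℂ} (h : IsPrimitive u u') (hu : MemLp u 2)
    (hu' : MemLp u' 2) (x : ℝ) : ‖u x‖ ^ 2 ≤ 2 * ∫ t, ‖u t‖ * ‖u' t‖ := by
  have hg : Integrable fun t => ‖u t‖ * ‖u' t‖ := hu.norm.integrable_mul hu'.norm
  have := h.norm_sq.le_exp_mul_integral (k := 0) (g := fun t => 2 * (‖u t‖ * ‖u' t‖))
    (by simpa using hu.integrable_norm_pow (by simp)) (fun x => by positivity)
    (integrable_zero _ _ _) (by rfl)
    (hg.const_mul 2) (Eventually.of_forall fun x => by positivity)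
    (Eventually.of_forall fun x => by
      rw [abs_mul, abs_two]
      simp only [Pi.zero_apply, zero_mul, zero_add]
      gcongr
      refine (Complex.abs_re_le_norm _).trans ?_
      simp) x
  simpa [integral_const_mul] using this

/-! ### The first order system: pairing identity and energy estimate. -/

/-- Real coefficients of the first order system
`h u' = a Φ + a w u - i a b u`, `h Φ' = -i a b Φ - a w Φ - (a P + r + i ε γ) u - γ f`. -/
structure SystemCoefficients where
  a : ℝ → ℝ
  b : ℝ → ℝ
  w : ℝ → ℝ
  P : ℝ → ℝ
  P' : ℝ → ℝ
  r : ℝ → ℝ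
  γ : ℝ → ℝ

namespace SystemCoefficients

/-- The derivative of `u` prescribed by the system. -/
noncomputable def rhsU (q : SystemCoefficients) (h : ℝ) (u Φ : ℝ → ℂ) (x : ℝ) : ℂ :=
  (h : ℂ)⁻¹ * (q.a x * Φ x + q.a x * q.w x * u x - Complex.I * q.a x * q.b x * u x)

/-- The derivative of `Φ` prescribed by the system. -/
noncomputable def rhsΦ (q : SystemCoefficients) (h ε : ℝ) (f u Φ : ℝ → ℂ) (x : ℝ) : ℂ :=
  (h : ℂ)⁻¹ * (-Complex.I * q.a x * q.b x * Φ x - q.a x * q.w x * Φ x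
    - (q.a x * q.P x + q.r x + Complex.I * ε * q.γ x) * u x - q.γ x * f x)

/-- `(u, Φ)` is a square integrable solution of the system. -/
structure IsSolution (q : SystemCoefficients) (h ε : ℝ) (f u Φ : ℝ → ℂ) : Prop where
  u_L2 : MemLp u 2
  Φ_L2 : MemLp Φ 2
  u_prim : IsPrimitive u (q.rhsU h u Φ)
  Φ_prim : IsPrimitive Φ (q.rhsΦ h ε f u Φ)

/-- All the bounds on the coefficients that the estimates use, with a single constant `K`. -/
structure Bounded (q : SystemCoefficients) (h K : ℝ) : Prop where
  one_le : 1 ≤ K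
  h_pos : 0 < h
  h_le : h ≤ K
  a_meas : Measurable q.a
  γ_meas : Measurable q.γ
  a_ge : ∀ x, K⁻¹ ≤ q.a x
  a_le : ∀ x, q.a x ≤ K
  γ_ge : ∀ x, K⁻¹ ≤ q.γ x
  γ_le : ∀ x, q.γ x ≤ K
  w_int : Integrable q.w
  w_le : ∫ x, |q.w x| ≤ K * h
  P_prim : IsPrimitive q.P q.P'
  P'_int : Integrable q.P'
  P'_le : ∫ x, |q.P' x| ≤ K
  P_ge : ∀ x, K⁻¹ ≤ q.P x
  P_le : ∀ x, q.P x ≤ K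
  r_int : Integrable q.r
  r_le : ∫ x, |q.r x| ≤ K

variable {q : SystemCoefficients} {h K ε : ℝ} {f u Φ : ℝ → ℂ}

theorem Bounded.K_pos (hq : q.Bounded h K) : 0 < K := zero_lt_one.trans_le hq.one_le

theorem Bounded.a_pos (hq : q.Bounded h K) (x : ℝ) : 0 < q.a x :=
  (inv_pos.2 hq.K_pos).trans_le (hq.a_ge x)

theorem Bounded.γ_pos (hq : q.Bounded h K) (x : ℝ) : 0 < q.γ x :=
  (inv_pos.2 hq.K_pos).trans_le (hq.γ_ge x)

theorem Bounded.P_pos (hq : q.Bounded h K) (x : ℝ) : 0 < q.P x :=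
  (inv_pos.2 hq.K_pos).trans_le (hq.P_ge x)

theorem re_conj_mul_rhsU (q : SystemCoefficients) (h : ℝ) (u Φ : ℝ → ℂ) (x : ℝ) :
    (starRingEnd ℂ (u x) * q.rhsU h u Φ x).re =
      h⁻¹ * (q.a x * (starRingEnd ℂ (Φ x) * u x).re + q.a x * q.w x * ‖u x‖ ^ 2) := by
  rw [Complex.sq_norm, Complex.normSq_apply, rhsU, ← Complex.ofReal_inv]
  simp
  ring

/-- The magnetic term is imaginary and drops out. The cross term carrying `a P` is the one that the
derivative of P|u|² cancels in the energy. -/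
theorem re_conj_mul_rhsΦ (q : SystemCoefficients) (h ε : ℝ) (f u Φ : ℝ → ℂ) (x : ℝ) :
    (starRingEnd ℂ (Φ x) * q.rhsΦ h ε f u Φ x).re =
      h⁻¹ * (-q.a x * q.w x * ‖Φ x‖ ^ 2
        - (q.a x * q.P x + q.r x) * (starRingEnd ℂ (Φ x) * u x).re
        + ε * q.γ x * (starRingEnd ℂ (Φ x) * u x).im
        - q.γ x * (starRingEnd ℂ (Φ x) * f x).re) := by
  rw [Complex.sq_norm, Complex.normSq_apply, rhsΦ, ← Complex.ofReal_inv]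
  simp
  ring

theorem abs_re_conj_mul_le (y z : ℂ) : |(starRingEnd ℂ y * z).re| ≤ ‖y‖ * ‖z‖ :=
  (Complex.abs_re_le_norm _).trans (by simp)

theorem abs_im_conj_mul_le (y z : ℂ) : |(starRingEnd ℂ y * z).im| ≤ ‖y‖ * ‖z‖ :=
  (Complex.abs_im_le_norm _).trans (by simp)

theorem integral_norm_mul_nonneg (y z : ℝ → ℂ) : 0 ≤ ∫ x, ‖y x‖ * ‖z x‖ :=
  integral_nonneg fun _ => by positivity

/-- Grönwall for |u|² alone: only `w` multiplies |u|², with weight 2K/h, and ∫|w| ≤ Kh makes the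
exponential factor independent of h. The price is the factor 1/h in front of the source. -/
theorem IsSolution.norm_sq_u_le (hs : q.IsSolution h ε f u Φ) (hq : q.Bounded h K) (x : ℝ) :
    ‖u x‖ ^ 2 ≤ Real.exp (2 * K ^ 2) * (2 * K / h * ∫ t, ‖u t‖ * ‖Φ t‖) := by
  have hh := hq.h_pos
  have hK := hq.K_pos
  have hg : Integrable fun t => ‖u t‖ * ‖Φ t‖ := hs.u_L2.norm.integrable_mul hs.Φ_L2.norm
  have h1 := hs.u_prim.norm_sq.le_exp_mul_integral (k := fun t => 2 * K / h * |q.w t|)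
    (g := fun t => 2 * K / h * (‖u t‖ * ‖Φ t‖))
    (by simpa using hs.u_L2.integrable_norm_pow (by simp)) (fun x => by positivity)
    (hq.w_int.abs.const_mul _) (Eventually.of_forall fun x => by positivity)
    (hg.const_mul _) (Eventually.of_forall fun x => by positivity)
    (Eventually.of_forall fun x => by
      rw [re_conj_mul_rhsU]
      have e1 := abs_re_conj_mul_le (Φ x) (u x)
      have e2 : |q.a x * (starRingEnd ℂ (Φ x) * u x).re| ≤ K * (‖Φ x‖ * ‖u x‖) := by
        rw [abs_mul, abs_of_pos (hq.a_pos x)]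
        exact mul_le_mul (hq.a_le x) e1 (abs_nonneg _) hK.le
      have e3 : |q.a x * q.w x * ‖u x‖ ^ 2| ≤ K * |q.w x| * ‖u x‖ ^ 2 := by
        rw [abs_mul, abs_mul, abs_of_pos (hq.a_pos x), abs_of_nonneg (sq_nonneg ‖u x‖)]
        gcongr
        exact hq.a_le x
      rw [abs_mul, abs_mul, abs_two, abs_of_pos (inv_pos.2 hh)]
      calc 2 * (h⁻¹ * |q.a x * (starRingEnd ℂ (Φ x) * u x).re + q.a x * q.w x * ‖u x‖ ^ 2|)
          ≤ 2 * (h⁻¹ * (K * (‖Φ x‖ * ‖u x‖) + K * |q.w x| * ‖u x‖ ^ 2)) := by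
            gcongr
            exact (abs_add_le _ _).trans (add_le_add e2 e3)
        _ = _ := by field_simp; ring) x
  rw [integral_const_mul, integral_const_mul] at h1
  refine h1.trans ?_
  have h2 := integral_norm_mul_nonneg u Φ
  have h3 : 2 * K / h * ∫ t, |q.w t| ≤ 2 * K ^ 2 :=
    calc 2 * K / h * ∫ t, |q.w t| ≤ 2 * K / h * (K * h) := by gcongr; exact hq.w_le
      _ = 2 * K ^ 2 := by field_simp
  gcongr

/-- The derivative of the pairing `ū Φ`. -/
theorem pairing_deriv_eq (q : SystemCoefficients) (h ε : ℝ) (f u Φ : ℝ → ℂ) (x : ℝ) :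
    starRingEnd ℂ (q.rhsU h u Φ x) * Φ x + starRingEnd ℂ (u x) * q.rhsΦ h ε f u Φ x =
      (h : ℂ)⁻¹ * (((q.a x * ‖Φ x‖ ^ 2 - q.a x * q.P x * ‖u x‖ ^ 2 - q.r x * ‖u x‖ ^ 2 : ℝ) : ℂ)
        - Complex.I * ε * (q.γ x * ‖u x‖ ^ 2 : ℝ) - starRingEnd ℂ (u x) * (q.γ x * f x)) := by
  rw [rhsU, rhsΦ]
  have e1 : ((‖Φ x‖ ^ 2 : ℝ) : ℂ) = starRingEnd ℂ (Φ x) * Φ x := by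
    rw [mul_comm, Complex.mul_conj, Complex.sq_norm]
  have e2 : ((‖u x‖ ^ 2 : ℝ) : ℂ) = starRingEnd ℂ (u x) * u x := by
    rw [mul_comm, Complex.mul_conj, Complex.sq_norm]
  push_cast at e1 e2 ⊢
  rw [e1, e2]
  simp only [map_mul, map_sub, map_add, map_inv₀, Complex.conj_ofReal, Complex.conj_I]
  ring

theorem integrable_mul_norm_sq {c : ℝ → ℝ} (hc : Measurable c)
    {C : ℝ} (hC : ∀ x, |c x| ≤ C) {v : ℝ → ℂ} (hv : MemLp v 2) :
    Integrable fun x => c x * ‖v x‖ ^ 2 := by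
  have h1 : Integrable fun x => ‖v x‖ ^ 2 := by simpa using hv.integrable_norm_pow (by simp)
  exact h1.bdd_mul (c := C) hc.aestronglyMeasurable (Eventually.of_forall hC)

/-- The derivative of ūΦ has integral zero, and the terms with `b` and `w` cancel in it. The
function r|u|² is integrable because `u` is bounded. -/
theorem IsSolution.integral_pairing (hs : q.IsSolution h ε f u Φ) (hq : q.Bounded h K)
    (hf : MemLp f 2) :
    Integrable (fun x => q.r x * ‖u x‖ ^ 2) ∧
    (((∫ x, q.a x * ‖Φ x‖ ^ 2) - (∫ x, q.a x * q.P x * ‖u x‖ ^ 2)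
        - (∫ x, q.r x * ‖u x‖ ^ 2) : ℝ) : ℂ)
      - Complex.I * ε * ((∫ x, q.γ x * ‖u x‖ ^ 2 : ℝ) : ℂ)
      - ∫ x, starRingEnd ℂ (u x) * (q.γ x * f x) = 0 := by
  have hK := hq.K_pos
  have hPm : Measurable q.P := hq.P_prim.continuous.measurable
  have i1 : Integrable fun x => q.a x * ‖Φ x‖ ^ 2 :=
    integrable_mul_norm_sq hq.a_meas (C := K)
      (fun x => by rw [abs_of_pos (hq.a_pos x)]; exact hq.a_le x) hs.Φ_L2
  have i2 : Integrable fun x => q.a x * q.P x * ‖u x‖ ^ 2 :=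
    integrable_mul_norm_sq (hq.a_meas.mul hPm) (C := K * K)
      (fun x => by
        rw [Pi.mul_apply, abs_mul, abs_of_pos (hq.a_pos x), abs_of_pos (hq.P_pos x)]
        exact mul_le_mul (hq.a_le x) (hq.P_le x) (hq.P_pos x).le hK.le) hs.u_L2
  have i4 : Integrable fun x => q.γ x * ‖u x‖ ^ 2 :=
    integrable_mul_norm_sq hq.γ_meas (C := K)
      (fun x => by rw [abs_of_pos (hq.γ_pos x)]; exact hq.γ_le x) hs.u_L2
  have i3 : Integrable fun x => q.r x * ‖u x‖ ^ 2 := by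
    refine hq.r_int.mul_bdd (c := Real.exp (2 * K ^ 2) * (2 * K / h * ∫ t, ‖u t‖ * ‖Φ t‖))
      (hs.u_L2.1.norm.pow 2) (Eventually.of_forall fun x => ?_)
    rw [Real.norm_of_nonneg (by positivity)]
    exact hs.norm_sq_u_le hq x
  have i5 : Integrable fun x => starRingEnd ℂ (u x) * (q.γ x * f x) := by
    have j1 : MemLp (fun x => (q.γ x : ℂ) * f x) 2 := by
      refine hf.of_le_mul (c := K) ((Complex.measurable_ofReal.comp
        hq.γ_meas).aestronglyMeasurable.mul hf.1) (Eventually.of_forall fun x => ?_)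
      rw [norm_mul, Complex.norm_real, Real.norm_of_nonneg (hq.γ_pos x).le]
      gcongr
      exact hq.γ_le x
    exact hs.u_L2.star.integrable_mul j1
  refine ⟨i3, ?_⟩
  have hp := (hs.u_prim.clm_comp (Complex.conjCLE : ℂ →L[ℝ] ℂ)).mul hs.Φ_prim
  have hp2 : IsPrimitive (fun x => starRingEnd ℂ (u x) * Φ x) (fun x => (h : ℂ)⁻¹ *
      (((q.a x * ‖Φ x‖ ^ 2 - q.a x * q.P x * ‖u x‖ ^ 2 - q.r x * ‖u x‖ ^ 2 : ℝ) : ℂ)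
        - Complex.I * ε * (q.γ x * ‖u x‖ ^ 2 : ℝ) - starRingEnd ℂ (u x) * (q.γ x * f x))) := by
    refine hp.congr_deriv (Eventually.of_forall fun x => ?_)
    exact pairing_deriv_eq q h ε f u Φ x
  have j := (((i1.sub i2).sub i3).ofReal (𝕜 := ℂ)).sub ((i4.ofReal (𝕜 := ℂ)).const_mul
    (Complex.I * ε))
  have hz := hp2.integral_eq_zero (hs.u_L2.star.integrable_mul hs.Φ_L2)
    ((j.sub i5).const_mul _)
  rw [integral_const_mul] at hz
  have hh : (h : ℂ)⁻¹ ≠ 0 := inv_ne_zero (by exact_mod_cast hq.h_pos.ne')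
  have hz2 := (mul_eq_zero.1 hz).resolve_left hh
  have k1 := integral_sub j i5
  have k2 := integral_sub (((i1.sub i2).sub i3).ofReal (𝕜 := ℂ)) ((i4.ofReal (𝕜 := ℂ)).const_mul
    (Complex.I * ε))
  have k3 : ∫ x, (q.a x * ‖Φ x‖ ^ 2 - q.a x * q.P x * ‖u x‖ ^ 2 - q.r x * ‖u x‖ ^ 2) =
      (∫ x, q.a x * ‖Φ x‖ ^ 2) - (∫ x, q.a x * q.P x * ‖u x‖ ^ 2)
        - (∫ x, q.r x * ‖u x‖ ^ 2) := by
    have := integral_sub (i1.sub i2) i3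
    rw [integral_sub' i1 i2] at this
    exact this
  rw [← k3, ← integral_complex_ofReal, ← integral_complex_ofReal, ← integral_const_mul]
  rw [← hz2]
  refine Eq.symm (k1.trans ?_)
  congr 1


theorem norm_integral_pairing_le (hq : q.Bounded h K) (hf : MemLp f 2) (hu : MemLp u 2) :
    ‖∫ x, starRingEnd ℂ (u x) * (q.γ x * f x)‖ ≤ K * ∫ x, ‖f x‖ * ‖u x‖ := by
  rw [← integral_const_mul]
  refine norm_integral_le_of_norm_le ((hf.norm.integrable_mul hu.norm).const_mul _)
    (Eventually.of_forall fun x => ?_)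
  rw [norm_mul, norm_mul, RCLike.norm_conj, Complex.norm_real,
    Real.norm_of_nonneg (hq.γ_pos x).le, mul_left_comm, mul_comm ‖u x‖]
  exact mul_le_mul_of_nonneg_right (hq.γ_le x) (by positivity)

/-- Imaginary part of the pairing identity: all coefficients are real, so only the ε term and the
term with `f` survive. -/
theorem IsSolution.eps_mul_le (hs : q.IsSolution h ε f u Φ) (hq : q.Bounded h K)
    (hf : MemLp f 2) :
    |ε| * ∫ x, ‖u x‖ ^ 2 ≤ K ^ 2 * ∫ x, ‖f x‖ * ‖u x‖ := by
  have hK := hq.K_pos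
  obtain ⟨-, hid⟩ := hs.integral_pairing hq hf
  have him := congrArg Complex.im hid
  have h1 : ∫ x, ‖u x‖ ^ 2 ≤ K * ∫ x, q.γ x * ‖u x‖ ^ 2 := by
    rw [← integral_const_mul]
    refine integral_mono_of_nonneg (Eventually.of_forall fun x => by positivity)
      ((integrable_mul_norm_sq hq.γ_meas (C := K)
      (fun x => by rw [abs_of_pos (hq.γ_pos x)]; exact hq.γ_le x) hs.u_L2).const_mul _)
      (Eventually.of_forall fun x => ?_)
    have := hq.γ_ge x
    rw [inv_le_iff_one_le_mul₀ hK] at this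
    have h2 := mul_le_mul_of_nonneg_right this (sq_nonneg ‖u x‖)
    change ‖u x‖ ^ 2 ≤ K * (q.γ x * ‖u x‖ ^ 2)
    linarith
  have h2 := norm_integral_pairing_le (u := u) hq hf hs.u_L2
  set A := ∫ x, starRingEnd ℂ (u x) * (q.γ x * f x)
  set G := ∫ x, q.γ x * ‖u x‖ ^ 2
  have h3 : ε * G = -A.im := by
    simp only [Complex.sub_im, Complex.ofReal_im, Complex.mul_im, Complex.mul_re, Complex.I_re,
      Complex.I_im, Complex.ofReal_re, Complex.zero_im] at him
    linarith
  have hG : 0 ≤ G := integral_nonneg fun x => mul_nonneg (hq.γ_pos x).le (sq_nonneg _)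
  have h4 : |ε| * G ≤ K * ∫ x, ‖f x‖ * ‖u x‖ := by
    rw [← abs_of_nonneg hG, ← abs_mul, h3, abs_neg]
    exact (Complex.abs_im_le_norm A).trans h2
  calc |ε| * ∫ x, ‖u x‖ ^ 2 ≤ |ε| * (K * G) := by gcongr
    _ = K * (|ε| * G) := by ring
    _ ≤ K * (K * ∫ x, ‖f x‖ * ‖u x‖) := by gcongr
    _ = _ := by ring

/-- Real part of the pairing identity. As `r` is merely integrable, its term is estimated with the
supremum of |u|², which brings ∫|u||Φ| back on the right. -/
theorem IsSolution.integral_norm_sq_Φ_le (hs : q.IsSolution h ε f u Φ) (hq : q.Bounded h K)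
    (hf : MemLp f 2) :
    ∫ x, ‖Φ x‖ ^ 2 ≤ K * (K ^ 2 * (∫ x, ‖u x‖ ^ 2)
      + K * (Real.exp (2 * K ^ 2) * (2 * K / h * ∫ t, ‖u t‖ * ‖Φ t‖))
      + K * ∫ x, ‖f x‖ * ‖u x‖) := by
  have hK := hq.K_pos
  have hPm : Measurable q.P := hq.P_prim.continuous.measurable
  have iu : Integrable fun x => ‖u x‖ ^ 2 := by simpa using hs.u_L2.integrable_norm_pow (by simp)
  have i1 : Integrable fun x => q.a x * ‖Φ x‖ ^ 2 :=
    integrable_mul_norm_sq hq.a_meas (C := K)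
      (fun x => by rw [abs_of_pos (hq.a_pos x)]; exact hq.a_le x) hs.Φ_L2
  obtain ⟨i3, hid⟩ := hs.integral_pairing hq hf
  have hre := congrArg Complex.re hid
  have h1 : ∫ x, ‖Φ x‖ ^ 2 ≤ K * ∫ x, q.a x * ‖Φ x‖ ^ 2 := by
    rw [← integral_const_mul]
    refine integral_mono_of_nonneg (Eventually.of_forall fun x => by positivity)
      (i1.const_mul _) (Eventually.of_forall fun x => ?_)
    have := hq.a_ge x
    rw [inv_le_iff_one_le_mul₀ hK] at this
    have h2 := mul_le_mul_of_nonneg_right this (sq_nonneg ‖Φ x‖)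
    change ‖Φ x‖ ^ 2 ≤ K * (q.a x * ‖Φ x‖ ^ 2)
    linarith
  have h2 := norm_integral_pairing_le (u := u) hq hf hs.u_L2
  have h3 : ∫ x, q.a x * q.P x * ‖u x‖ ^ 2 ≤ K ^ 2 * ∫ x, ‖u x‖ ^ 2 := by
    rw [← integral_const_mul]
    refine integral_mono_of_nonneg (Eventually.of_forall fun x =>
      mul_nonneg (mul_nonneg (hq.a_pos x).le (hq.P_pos x).le) (sq_nonneg _))
      (iu.const_mul _) (Eventually.of_forall fun x => ?_)
    change q.a x * q.P x * ‖u x‖ ^ 2 ≤ K ^ 2 * ‖u x‖ ^ 2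
    rw [sq K]
    gcongr
    exacts [(hq.P_pos x).le, hq.a_le x, hq.P_le x]
  set S := Real.exp (2 * K ^ 2) * (2 * K / h * ∫ t, ‖u t‖ * ‖Φ t‖) with hS
  have hS0 : 0 ≤ S := (sq_nonneg _).trans (hs.norm_sq_u_le hq 0)
  have h4 : ∫ x, q.r x * ‖u x‖ ^ 2 ≤ K * S := by
    calc ∫ x, q.r x * ‖u x‖ ^ 2 ≤ ∫ x, |q.r x| * S := by
          refine integral_mono i3 (hq.r_int.abs.mul_const _) fun x => ?_
          change q.r x * ‖u x‖ ^ 2 ≤ |q.r x| * S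
          exact mul_le_mul (le_abs_self _) (hs.norm_sq_u_le hq x) (sq_nonneg _) (abs_nonneg _)
      _ = (∫ x, |q.r x|) * S := integral_mul_const _ _
      _ ≤ K * S := by gcongr; exact hq.r_le
  set A := ∫ x, starRingEnd ℂ (u x) * (q.γ x * f x)
  have h5 : A.re ≤ K * ∫ x, ‖f x‖ * ‖u x‖ :=
    ((le_abs_self _).trans (Complex.abs_re_le_norm A)).trans h2
  refine h1.trans (mul_le_mul_of_nonneg_left ?_ hK.le)
  simp only [Complex.sub_re, Complex.ofReal_im, Complex.mul_im, Complex.mul_re, Complex.I_re,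
      Complex.I_im, Complex.ofReal_re, Complex.zero_re] at hre
  linarith

/-- The energy estimate. -/
theorem IsSolution.energy_le (hs : q.IsSolution h ε f u Φ) (hq : q.Bounded h K)
    (hf : MemLp f 2) (x : ℝ) :
    ‖Φ x‖ ^ 2 + q.P x * ‖u x‖ ^ 2 ≤ Real.exp (4 * K ^ 3 / h) *
      (2 * K / h * (|ε| * (∫ t, ‖u t‖ * ‖Φ t‖) + ∫ t, ‖f t‖ * ‖Φ t‖)) := by
  have hh := hq.h_pos
  have hK := hq.K_pos
  have hPm : Measurable q.P := hq.P_prim.continuous.measurable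
  have iu : Integrable fun x => ‖u x‖ ^ 2 := by simpa using hs.u_L2.integrable_norm_pow (by simp)
  have iΦ : Integrable fun x => ‖Φ x‖ ^ 2 := by simpa using hs.Φ_L2.integrable_norm_pow (by simp)
  have iPu : Integrable fun x => q.P x * ‖u x‖ ^ 2 := integrable_mul_norm_sq hPm (C := K)
      (fun x => by rw [abs_of_pos (hq.P_pos x)]; exact hq.P_le x) hs.u_L2
  have g1 : Integrable fun t => ‖u t‖ * ‖Φ t‖ := hs.u_L2.norm.integrable_mul hs.Φ_L2.norm
  have g2 : Integrable fun t => ‖f t‖ * ‖Φ t‖ := hf.norm.integrable_mul hs.Φ_L2.norm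
  have hkint : Integrable fun t => h⁻¹ * (2 * K * |q.w t| + K * |q.r t|) + K * |q.P' t| :=
    (((hq.w_int.abs.const_mul _).add (hq.r_int.abs.const_mul _)).const_mul _).add
      (hq.P'_int.abs.const_mul _)
  -- Everything quadratic with an integrable coefficient goes into `k`. The ε term has a coefficient
  -- that is not integrable and must be counted as a source.
  have h1 := (hs.Φ_prim.norm_sq.add (hq.P_prim.mul hs.u_prim.norm_sq)).le_exp_mul_integral
    (k := fun t => h⁻¹ * (2 * K * |q.w t| + K * |q.r t|) + K * |q.P' t|)
    (g := fun t => 2 * K / h * (|ε| * (‖u t‖ * ‖Φ t‖) + ‖f t‖ * ‖Φ t‖))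
    (iΦ.add iPu) (fun x => add_nonneg (sq_nonneg _) (mul_nonneg (hq.P_pos x).le (sq_nonneg _)))
    hkint
    (Eventually.of_forall fun x => by positivity)
    (((g1.const_mul _).add g2).const_mul _) (Eventually.of_forall fun x => by positivity)
    (Eventually.of_forall fun x => by
      rw [re_conj_mul_rhsU, re_conj_mul_rhsΦ]
      have hc := abs_re_conj_mul_le (Φ x) (u x)
      have hd := abs_im_conj_mul_le (Φ x) (u x)
      have hk := abs_re_conj_mul_le (Φ x) (f x)
      have hP := hq.P_ge x
      rw [inv_le_iff_one_le_mul₀ hK] at hP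
      have hA := norm_nonneg (Φ x)
      have hB := norm_nonneg (u x)
      have hF := norm_nonneg (f x)
      have ha := hq.a_le x
      have hγ := hq.γ_le x
      have hapos := hq.a_pos x
      have hγpos := hq.γ_pos x
      have hPpos := hq.P_pos x
      have hK1 := hq.one_le
      generalize (starRingEnd ℂ (Φ x) * u x).re = c at *
      generalize (starRingEnd ℂ (Φ x) * u x).im = d at *
      generalize (starRingEnd ℂ (Φ x) * f x).re = k at *
      generalize ‖Φ x‖ = A at *
      generalize ‖u x‖ = B at *
      generalize ‖f x‖ = F at *
      generalize q.a x = a at *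
      generalize q.γ x = γ at *
      generalize q.P x = p at *
      generalize q.P' x = p' at *
      generalize q.r x = r at *
      generalize q.w x = w at *
      have hpB : B ^ 2 ≤ K * (p * B ^ 2) := by nlinarith [sq_nonneg B]
      have t1 : |a * w * (A ^ 2 - p * B ^ 2)| ≤ K * |w| * (A ^ 2 + p * B ^ 2) := by
        rw [abs_mul, abs_mul, abs_of_pos hapos]
        gcongr
        rw [abs_le]
        have : 0 ≤ p * B ^ 2 := by positivity
        constructor <;> nlinarith [sq_nonneg A]
      have t2 : |2 * (r * c)| ≤ |r| * (K * (A ^ 2 + p * B ^ 2)) := by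
        rw [abs_mul, abs_mul, abs_two, mul_left_comm]
        refine mul_le_mul_of_nonneg_left ?_ (abs_nonneg _)
        have h3 : A ^ 2 ≤ K * A ^ 2 := le_mul_of_one_le_left (sq_nonneg A) hK1
        nlinarith [sq_nonneg (A - B)]
      have t3 : |ε * γ * d| ≤ |ε| * K * (A * B) := by
        rw [abs_mul, abs_mul, abs_of_pos hγpos]
        gcongr
      have t4 : |γ * k| ≤ K * (A * F) := by
        rw [abs_mul, abs_of_pos hγpos]
        gcongr
      have t5 : |p' * B ^ 2| ≤ K * |p'| * (A ^ 2 + p * B ^ 2) := by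
        rw [abs_mul, abs_of_nonneg (sq_nonneg B), mul_comm K, mul_assoc]
        refine mul_le_mul_of_nonneg_left ?_ (abs_nonneg _)
        have h3 : 0 ≤ K * A ^ 2 := by positivity
        linarith
      -- Here the two contributions ± a p c cancel; they are the only ones whose coefficient is of
      -- order 1/h without being integrable or multiplied by ε. The two `w` terms combine into the
      -- difference A² - pB².
      have e1 : 2 * (h⁻¹ * (-a * w * A ^ 2 - (a * p + r) * c + ε * γ * d - γ * k)) +
          (p' * B ^ 2 + p * (2 * (h⁻¹ * (a * c + a * w * B ^ 2)))) =
          h⁻¹ * (-2 * (a * w * (A ^ 2 - p * B ^ 2)) - 2 * (r * c) + 2 * (ε * γ * d)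
            - 2 * (γ * k)) + p' * B ^ 2 := by ring
      rw [e1]
      refine (abs_add_le _ _).trans ?_
      rw [abs_mul, abs_of_pos (inv_pos.2 hh)]
      have t6 : |-2 * (a * w * (A ^ 2 - p * B ^ 2)) - 2 * (r * c) + 2 * (ε * γ * d)
            - 2 * (γ * k)| ≤ 2 * (K * |w| * (A ^ 2 + p * B ^ 2)) +
            |r| * (K * (A ^ 2 + p * B ^ 2)) + 2 * (|ε| * K * (A * B)) + 2 * (K * (A * F)) := by
        rw [abs_le] at *
        constructor <;> linarith [t1.1, t1.2, t2.1, t2.2, t3.1, t3.2, t4.1, t4.2]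
      calc _ ≤ h⁻¹ * (2 * (K * |w| * (A ^ 2 + p * B ^ 2)) +
            |r| * (K * (A ^ 2 + p * B ^ 2)) + 2 * (|ε| * K * (A * B)) + 2 * (K * (A * F)))
            + K * |p'| * (A ^ 2 + p * B ^ 2) := by gcongr
        _ = _ := by ring) x
  refine h1.trans ?_
  rw [integral_const_mul, integral_add (g1.const_mul _) g2, integral_const_mul]
  have hn1 := integral_norm_mul_nonneg u Φ
  have hn2 := integral_norm_mul_nonneg f Φ
  refine mul_le_mul_of_nonneg_right (Real.exp_le_exp.2 ?_) (by positivity)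
  have iw : Integrable fun t => 2 * K * |q.w t| := hq.w_int.abs.const_mul _
  have ir : Integrable fun t => K * |q.r t| := hq.r_int.abs.const_mul _
  have iwr : Integrable fun t => h⁻¹ * (2 * K * |q.w t| + K * |q.r t|) :=
    (iw.add ir).const_mul _
  rw [integral_add iwr (hq.P'_int.abs.const_mul _), integral_const_mul, integral_const_mul,
    integral_add iw ir, integral_const_mul, integral_const_mul]
  -- The contributions of w, r and P' are 2K², K²/h and K²; then h ≤ K and 1 ≤ K are used.
  calc h⁻¹ * (2 * K * (∫ t, |q.w t|) + K * ∫ t, |q.r t|) + K * ∫ t, |q.P' t|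
      ≤ h⁻¹ * (2 * K * (K * h) + K * K) + K * K := by
        gcongr
        exacts [hq.w_le, hq.r_le, hq.P'_le]
    _ = (3 * K ^ 2 * h + K ^ 2) / h := by field_simp; ring
    _ ≤ 4 * K ^ 3 / h := by
        have := hq.one_le
        have := hq.h_le
        gcongr
        have e1 : K ^ 2 * h ≤ K ^ 2 * K := by gcongr
        have e2 : K ^ 2 * 1 ≤ K ^ 2 * K := by gcongr
        nlinarith

end SystemCoefficients

/-! ### Removal of ε, the exponential bound and uniqueness. -/

namespace SystemCoefficients

variable {q : SystemCoefficients} {h K ε : ℝ} {f u Φ : ℝ → ℂ}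

/-- This turns the ε part of the source in the energy estimate into a term containing `f`, at the
cost of a power of 1/h but without any loss in ε: both |ε|∫|u|² and |ε|∫|Φ|² are bounded by ∫|f||u|.
-/
theorem IsSolution.eps_mul_integral_mul_le (hs : q.IsSolution h ε f u Φ) (hq : q.Bounded h K)
    (hf : MemLp f 2) (hε : |ε| ≤ K) :
    |ε| * ∫ x, ‖u x‖ * ‖Φ x‖ ≤ (K ^ 4 * (2 * K ^ 3 + 1)
      + K ^ 2 * (2 * K ^ 3 * Real.exp (2 * K ^ 2)) ^ 2 + 2 * K ^ 5) / h ^ 2 *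
        ∫ x, ‖f x‖ * ‖u x‖ := by
  have hh := hq.h_pos
  have hK := hq.K_pos
  have h1 := hs.eps_mul_le hq hf
  have h2 := hs.integral_norm_sq_Φ_le hq hf
  have hY := integral_norm_mul_nonneg f u
  have hX := integral_norm_mul_nonneg u Φ
  have iX : Integrable fun t => ‖u t‖ * ‖Φ t‖ := hs.u_L2.norm.integrable_mul hs.Φ_L2.norm
  have iU : Integrable fun x => ‖u x‖ ^ 2 := by simpa using hs.u_L2.integrable_norm_pow (by simp)
  have iZ : Integrable fun x => ‖Φ x‖ ^ 2 := by simpa using hs.Φ_L2.integrable_norm_pow (by simp)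
  have hU : 0 ≤ ∫ x, ‖u x‖ ^ 2 := integral_nonneg fun _ => by positivity
  set c := 2 * K ^ 3 * Real.exp (2 * K ^ 2) with hc
  have hc0 : 0 < c := by positivity
  have hXle : ∀ t : ℝ, 0 < t → t * (∫ x, ‖u x‖ * ‖Φ x‖) ≤
      (∫ x, ‖Φ x‖ ^ 2) / 2 + t ^ 2 / 2 * ∫ x, ‖u x‖ ^ 2 := by
    intro t ht
    rw [← integral_const_mul, ← integral_div, ← integral_const_mul, ← integral_add (iZ.div_const _)
      (iU.const_mul _)]
    refine integral_mono (iX.const_mul _) ((iZ.div_const _).add (iU.const_mul _)) fun x => ?_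
    change t * (‖u x‖ * ‖Φ x‖) ≤ ‖Φ x‖ ^ 2 / 2 + t ^ 2 / 2 * ‖u x‖ ^ 2
    nlinarith [sq_nonneg (‖Φ x‖ - t * ‖u x‖)]
  -- This weight in Young's inequality is the coefficient of X in the bound for Z, so that X there
  -- costs only Z/2, which is absorbed.
  have h3 := hXle (c / h) (by positivity)
  have h4 := hXle 1 one_pos
  set X := ∫ x, ‖u x‖ * ‖Φ x‖
  set U := ∫ x, ‖u x‖ ^ 2
  set Z := ∫ x, ‖Φ x‖ ^ 2
  set Y := ∫ x, ‖f x‖ * ‖u x‖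
  have h5 : K * (K ^ 2 * U + K * (Real.exp (2 * K ^ 2) * (2 * K / h * X)) + K * Y) =
      K ^ 3 * U + c / h * X + K ^ 2 * Y := by rw [hc]; field_simp
  rw [h5] at h2
  have h6 : Z ≤ (2 * K ^ 3 + (c / h) ^ 2) * U + 2 * K ^ 2 * Y := by linarith
  have h7 : |ε| * Z ≤ (2 * K ^ 3 + (c / h) ^ 2) * (K ^ 2 * Y) + 2 * K ^ 3 * Y := by
    calc |ε| * Z ≤ |ε| * ((2 * K ^ 3 + (c / h) ^ 2) * U + 2 * K ^ 2 * Y) := by gcongr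
      _ = (2 * K ^ 3 + (c / h) ^ 2) * (|ε| * U) + 2 * K ^ 2 * (|ε| * Y) := by ring
      _ ≤ (2 * K ^ 3 + (c / h) ^ 2) * (K ^ 2 * Y) + 2 * K ^ 2 * (K * Y) := by gcongr
      _ = _ := by ring
  have h8 : |ε| * X ≤ |ε| * (Z / 2 + U / 2) := by
    gcongr; linarith
  -- Allows the terms free of h to be put over the common denominator h².
  have h9 : 1 ≤ K ^ 2 / h ^ 2 := by
    rw [one_le_div (by positivity)]
    exact pow_le_pow_left₀ hh.le hq.h_le 2
  have h10 : 0 ≤ |ε| * X := by positivity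
  calc |ε| * X ≤ |ε| * Z + |ε| * U := by linarith
    _ ≤ 1 * (((2 * K ^ 3 + 1) * K ^ 2 + 2 * K ^ 3) * Y) + c ^ 2 * K ^ 2 / h ^ 2 * Y := by
        have : (c / h) ^ 2 * (K ^ 2 * Y) = c ^ 2 * K ^ 2 / h ^ 2 * Y := by field_simp
        linarith
    _ ≤ K ^ 2 / h ^ 2 * (((2 * K ^ 3 + 1) * K ^ 2 + 2 * K ^ 3) * Y)
          + c ^ 2 * K ^ 2 / h ^ 2 * Y := by gcongr
    _ = _ := by field_simp; ring

/-- The exponential bound for the reduced system. -/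
theorem exists_exp_bound (K : ℝ) : ∃ D : ℝ, 0 < D ∧ ∀ (q : SystemCoefficients) (h ε : ℝ)
    (f u Φ : ℝ → ℂ), q.Bounded h K → |ε| ≤ K → MemLp f 2 → Integrable f →
    q.IsSolution h ε f u Φ → ∀ x, ‖u x‖ ≤ Real.exp (D / h) * ∫ t, ‖f t‖ := by
  set D₁ := K ^ 4 * (2 * K ^ 3 + 1)
      + K ^ 2 * (2 * K ^ 3 * Real.exp (2 * K ^ 2)) ^ 2 + 2 * K ^ 5 with hD₁
  -- The 12 is 2 · 3!, the factorial coming from the bound of h⁻³ by an exponential of 1/h.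
  set L := 12 * K ^ 3 * (D₁ + K ^ 2) with hL
  -- Nothing is known about the sign of K at this point, hence the absolute value.
  refine ⟨|4 * K ^ 3 + 1 + L * K| + 1, by positivity, ?_⟩
  intro q h ε f u Φ hq hε hf hf1 hs x
  have hh := hq.h_pos
  have hK := hq.K_pos
  have hD₁0 : 0 < D₁ := by positivity
  have hL0 : 0 < L := by positivity
  have key := hs.eps_mul_integral_mul_le hq hf hε
  have hen := hs.energy_le hq hf
  have hY := integral_norm_mul_nonneg f u
  have hX := integral_norm_mul_nonneg u Φ
  set e : ℝ → ℝ := fun x => ‖Φ x‖ ^ 2 + q.P x * ‖u x‖ ^ 2 with he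
  have he0 : ∀ x, 0 ≤ e x := fun x =>
    add_nonneg (sq_nonneg _) (mul_nonneg (hq.P_pos x).le (sq_nonneg _))
  have hbdd : BddAbove (range e) := ⟨_, by rintro _ ⟨y, rfl⟩; exact hen y⟩
  -- The supremum is finite by the energy estimate, though with a bound that is useless
  -- quantitatively. Finiteness is what permits division by √S below.
  set S := ⨆ x, e x with hS
  have heS : ∀ x, e x ≤ S := fun x => le_ciSup hbdd x
  have hS0 : 0 ≤ S := (he0 0).trans (heS 0)
  have hPu : ∀ x, ‖u x‖ ^ 2 ≤ K * (q.P x * ‖u x‖ ^ 2) := fun x => by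
    have hP := hq.P_ge x
    rw [inv_le_iff_one_le_mul₀ hK] at hP
    nlinarith [sq_nonneg ‖u x‖]
  have hu : ∀ x, ‖u x‖ ≤ K * √S := fun x => by
    refine abs_le_of_sq_le_sq' ?_ (by positivity) |>.2
    rw [mul_pow, Real.sq_sqrt hS0]
    have h1 := heS x
    simp only [he] at h1
    have h2 : K * S ≤ K ^ 2 * S := by
      rw [sq, mul_assoc]; exact le_mul_of_one_le_left (by positivity) hq.one_le
    have h3 : K * (q.P x * ‖u x‖ ^ 2) ≤ K * S := by
      gcongr; linarith [sq_nonneg ‖Φ x‖]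
    linarith [hPu x]
  have hΦ : ∀ x, ‖Φ x‖ ≤ K * √S := fun x => by
    refine abs_le_of_sq_le_sq' ?_ (by positivity) |>.2
    rw [mul_pow, Real.sq_sqrt hS0]
    have h1 := heS x
    simp only [he] at h1
    have h2 : S ≤ K ^ 2 * S := le_mul_of_one_le_left hS0 (one_le_pow₀ hq.one_le)
    have h3 := mul_nonneg (hq.P_pos x).le (sq_nonneg ‖u x‖)
    linarith
  set J := ∫ t, ‖f t‖ with hJ
  have hJ0 : 0 ≤ J := integral_nonneg fun _ => norm_nonneg _
  have hle : ∀ v : ℝ → ℂ, (∀ x, ‖v x‖ ≤ K * √S) → ∫ t, ‖f t‖ * ‖v t‖ ≤ J * (K * √S) := by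
    intro v hv
    rw [← integral_mul_const]
    refine integral_mono_of_nonneg (Eventually.of_forall fun x => by positivity)
      (hf1.norm.mul_const _) (Eventually.of_forall fun x => ?_)
    exact mul_le_mul_of_nonneg_left (hv x) (norm_nonneg _)
  set M := Real.exp (4 * K ^ 3 / h) * (2 * K / h * ((D₁ / h ^ 2 + 1) * K)) with hM
  have hM0 : 0 ≤ M := by positivity
  have h1 : ∀ x, e x ≤ M * J * √S := fun x => by
    refine (hen x).trans ?_
    calc _ ≤ Real.exp (4 * K ^ 3 / h) *
          (2 * K / h * (D₁ / h ^ 2 * (J * (K * √S)) + J * (K * √S))) := by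
          have key' := key.trans (mul_le_mul_of_nonneg_left (hle u hu) (by positivity))
          exact mul_le_mul_of_nonneg_left (mul_le_mul_of_nonneg_left
            (add_le_add key' (hle Φ hΦ)) (by positivity)) (by positivity)
      _ = _ := by rw [hM]; ring
  have h2 : S ≤ M * J * √S := ciSup_le h1
  have h3 : √S ≤ M * J := by
    rcases hS0.eq_or_lt with h0 | h0
    · rw [← h0, Real.sqrt_zero]; positivity
    · have h4 := Real.sqrt_pos.2 h0
      nth_rewrite 1 [← Real.mul_self_sqrt hS0] at h2
      exact le_of_mul_le_mul_right h2 h4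
  refine (hu x).trans ?_
  have hKh : 1 ≤ K / h := (one_le_div hh).2 hq.h_le
  have h5 : K * M ≤ Real.exp ((|4 * K ^ 3 + 1 + L * K| + 1) / h) := by
    have hcube : (1 / h) ^ 3 ≤ 6 * Real.exp (1 / h) := by
      have := Real.pow_div_factorial_le_exp (x := 1 / h) (by positivity) 3
      simp [Nat.factorial] at this ⊢
      linarith
    -- The constant L itself is hidden in the exponential, using K/h ≥ 1.
    have hLe : L ≤ Real.exp (L * K / h) := by
      have h6 := Real.add_one_le_exp (L * K / h)
      have h7 : L ≤ L * K / h := by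
        rw [mul_div_assoc]; exact le_mul_of_one_le_right hL0.le hKh
      linarith
    calc K * M = Real.exp (4 * K ^ 3 / h) * (2 * K ^ 3 * (D₁ / h ^ 2 + 1) / h) := by
          rw [hM]; ring
      _ ≤ Real.exp (4 * K ^ 3 / h) * (2 * K ^ 3 * (D₁ / h ^ 2 + K ^ 2 / h ^ 2) / h) := by
          gcongr
          rw [one_le_div (by positivity)]
          exact pow_le_pow_left₀ hh.le hq.h_le 2
      _ = Real.exp (4 * K ^ 3 / h) * (2 * K ^ 3 * (D₁ + K ^ 2) * (1 / h) ^ 3) := by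
          field_simp
      _ ≤ Real.exp (4 * K ^ 3 / h) * (2 * K ^ 3 * (D₁ + K ^ 2) * (6 * Real.exp (1 / h))) := by
          gcongr
      _ = Real.exp (4 * K ^ 3 / h) * (Real.exp (1 / h) * L) := by rw [hL]; ring
      _ ≤ Real.exp (4 * K ^ 3 / h) * (Real.exp (1 / h) * Real.exp (L * K / h)) := by gcongr
      _ = Real.exp ((4 * K ^ 3 + 1 + L * K) / h) := by
          rw [← Real.exp_add, ← Real.exp_add]; congr 1; ring
      _ ≤ _ := by
          refine Real.exp_le_exp.2 (div_le_div_of_nonneg_right ?_ hh.le)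
          have := le_abs_self (4 * K ^ 3 + 1 + L * K)
          linarith
  calc K * √S ≤ K * (M * J) := by gcongr
    _ = K * M * J := by ring
    _ ≤ _ := by gcongr

/-- Square integrable solutions of the homogeneous system vanish. -/
theorem IsSolution.eq_zero (hs : q.IsSolution h ε (fun _ => 0) u Φ) (hq : q.Bounded h K)
    (hε : ε ≠ 0) : u = 0 := by
  have h1 := hs.eps_mul_le hq MemLp.zero
  simp only [norm_zero, zero_mul, integral_zero, mul_zero] at h1
  have h2 : ∫ x, ‖u x‖ ^ 2 = 0 := by
    refine le_antisymm ?_ (integral_nonneg fun _ => by positivity)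
    by_contra! hcon
    exact absurd h1 (not_le.2 (mul_pos (abs_pos.2 hε) hcon))
  have iU : Integrable fun x => ‖u x‖ ^ 2 := by simpa using hs.u_L2.integrable_norm_pow (by simp)
  rw [integral_eq_zero_iff_of_nonneg (fun _ => by positivity) iU] at h2
  refine (hs.u_prim.continuous.ae_eq_iff_eq volume continuous_zero).1 ?_
  filter_upwards [h2] with x hx
  simpa using hx

theorem IsSolution.sub {f₁ f₂ u₁ u₂ Φ₁ Φ₂ : ℝ → ℂ} (hs₁ : q.IsSolution h ε f₁ u₁ Φ₁)
    (hs₂ : q.IsSolution h ε f₂ u₂ Φ₂) :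
    q.IsSolution h ε (fun x => f₁ x - f₂ x) (fun x => u₁ x - u₂ x) (fun x => Φ₁ x - Φ₂ x) where
  u_L2 := hs₁.u_L2.sub hs₂.u_L2
  Φ_L2 := hs₁.Φ_L2.sub hs₂.Φ_L2
  u_prim := (hs₁.u_prim.sub hs₂.u_prim).congr_deriv (Eventually.of_forall fun x => by
    simp only [rhsU]; ring)
  Φ_prim := (hs₁.Φ_prim.sub hs₂.Φ_prim).congr_deriv (Eventually.of_forall fun x => by
    simp only [rhsΦ]; ring)

end SystemCoefficients

/-! ### Complex measures and differentials of functions of locally bounded variation. -/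

section

open VectorMeasure

/-- A complex measure has finite variation. -/
theorem isFiniteMeasure_variation_complex (μ : ComplexMeasure ℝ) :
    IsFiniteMeasure μ.variation := by
  set μ₁ : SignedMeasure ℝ := ComplexMeasure.re μ
  set μ₂ : SignedMeasure ℝ := ComplexMeasure.im μ
  have hle : μ.variation ≤ μ₁.totalVariation + μ₂.totalVariation := by
    refine variation_le_of_forall_enorm_le fun A _ => ?_
    refine le_trans ?_ (add_le_add (μ₁.enorm_le_totalVariation A) (μ₂.enorm_le_totalVariation A))
    have h1 : μ A = ((μ₁ A : ℝ) : ℂ) + ((μ₂ A : ℝ) : ℂ) * Complex.I := by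
      change μ A = (((μ A).re : ℝ) : ℂ) + (((μ A).im : ℝ) : ℂ) * Complex.I
      exact (Complex.re_add_im _).symm
    rw [h1]
    refine (enorm_add_le _ _).trans ?_
    rw [enorm_mul]
    simp [← ofReal_norm]
  exact isFiniteMeasure_of_le _ hle

/-- Multiplication of densities: if `∫ᵛ_A ψ dμ = ∑ᵢ ∫_A kᵢ dρᵢ` for all measurable `A ⊆ I` then
the same holds after multiplication of all the integrands by a bounded measurable function. -/
theorem vectorMeasure_integral_mul {μ : ComplexMeasure ℝ} {ι : Type*} [Fintype ι]
    {ρ : ι → Measure ℝ} {k : ι → ℝ → ℂ} {I : Set ℝ} (hk : ∀ i, IntegrableOn (k i) I (ρ i))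
    {ψ : ℝ → ℝ} (hψ : Measurable ψ) {Cψ : ℝ} (hψb : ∀ x, |ψ x| ≤ Cψ)
    (H : ∀ A, MeasurableSet A → A ⊆ I → ∫ᵛ x in A, ψ x ∂•μ = ∑ i, ∫ x in A, k i x ∂(ρ i))
    {φ : ℝ → ℝ} (hφ : Measurable φ) {C : ℝ} (hφb : ∀ x, |φ x| ≤ C) {A : Set ℝ}
    (hA : MeasurableSet A) (hAI : A ⊆ I) :
    ∫ᵛ x in A, φ x * ψ x ∂•μ = ∑ i, ∫ x in A, (φ x : ℂ) * k i x ∂(ρ i) := by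
  have := isFiniteMeasure_variation_complex μ
  have hC : 0 ≤ C := (abs_nonneg _).trans (hφb 0)
  have hint : ∀ g : ℝ → ℝ, Measurable g → (∃ c, ∀ x, |g x| ≤ c) →
      (μ.restrict A).Integrable fun x => g x * ψ x := by
    rintro g hg ⟨c, hc⟩
    refine Integrable.of_bound (hg.mul hψ).aestronglyMeasurable (c * Cψ)
      (Eventually.of_forall fun x => ?_)
    rw [Real.norm_eq_abs, abs_mul]
    exact mul_le_mul (hc x) (hψb x) (abs_nonneg _) ((abs_nonneg _).trans (hc x))
  have hint2 : ∀ g : ℝ → ℝ, Measurable g → (∃ c, ∀ x, |g x| ≤ c) → ∀ i,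
      IntegrableOn (fun x => (g x : ℂ) * k i x) A (ρ i) := by
    rintro g hg ⟨c, hc⟩ i
    refine ((hk i).mono_set hAI).bdd_mul (c := c)
      (Complex.measurable_ofReal.comp hg).aestronglyMeasurable (Eventually.of_forall fun x => ?_)
    simpa using hc x
  -- For the indicator of B the claim is the hypothesis for A ∩ B, which still lies in I; bounded
  -- functions follow by dominated convergence on both sides.
  have hsimple : ∀ g : SimpleFunc ℝ ℝ,
      ∫ᵛ x in A, g x * ψ x ∂•μ = ∑ i, ∫ x in A, (g x : ℂ) * k i x ∂(ρ i) := by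
    intro g
    have hb : ∀ g : SimpleFunc ℝ ℝ, ∃ c, ∀ x, |g x| ≤ c := fun g => by
      obtain ⟨c, hc⟩ := g.exists_forall_norm_le
      exact ⟨c, hc⟩
    induction g using SimpleFunc.induction with
    | @const c B hB =>
      have e1 : ∀ x, (SimpleFunc.piecewise B hB (SimpleFunc.const ℝ c) (SimpleFunc.const ℝ 0)) x
          * ψ x = B.indicator (fun x => c • ψ x) x := by
        intro x
        by_cases hx : x ∈ B <;> simp [hx]
      have e2 : ∀ i x, (((SimpleFunc.piecewise B hB (SimpleFunc.const ℝ c)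
          (SimpleFunc.const ℝ 0)) x : ℝ) : ℂ) * k i x
          = B.indicator (fun x => (c : ℂ) * k i x) x := by
        intro i x
        by_cases hx : x ∈ B <;> simp [hx]
      simp_rw [e1, e2]
      rw [VectorMeasure.setIntegral_indicator hA hB, VectorMeasure.integral_fun_smul,
        H _ (hA.inter hB) (inter_subset_left.trans hAI), Finset.smul_sum]
      refine Finset.sum_congr rfl fun i _ => ?_
      rw [MeasureTheory.setIntegral_indicator hB, MeasureTheory.integral_const_mul]
      simp
    | @add f g _ hf hg =>
      have e1 : ∀ x, (f + g) x * ψ x = f x * ψ x + g x * ψ x := fun x => by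
        rw [SimpleFunc.add_apply]; ring
      have e2 : ∀ i x, (((f + g) x : ℝ) : ℂ) * k i x = (f x : ℂ) * k i x + (g x : ℂ) * k i x :=
        fun i x => by rw [SimpleFunc.add_apply]; push_cast; ring
      simp_rw [e1, e2]
      rw [VectorMeasure.integral_fun_add (hint f f.measurable (hb f))
        (hint g g.measurable (hb g)), hf, hg, ← Finset.sum_add_distrib]
      refine Finset.sum_congr rfl fun i _ => ?_
      rw [MeasureTheory.integral_add (hint2 f f.measurable (hb f) i)
        (hint2 g g.measurable (hb g) i)]
  have hsm : StronglyMeasurable φ := hφ.stronglyMeasurable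
  have hlim : ∀ x, Tendsto (fun n => hsm.approxBounded C n x) atTop (𝓝 (φ x)) := fun x =>
    hsm.tendsto_approxBounded_of_norm_le (hφb x)
  have hbd : ∀ n x, |hsm.approxBounded C n x| ≤ C := fun n x =>
    hsm.norm_approxBounded_le hC n x
  have t1 : Tendsto (fun n => ∫ᵛ x in A, hsm.approxBounded C n x * ψ x ∂•μ) atTop
      (𝓝 (∫ᵛ x in A, φ x * ψ x ∂•μ)) := by
    refine VectorMeasure.tendsto_integral_of_dominated_convergence (fun _ => C * Cψ)
      (fun n => ((SimpleFunc.measurable _).mul hψ).aestronglyMeasurable)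
      (integrable_const _) (fun n => Eventually.of_forall fun x => ?_)
      (Eventually.of_forall fun x => (hlim x).mul_const _)
    rw [Real.norm_eq_abs, abs_mul]
    exact mul_le_mul (hbd n x) (hψb x) (abs_nonneg _) hC
  have t2 : Tendsto (fun n => ∑ i, ∫ x in A, ((hsm.approxBounded C n x : ℝ) : ℂ) * k i x ∂(ρ i))
      atTop (𝓝 (∑ i, ∫ x in A, (φ x : ℂ) * k i x ∂(ρ i))) := by
    refine tendsto_finsetSum _ fun i _ => ?_
    refine MeasureTheory.tendsto_integral_of_dominated_convergence (fun x => C * ‖k i x‖)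
      (fun n => (hint2 _ (SimpleFunc.measurable _) ⟨C, hbd n⟩ i).aestronglyMeasurable)
      (((hk i).mono_set hAI).norm.const_mul _) (fun n => Eventually.of_forall fun x => ?_)
      (Eventually.of_forall fun x => ?_)
    · rw [norm_mul, Complex.norm_real]
      exact mul_le_mul_of_nonneg_right (hbd n x) (norm_nonneg _)
    · exact ((Complex.continuous_ofReal.tendsto _).comp (hlim x)).mul_const _
  simp_rw [hsimple] at t1
  exact tendsto_nhds_unique t1 t2

/-- Two vector measures on the line that agree on half-open intervals are equal. -/
theorem vectorMeasure_ext_Ioc {E : Type*} [NormedAddCommGroup E] {μ ν : VectorMeasure ℝ E}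
    (H : ∀ a b, a ≤ b → μ (Ioc a b) = ν (Ioc a b)) : μ = ν := by
  have hU : ⋃ n : ℕ, Ioc (-(n : ℝ)) n = univ := by
    refine eq_univ_of_forall fun x => mem_iUnion.2 ?_
    obtain ⟨n, hn⟩ := exists_nat_gt |x|
    exact ⟨n, (abs_lt.1 hn).1, (abs_lt.1 hn).2.le⟩
  have hmono : Monotone fun n : ℕ => Ioc (-(n : ℝ)) n := fun m n hmn =>
    Ioc_subset_Ioc (neg_le_neg (by exact_mod_cast hmn)) (by exact_mod_cast hmn)
  refine VectorMeasure.ext_of_generateFrom {S | ∃ l u : ℝ, l < u ∧ Ioc l u = S} ?_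
    ((BorelSpace.measurable_eq (α := ℝ)).trans (borel_eq_generateFrom_Ioc ℝ))
    (isPiSystem_Ioc id id) ?_
  · rintro _ ⟨l, u, hlu, rfl⟩
    exact H l u hlu.le
  -- The whole line is not a half-open interval; its mass is a limit along an exhaustion.
  · have t1 := μ.tendsto_vectorMeasure_iUnion_atTop_nat hmono fun n => measurableSet_Ioc
    have t2 := ν.tendsto_vectorMeasure_iUnion_atTop_nat hmono fun n => measurableSet_Ioc
    rw [hU] at t1 t2
    refine tendsto_nhds_unique t1 (t2.congr fun n => (H _ _ ?_).symm)
    have : (0 : ℝ) ≤ n := n.cast_nonneg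
    linarith

theorem setIntegral_signedMeasure (V : SignedMeasure ℝ) {u : ℝ → ℂ} (hu : Continuous u)
    {C : ℝ} (hC : ∀ x, ‖u x‖ ≤ C) {A : Set ℝ} (hA : MeasurableSet A) :
    ∫ᵛ x in A, u x ∂<•V = (∫ x in A, u x ∂V.toJordanDecomposition.posPart)
      - ∫ x in A, u x ∂V.toJordanDecomposition.negPart := by
  set p := V.toJordanDecomposition.posPart
  set n := V.toJordanDecomposition.negPart
  have hV : V = p.toSignedMeasure - n.toSignedMeasure := by
    conv_lhs => rw [← SignedMeasure.toSignedMeasure_toJordanDecomposition V]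
    rfl
  have hi : ∀ (m : Measure ℝ) [IsFiniteMeasure m], m.toSignedMeasure.Integrable u := by
    intro m _
    rw [VectorMeasure.Integrable, Measure.variation_toSignedMeasure]
    exact Integrable.of_bound hu.aestronglyMeasurable C (Eventually.of_forall hC)
  rw [hV, sub_eq_add_neg, VectorMeasure.restrict_add, VectorMeasure.restrict_neg,
    ← sub_eq_add_neg, VectorMeasure.integral_sub_vectorMeasure (hi p).restrict (hi n).restrict,
    VectorMeasure.setIntegral_toSignedMeasure hA, VectorMeasure.setIntegral_toSignedMeasure hA]

/-- Integration by parts of an absolutely continuous function against a finite measure. -/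
theorem IsPrimitive.integral_Iic_mul {u u' : ℝ → ℂ} (hu : IsPrimitive u u') (m : Measure ℝ)
    [IsFiniteMeasure m] {a b : ℝ} (hab : a ≤ b) :
    (m.real (Iic b) : ℂ) * u b - m.real (Iic a) * u a =
      (∫ x in Ioc a b, u x ∂m) + ∫ x in a..b, (m.real (Iic x) : ℂ) * u' x := by
  have hW : ∀ x, a ≤ x → m.real (Ioc a x) = m.real (Iic x) - m.real (Iic a) := by
    intro x hx
    rw [← Iic_sdiff_Iic, measureReal_sdiff (Iic_subset_Iic.2 hx) measurableSet_Iic]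
  have hWm : Measurable fun x => m.real (Iic x) := by
    refine Monotone.measurable fun x y hxy => ?_
    exact measureReal_mono (Iic_subset_Iic.2 hxy)
  have hWu : IntervalIntegrable (fun x => (m.real (Iic x) : ℂ) * u' x) volume a b := by
    have hbd : ∀ x, ‖(m.real (Iic x) : ℂ)‖ ≤ m.real univ := fun x => by
      rw [Complex.norm_real, Real.norm_of_nonneg measureReal_nonneg]
      exact measureReal_mono (subset_univ _)
    have hm' : Measurable fun x => (m.real (Iic x) : ℂ) := Complex.measurable_ofReal.comp hWm
    exact ⟨(hu.1 a b).1.bdd_mul hm'.aestronglyMeasurable (Eventually.of_forall hbd),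
      (hu.1 a b).2.bdd_mul hm'.aestronglyMeasurable (Eventually.of_forall hbd)⟩
  -- Fubini on the square (a, b]²: integrating first in t gives u(b) - u(x), integrating first in x
  -- gives the mass of (a, t] times u'(t).
  set K : ℝ → ℝ → ℂ := fun x t => if x ≤ t then u' t else 0 with hK
  have hu'i : IntegrableOn u' (Ioc a b) := (hu.1 a b).1
  have hint : Integrable (Function.uncurry K) ((m.restrict (Ioc a b)).prod
      (volume.restrict (Ioc a b))) := by
    have h1 : Integrable (fun z : ℝ × ℝ => u' z.2) ((m.restrict (Ioc a b)).prod
      (volume.restrict (Ioc a b))) := hu'i.integrable.comp_snd _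
    have h2 := h1.indicator (s := {z : ℝ × ℝ | z.1 ≤ z.2})
      (measurableSet_le measurable_fst measurable_snd)
    refine h2.congr (Eventually.of_forall fun z => ?_)
    simp only [indicator, mem_ofPred_eq, Function.uncurry, hK]
  have hF := integral_integral_swap hint
  have e1 : ∀ x ∈ Ioc a b, ∫ t in Ioc a b, K x t = u b - u x := by
    intro x hx
    have h1 : ∀ t, K x t = (Ici x).indicator u' t := fun t => by
      simp [hK, indicator]
    simp_rw [h1]
    rw [MeasureTheory.setIntegral_indicator measurableSet_Ici, ← hu.2,
      intervalIntegral.integral_of_le hx.2, ← integral_Icc_eq_integral_Ioc]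
    congr 2
    ext t
    simp only [mem_inter_iff, mem_Ioc, mem_Ici, mem_Icc]
    exact ⟨fun h => ⟨h.2, h.1.2⟩, fun h => ⟨⟨hx.1.trans_le h.1, h.2⟩, h.1⟩⟩
  have e2 : ∀ t ∈ Ioc a b, ∫ x in Ioc a b, K x t ∂m = (m.real (Iic t) - m.real (Iic a) : ℝ) * u' t := by
    intro t ht
    have h1 : ∀ x, K x t = (Iic t).indicator (fun _ => u' t) x := fun x => by
      simp [hK, indicator]
    simp_rw [h1]
    rw [MeasureTheory.setIntegral_indicator measurableSet_Iic, MeasureTheory.setIntegral_const,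
      ← hW t ht.1.le, Complex.real_smul]
    congr 3
    ext x
    simp only [mem_inter_iff, mem_Ioc, mem_Iic]
    exact ⟨fun h => ⟨h.1.1, h.2⟩, fun h => ⟨⟨h.1, h.2.trans ht.2⟩, h.2⟩⟩
  rw [setIntegral_congr_fun measurableSet_Ioc e1, setIntegral_congr_fun measurableSet_Ioc e2] at hF
  have hum : IntegrableOn u (Ioc a b) m :=
    (hu.continuous.continuousOn.integrableOn_compact isCompact_Icc).mono_set Ioc_subset_Icc_self
  have e3 : ∫ x in Ioc a b, (u b - u x) ∂m =
      (m.real (Iic b) - m.real (Iic a) : ℝ) * u b - ∫ x in Ioc a b, u x ∂m := by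
    rw [MeasureTheory.integral_sub (integrable_const _) hum, MeasureTheory.setIntegral_const,
      hW b hab, Complex.real_smul]
  have e4 : ∫ t in Ioc a b, ((m.real (Iic t) - m.real (Iic a) : ℝ) : ℂ) * u' t =
      (∫ t in a..b, (m.real (Iic t) : ℂ) * u' t) - m.real (Iic a) * (u b - u a) := by
    rw [← hu.2, ← intervalIntegral.integral_const_mul, ← intervalIntegral.integral_sub hWu
      ((hu.1 a b).const_mul _), intervalIntegral.integral_of_le hab]
    congr 1
    ext t
    push_cast; ring
  rw [e3, e4] at hF
  push_cast at hF
  linear_combination hF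

theorem rightLim_truncate {F : ℝ → ℂ} (hF : LocallyBoundedVariationOn F univ) {r x : ℝ}
    (hx : x ∈ Ioo (-r) r) : (truncate r F).rightLim x = F.rightLim x := by
  have h1 := (truncate_bv hF r).tendsto_rightLim x
  have h2 : truncate r F =ᶠ[𝓝[>] x] F := by
    filter_upwards [mem_nhdsWithin_of_mem_nhds (Ioo_mem_nhds hx.1 hx.2)] with y hy
    rw [truncate, min_eq_left hy.2.le, max_eq_right hy.1.le]
  exact (rightLim_eq_of_tendsto (h1.congr' h2)).symm

theorem dLoc_Ioc {F : ℝ → ℂ} (hF : LocallyBoundedVariationOn F univ) {r a b : ℝ}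
    (ha : -r < a) (hab : a ≤ b) (hb : b < r) :
    dLoc hF r (Ioc a b) = F.rightLim b - F.rightLim a := by
  rw [dLoc, BoundedVariationOn.vectorMeasure_Ioc _ hab, rightLim_truncate hF ⟨by linarith, hb⟩,
    rightLim_truncate hF ⟨ha, by linarith⟩]

theorem LocallyBoundedVariationOn.rightLim_ae_eq {F : ℝ → ℂ}
    (hF : LocallyBoundedVariationOn F univ) : F.rightLim =ᵐ[volume] F := by
  filter_upwards [hF.ae_differentiableAt] with x hx
  exact rightLim_eq_of_tendsto
    (hx.continuousAt.tendsto.mono_left nhdsWithin_le_nhds)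

/-- The increments of a function of locally bounded variation from the values of its differential
multiplied by a function that is bounded below. -/
theorem rightLim_sub_rightLim {F : ℝ → ℂ} (hF : LocallyBoundedVariationOn F univ) {ι : Type*}
    [Fintype ι] {ρ : ι → Measure ℝ} {k : ι → ℝ → ℂ}
    (hk : ∀ i r, IntegrableOn (k i) (Ioo (-r) r) (ρ i)) {ψ : ℝ → ℝ} (hψ : Measurable ψ)
    {m M : ℝ} (hm : 0 < m) (hψm : ∀ x, m ≤ ψ x) (hψM : ∀ x, ψ x ≤ M)
    (H : ∀ r A, MeasurableSet A → A ⊆ Ioo (-r) r →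
      ∫ᵛ x in A, ψ x ∂•(dLoc hF r) = ∑ i, ∫ x in A, k i x ∂(ρ i)) {a b : ℝ} (hab : a ≤ b) :
    F.rightLim b - F.rightLim a = ∑ i, ∫ x in Ioc a b, ((ψ x)⁻¹ : ℝ) * k i x ∂(ρ i) := by
  -- The added 1 puts (a, b], with its endpoint b, inside the open interval on which `dLoc` is dF.
  set r := max |a| |b| + 1
  have hra : -r < a := by
    have := neg_abs_le a; have := le_max_left |a| |b|; simp only [r]; linarith
  have hbr : b < r := by
    have := le_abs_self b; have := le_max_right |a| |b|; simp only [r]; linarith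
  have hpos : ∀ x, 0 < ψ x := fun x => hm.trans_le (hψm x)
  have := isFiniteMeasure_variation_complex (dLoc hF r)
  have key := vectorMeasure_integral_mul (μ := dLoc hF r) (hk · r) hψ (Cψ := M)
    (fun x => by rw [abs_of_pos (hpos x)]; exact hψM x) (H r) hψ.inv (C := m⁻¹)
    (fun x => by
      rw [Pi.inv_apply, abs_of_pos (inv_pos.2 (hpos x))]
      exact inv_anti₀ hm (hψm x)) measurableSet_Ioc
    (A := Ioc a b) (fun x hx => ⟨hra.trans hx.1, hx.2.trans_lt hbr⟩)
  simp only [Pi.inv_apply] at key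
  rw [← key, ← dLoc_Ioc hF hra hab hbr]
  have h1 : ∀ x, (ψ x)⁻¹ * ψ x = 1 := fun x => inv_mul_cancel₀ (hpos x).ne'
  simp_rw [h1]
  rw [VectorMeasure.integral_const, VectorMeasure.restrict_apply _ measurableSet_Ioc
    MeasurableSet.univ, univ_inter]
  simp

/-- The sum over a partition is dominated by masses of adjacent half-open intervals, which
telescope. -/
theorem locallyBoundedVariationOn_of_le_measure {F : ℝ → ℂ} {m : Measure ℝ}
    (hm : ∀ a b, m (Ioc a b) ≠ ⊤) (hFm : ∀ a b, a ≤ b → ‖F b - F a‖ₑ ≤ m (Ioc a b)) :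
    LocallyBoundedVariationOn F univ := by
  intro a b _ _
  refine ne_top_of_le_ne_top (hm (a - 1) b) (iSup_le fun p => ?_)
  obtain ⟨n, u, hu, hus⟩ := p
  have hsum : ∀ n, ∑ i ∈ Finset.range n, m (Ioc (u i) (u (i + 1))) = m (Ioc (u 0) (u n)) := by
    intro n
    induction n with
    | zero => simp
    | succ n ih =>
      rw [Finset.sum_range_succ, ih, ← measure_union (Ioc_disjoint_Ioc_of_le le_rfl)
        measurableSet_Ioc, Ioc_union_Ioc_eq_Ioc (hu n.zero_le) (hu n.le_succ)]
  calc ∑ i ∈ Finset.range n, edist (F (u (i + 1))) (F (u i))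
      ≤ ∑ i ∈ Finset.range n, m (Ioc (u i) (u (i + 1))) := by
        refine Finset.sum_le_sum fun i _ => ?_
        rw [edist_eq_enorm_sub]
        exact hFm _ _ (hu i.le_succ)
    _ = m (Ioc (u 0) (u n)) := hsum n
    _ ≤ m (Ioc (a - 1) b) := by
        refine measure_mono (Ioc_subset_Ioc ?_ (hus n).2.2)
        linarith [(hus 0).2.1]

/-- The intervals (x, y] have finite mass and decrease to the empty set as y decreases to x. -/
theorem tendsto_nhdsGT_of_le_measure {F : ℝ → ℂ} {m : Measure ℝ}
    (hm : ∀ a b, m (Ioc a b) ≠ ⊤) (hFm : ∀ a b, a ≤ b → ‖F b - F a‖ₑ ≤ m (Ioc a b)) (x : ℝ) :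
    Tendsto F (𝓝[>] x) (𝓝 (F x)) := by
  have h1 : Tendsto (fun y => m (Ioc x y)) (𝓝[>] x) (𝓝 0) := by
    have := tendsto_measure_biInter_gt (μ := m) (s := fun y => Ioc x y) (a := x)
      (fun r _ => measurableSet_Ioc.nullMeasurableSet)
      (fun i j _ hij => Ioc_subset_Ioc_right hij) ⟨x + 1, by simp, hm _ _⟩
    have h2 : ⋂ r > x, Ioc x r = ∅ := by
      refine eq_empty_of_forall_notMem fun y hy => ?_
      simp only [mem_iInter, mem_Ioc] at hy
      have h3 := (hy (x + 1) (by simp)).1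
      have h4 := (hy ((x + y) / 2) (by simp only [gt_iff_lt]; linarith)).2
      linarith
    rw [h2, measure_empty] at this
    exact this
  rw [EMetric.tendsto_nhds]
  intro ε hε
  filter_upwards [h1.eventually (gt_mem_nhds hε), self_mem_nhdsWithin] with y hy hxy
  rw [edist_eq_enorm_sub]
  exact (hFm x y (le_of_lt hxy)).trans_lt hy

/-- The differential of a function with given increments. -/
theorem exists_dLoc_eq {F : ℝ → ℂ} {ι : Type*} [Fintype ι] {ρ : ι → Measure ℝ} {k : ι → ℝ → ℂ}
    (hk : ∀ i a b, IntegrableOn (k i) (Ioc a b) (ρ i))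
    (H : ∀ a b, a ≤ b → F b - F a = ∑ i, ∫ x in Ioc a b, k i x ∂(ρ i)) :
    ∃ hF : LocallyBoundedVariationOn F univ, ∀ (ψ : ℝ → ℝ) (C : ℝ), Measurable ψ →
      (∀ x, |ψ x| ≤ C) → ∀ r A, MeasurableSet A → A ⊆ Ioo (-r) r →
      ∫ᵛ x in A, ψ x ∂•(dLoc hF r) = ∑ i, ∫ x in A, (ψ x : ℂ) * k i x ∂(ρ i) := by
  classical
  -- The sum of the absolute values of the densities dominates the increments of F, which gives at
  -- once local bounded variation and right continuity.
  set m : Measure ℝ := ∑ i, (ρ i).withDensity fun x => ‖k i x‖ₑ with hmdef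
  have hmI : ∀ a b, m (Ioc a b) = ∑ i, ∫⁻ x in Ioc a b, ‖k i x‖ₑ ∂(ρ i) := by
    intro a b
    rw [hmdef, Measure.finsetSum_apply]
    exact Finset.sum_congr rfl fun i _ => withDensity_apply _ measurableSet_Ioc
  have hm : ∀ a b, m (Ioc a b) ≠ ⊤ := by
    intro a b
    rw [hmI]
    exact (ENNReal.sum_lt_top.2 fun i _ => (hk i a b).2).ne
  have hFm : ∀ a b, a ≤ b → ‖F b - F a‖ₑ ≤ m (Ioc a b) := by
    intro a b hab
    rw [H a b hab, hmI]
    exact (enorm_sum_le _ _).trans (Finset.sum_le_sum fun i _ => enorm_integral_le_lintegral_enorm _)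
  have hF := locallyBoundedVariationOn_of_le_measure hm hFm
  have hlim := tendsto_nhdsGT_of_le_measure hm hFm
  have hright : ∀ x, F.rightLim x = F x := fun x =>
    rightLim_eq_of_tendsto (hlim x)
  refine ⟨hF, fun ψ C hψ hC r A hA hAr => ?_⟩
  rcases le_or_gt r 0 with hr | hr
  · have : A = ∅ := by
      rw [Ioo_eq_empty (by linarith)] at hAr
      exact subset_empty_iff.1 hAr
    simp [this]
  have := isFiniteMeasure_variation_complex (dLoc hF r)
  have hkr : ∀ i, Integrable (k i) ((ρ i).restrict (Ioc (-r) r)) := fun i => hk i _ _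
  have hclamp : ∀ x, -r ≤ max (-r) (min x r) ∧ max (-r) (min x r) ≤ r := fun x =>
    ⟨le_max_left _ _, max_le (by linarith) (min_le_right _ _)⟩
  have hrt : ∀ x, (truncate r F).rightLim x = truncate r F x := by
    intro x
    refine rightLim_eq_of_tendsto ?_
    -- The closed right neighbourhood is needed, as the clamping map is constant to the right of
    -- points outside [-r, r).
    have hge : Tendsto F (𝓝[≥] (max (-r) (min x r))) (𝓝 (F (max (-r) (min x r)))) := by
      have h1 : ContinuousWithinAt F (Ioi (max (-r) (min x r))) (max (-r) (min x r)) := hlim _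
      exact continuousWithinAt_Ioi_iff_Ici.1 h1
    refine hge.comp (tendsto_nhdsWithin_iff.2 ⟨?_, ?_⟩)
    · have : Continuous fun x : ℝ => max (-r) (min x r) := by fun_prop
      exact (this.tendsto x).mono_left nhdsWithin_le_nhds
    · filter_upwards [self_mem_nhdsWithin] with y hy
      exact max_le_max le_rfl (min_le_min (le_of_lt (mem_Ioi.1 hy)) le_rfl)
  -- By right continuity the measure of a half-open interval is an increment of the truncated F
  -- itself, which the hypothesis computes.
  have hd : dLoc hF r = ∑ i, ((ρ i).restrict (Ioc (-r) r)).withDensityᵥ (k i) := by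
    refine vectorMeasure_ext_Ioc fun a b hab => ?_
    have hcc : max (-r) (min a r) ≤ max (-r) (min b r) := max_le_max le_rfl (min_le_min hab le_rfl)
    rw [dLoc, BoundedVariationOn.vectorMeasure_Ioc _ hab, hrt, hrt, truncate, truncate, H _ _ hcc]
    have h1 : (∑ i, ((ρ i).restrict (Ioc (-r) r)).withDensityᵥ (k i)) (Ioc a b) =
        ∑ i, (((ρ i).restrict (Ioc (-r) r)).withDensityᵥ (k i)) (Ioc a b) := by
      simp
    rw [h1]
    refine Finset.sum_congr rfl fun i _ => ?_
    rw [withDensityᵥ_apply (hkr i) measurableSet_Ioc, Measure.restrict_restrict measurableSet_Ioc]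
    congr 2
    ext x
    simp only [mem_Ioc, mem_inter_iff, max_lt_iff, le_max_iff, min_lt_iff, le_min_iff]
    constructor
    · rintro ⟨⟨h1, h2⟩, h3⟩
      rcases h3 with h3 | h3
      · linarith
      · rcases h2 with h2 | h2
        · exact ⟨⟨h2, h3.1⟩, h1, h3.2⟩
        · linarith [h3.2]
    · rintro ⟨⟨h1, h2⟩, h3, h4⟩
      exact ⟨⟨h3, Or.inl h1⟩, Or.inr ⟨h2, h4⟩⟩
  have hone : ∀ B, MeasurableSet B → B ⊆ Ioo (-r) r →
      ∫ᵛ x in B, (1 : ℝ) ∂•(dLoc hF r) = ∑ i, ∫ x in B, k i x ∂(ρ i) := by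
    intro B hB hBr
    rw [VectorMeasure.integral_const, VectorMeasure.restrict_apply _ hB
      MeasurableSet.univ, univ_inter]
    have h1 : (∑ i, ((ρ i).restrict (Ioc (-r) r)).withDensityᵥ (k i)) B =
        ∑ i, (((ρ i).restrict (Ioc (-r) r)).withDensityᵥ (k i)) B := by
      simp
    rw [hd, h1]
    simp only [ContinuousLinearMap.lsmul_apply, one_smul]
    refine Finset.sum_congr rfl fun i _ => ?_
    rw [withDensityᵥ_apply (hkr i) hB, Measure.restrict_restrict hB,
      inter_eq_self_of_subset_left (hBr.trans Ioo_subset_Ioc_self)]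
  have key := vectorMeasure_integral_mul (μ := dLoc hF r) (I := Ioo (-r) r)
    (fun i => (hk i (-r) r).mono_set Ioo_subset_Ioc_self) (ψ := fun _ => 1) measurable_const
    (Cψ := 1) (by simp) hone hψ hC hA hAr
  simpa using key

/-! ### Moving averages of finite measures. -/

/-- The moving integral over intervals of length `δ` is locally absolutely continuous. -/
theorem isPrimitive_integral_add {E : Type*} [NormedAddCommGroup E] [NormedSpace ℝ E]
    {p : ℝ → E} (hp : LocallyIntegrable p volume) (δ : ℝ) :
    IsPrimitive (fun x => ∫ t in x..x + δ, p t) (fun x => p (x + δ) - p x) := by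
  have hi : ∀ a b, IntervalIntegrable p volume a b := (isPrimitive_intervalIntegral hp 0).1
  have hs : ∀ a b, IntervalIntegrable (fun x => p (x + δ)) volume a b := fun a b => by
    simpa using (hi (a + δ) (b + δ)).comp_add_right δ
  refine ⟨fun a b => (hs a b).sub (hi a b), fun a b => ?_⟩
  rw [intervalIntegral.integral_sub (hs a b) (hi a b),
    intervalIntegral.integral_comp_add_right]
  have h1 := intervalIntegral.integral_add_adjacent_intervals (hi a b) (hi b (b + δ))
  have h2 := intervalIntegral.integral_add_adjacent_intervals (hi a (a + δ)) (hi (a + δ) (b + δ))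
  rw [← h1] at h2
  have h3 := eq_sub_of_add_eq' h2
  rw [h3]; abel

section FiniteMeasure

variable (m : Measure ℝ) [IsFiniteMeasure m] (δ : ℝ)

theorem measurable_real_Iic : Measurable fun x => m.real (Iic x) :=
  Monotone.measurable fun _ _ hxy => measureReal_mono (Iic_subset_Iic.2 hxy)

theorem real_Ioc_eq {x y : ℝ} (hxy : x ≤ y) : m.real (Ioc x y) = m.real (Iic y) - m.real (Iic x) := by
  rw [← Iic_sdiff_Iic, measureReal_sdiff (Iic_subset_Iic.2 hxy) measurableSet_Iic]

theorem locallyIntegrable_real_Iic : LocallyIntegrable (fun x => m.real (Iic x)) volume := by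
  refine (locallyIntegrable_const (m.real univ)).mono
    (measurable_real_Iic m).aestronglyMeasurable (Eventually.of_forall fun x => ?_)
  rw [Real.norm_of_nonneg measureReal_nonneg, Real.norm_of_nonneg measureReal_nonneg]
  exact measureReal_mono (subset_univ _)

variable {δ}

theorem measurable_real_Ioc (hδ : 0 < δ) : Measurable fun x => m.real (Ioc x (x + δ)) := by
  have h1 : (fun x => m.real (Ioc x (x + δ))) = fun x => m.real (Iic (x + δ)) - m.real (Iic x) :=
    funext fun x => real_Ioc_eq m (by linarith)
  rw [h1]
  exact ((measurable_real_Iic m).comp (measurable_id.add_const δ)).sub (measurable_real_Iic m)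

variable (δ) in
-- Tonelli: a point t lies in (x, x + δ] exactly when x is in [t - δ, t), a set of length δ.
theorem lintegral_measure_Ioc :
    ∫⁻ x, m (Ioc x (x + δ)) = ENNReal.ofReal δ * m univ := by
  have hS : MeasurableSet {z : ℝ × ℝ | z.1 < z.2 ∧ z.2 ≤ z.1 + δ} :=
    (measurableSet_lt measurable_fst measurable_snd).inter
      (measurableSet_le measurable_snd (measurable_fst.add_const δ))
  have h1 : ∀ x, m (Ioc x (x + δ)) =
      ∫⁻ t, {z : ℝ × ℝ | z.1 < z.2 ∧ z.2 ≤ z.1 + δ}.indicator 1 (x, t) ∂m := by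
    intro x
    rw [← lintegral_indicator_one measurableSet_Ioc]
    rfl
  have h2 : ∀ t, ∫⁻ x, {z : ℝ × ℝ | z.1 < z.2 ∧ z.2 ≤ z.1 + δ}.indicator (1 : ℝ × ℝ → ℝ≥0∞) (x, t)
      = ENNReal.ofReal δ := by
    intro t
    have h3 : ∀ x, {z : ℝ × ℝ | z.1 < z.2 ∧ z.2 ≤ z.1 + δ}.indicator (1 : ℝ × ℝ → ℝ≥0∞) (x, t)
        = (Ico (t - δ) t).indicator 1 x := by
      intro x
      simp only [indicator, mem_ofPred_eq, mem_Ico, Pi.one_apply]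
      congr 1
      simp only [eq_iff_iff]
      constructor
      · rintro ⟨h, h'⟩; exact ⟨by linarith, h⟩
      · rintro ⟨h, h'⟩; exact ⟨h', by linarith⟩
    simp_rw [h3]
    rw [lintegral_indicator_one measurableSet_Ico, Real.volume_Ico, sub_sub_cancel]
  simp_rw [h1]
  rw [lintegral_lintegral_swap (f := fun x t =>
    {z : ℝ × ℝ | z.1 < z.2 ∧ z.2 ≤ z.1 + δ}.indicator (1 : ℝ × ℝ → ℝ≥0∞) (x, t))
    ((measurable_one.indicator hS).aemeasurable)]
  simp_rw [h2]
  rw [lintegral_const]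

theorem integrable_real_Ioc (hδ : 0 < δ) : Integrable fun x => m.real (Ioc x (x + δ)) := by
  refine ⟨(measurable_real_Ioc m hδ).aestronglyMeasurable, ?_⟩
  rw [hasFiniteIntegral_iff_enorm]
  have h1 : ∀ x, ‖m.real (Ioc x (x + δ))‖ₑ = m (Ioc x (x + δ)) := fun x => by
    rw [Real.enorm_of_nonneg measureReal_nonneg, ofReal_measureReal]
  simp_rw [h1]
  rw [lintegral_measure_Ioc m δ]
  exact ENNReal.mul_lt_top ENNReal.ofReal_lt_top (measure_lt_top _ _)

theorem integral_real_Ioc (hδ : 0 < δ) : ∫ x, m.real (Ioc x (x + δ)) = δ * m.real univ := by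
  rw [integral_eq_lintegral_of_nonneg_ae (Eventually.of_forall fun _ => measureReal_nonneg)
    (measurable_real_Ioc m hδ).aestronglyMeasurable]
  have h1 : ∀ x, ENNReal.ofReal (m.real (Ioc x (x + δ))) = m (Ioc x (x + δ)) := fun x =>
    ofReal_measureReal
  simp_rw [h1]
  rw [lintegral_measure_Ioc m δ, ENNReal.toReal_mul, ENNReal.toReal_ofReal hδ.le]
  rfl

variable (δ) in
/-- The distribution function of `m` minus its moving average. -/
noncomputable def cdfOscillation (x : ℝ) : ℝ :=
  m.real (Iic x) - δ⁻¹ * ∫ t in x..x + δ, m.real (Iic t)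

/-- A monotone function differs from its forward average by at most its growth over the window. With
the integral of window masses this makes the oscillation of size δ in L¹. -/
theorem abs_cdfOscillation_le (hδ : 0 < δ) (x : ℝ) :
    |cdfOscillation m δ x| ≤ m.real (Ioc x (x + δ)) := by
  have hx : x ≤ x + δ := by linarith
  have hi : IntervalIntegrable (fun t => m.real (Iic t)) volume x (x + δ) :=
    (isPrimitive_intervalIntegral (locallyIntegrable_real_Iic m) 0).1 _ _
  have h1 : cdfOscillation m δ x = -(δ⁻¹ * ∫ t in x..x + δ, (m.real (Iic t) - m.real (Iic x))) := by
    rw [intervalIntegral.integral_sub hi intervalIntegrable_const, cdfOscillation,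
      intervalIntegral.integral_const]
    simp only [add_sub_cancel_left, smul_eq_mul]
    field_simp
    ring
  have h2 : |∫ t in x..x + δ, (m.real (Iic t) - m.real (Iic x))|
      ≤ m.real (Ioc x (x + δ)) * |x + δ - x| := by
    rw [← Real.norm_eq_abs]
    refine intervalIntegral.norm_integral_le_of_norm_le_const fun t ht => ?_
    rw [uIoc_of_le hx] at ht
    rw [← real_Ioc_eq m ht.1.le, Real.norm_of_nonneg measureReal_nonneg]
    exact measureReal_mono (Ioc_subset_Ioc_right ht.2)
  rw [h1, abs_neg, abs_mul, abs_of_pos (inv_pos.2 hδ), inv_mul_le_iff₀ hδ]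
  rw [add_sub_cancel_left, abs_of_pos hδ] at h2
  linarith

theorem measurable_cdfOscillation : Measurable (cdfOscillation m δ) :=
  (measurable_real_Iic m).sub
    ((isPrimitive_integral_add (locallyIntegrable_real_Iic m) δ).continuous.measurable.const_mul _)

/-- Replacing a finite measure by its moving average, up to a total derivative. -/
theorem IsPrimitive.cdfOscillation_mul (hδ : 0 < δ) {u u' : ℝ → ℂ} (hu : IsPrimitive u u') {a b : ℝ}
    (hab : a ≤ b) :
    (cdfOscillation m δ b : ℂ) * u b - cdfOscillation m δ a * u a = (∫ x in Ioc a b, u x ∂m) +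
      ∫ x in a..b, ((cdfOscillation m δ x : ℂ) * u' x
        - (δ⁻¹ * m.real (Ioc x (x + δ)) : ℝ) * u x) := by
  have h1 := hu.integral_Iic_mul m hab
  have h2 := (((isPrimitive_integral_add (locallyIntegrable_real_Iic m) δ).clm_comp
    Complex.ofRealCLM).mul hu)
  simp only [Complex.ofRealCLM_apply] at h2
  have h3 := h2.2 a b
  have hWu : IntervalIntegrable (fun x => (m.real (Iic x) : ℂ) * u' x) volume a b := by
    have hbd : ∀ x, ‖(m.real (Iic x) : ℂ)‖ ≤ m.real univ := fun x => by
      rw [Complex.norm_real, Real.norm_of_nonneg measureReal_nonneg]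
      exact measureReal_mono (subset_univ _)
    have hm' : Measurable fun x => (m.real (Iic x) : ℂ) :=
      Complex.measurable_ofReal.comp (measurable_real_Iic m)
    exact ⟨(hu.1 a b).1.bdd_mul hm'.aestronglyMeasurable (Eventually.of_forall hbd),
      (hu.1 a b).2.bdd_mul hm'.aestronglyMeasurable (Eventually.of_forall hbd)⟩
  have h4 : ∫ x in a..b, ((cdfOscillation m δ x : ℂ) * u' x
        - (δ⁻¹ * m.real (Ioc x (x + δ)) : ℝ) * u x) =
      (∫ x in a..b, (m.real (Iic x) : ℂ) * u' x) - (δ : ℂ)⁻¹ * ∫ x in a..b,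
        (((m.real (Iic (x + δ)) - m.real (Iic x) : ℝ) : ℂ) * u x
        + ((∫ t in x..x + δ, m.real (Iic t) : ℝ) : ℂ) * u' x) := by
    rw [← intervalIntegral.integral_const_mul, ← intervalIntegral.integral_sub hWu
      ((h2.1 a b).const_mul _)]
    refine intervalIntegral.integral_congr fun x _ => ?_
    simp only [cdfOscillation, real_Ioc_eq m (show x ≤ x + δ by linarith)]
    push_cast
    ring
  rw [h4, h3]
  simp only [cdfOscillation]
  push_cast
  linear_combination h1

end FiniteMeasure

/-! ### The coefficients of the system at scale h². -/

theorem BoundedVariationOn.measurable {f : ℝ → ℝ} (hf : BoundedVariationOn f univ) :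
    Measurable f := by
  obtain ⟨p, q, hp, hq, rfl⟩ := hf.locallyBoundedVariationOn.exists_monotoneOn_sub_monotoneOn
  exact (monotoneOn_univ.1 hp).measurable.sub (monotoneOn_univ.1 hq).measurable

theorem BoundedVariationOn.exists_abs_le {f : ℝ → ℝ} (hf : BoundedVariationOn f univ) :
    ∃ C, ∀ x, |f x| ≤ C := by
  refine ⟨|f 0| + (eVariationOn f univ).toReal, fun x => ?_⟩
  have h1 := hf.dist_le (mem_univ x) (mem_univ 0)
  rw [Real.dist_eq] at h1
  have h2 := abs_sub_abs_le_abs_sub (f x) (f 0)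
  linarith

theorem memLp_ofReal_mul {k : ℝ → ℝ} (hk : Measurable k) {C : ℝ} (hC : ∀ x, |k x| ≤ C)
    {v : ℝ → ℂ} {p : ℝ≥0∞} (hv : MemLp v p) : MemLp (fun x => (k x : ℂ) * v x) p := by
  refine hv.of_le_mul (c := C)
    ((Complex.measurable_ofReal.comp hk).aestronglyMeasurable.mul hv.1)
    (Eventually.of_forall fun x => ?_)
  rw [norm_mul, Complex.norm_real, Real.norm_eq_abs]
  gcongr
  exact hC x

namespace MagSchro.Coefficients

variable (c : Coefficients)

theorem β_pos (x : ℝ) : 0 < c.β x := by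
  obtain ⟨m, hm, h⟩ := c.β_inf
  exact hm.trans_le (h x)

theorem α_pos (x : ℝ) : 0 < c.α x := by
  obtain ⟨m, hm, h⟩ := c.α_inf
  exact hm.trans_le (h x)

theorem exists_abs_inv_β_le : ∃ C, ∀ x, |(c.β x)⁻¹| ≤ C := by
  obtain ⟨m, hm, h⟩ := c.β_inf
  exact ⟨m⁻¹, fun x => by
    rw [abs_of_pos (inv_pos.2 (c.β_pos x))]; exact inv_anti₀ hm (h x)⟩

theorem exists_abs_inv_α_le : ∃ C, ∀ x, |(c.α x)⁻¹| ≤ C := by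
  obtain ⟨m, hm, h⟩ := c.α_inf
  exact ⟨m⁻¹, fun x => by
    rw [abs_of_pos (inv_pos.2 (c.α_pos x))]; exact inv_anti₀ hm (h x)⟩

/-- The positive part of `V₀ / β`. -/
noncomputable def posMeasure : Measure ℝ :=
  c.V₀.toJordanDecomposition.posPart.withDensity fun x => ENNReal.ofReal (c.β x)⁻¹

/-- The negative part of `V₀ / β`. -/
noncomputable def negMeasure : Measure ℝ :=
  c.V₀.toJordanDecomposition.negPart.withDensity fun x => ENNReal.ofReal (c.β x)⁻¹

theorem isFiniteMeasure_withDensity_inv_β (m : Measure ℝ) [IsFiniteMeasure m] :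
    IsFiniteMeasure (m.withDensity fun x => ENNReal.ofReal (c.β x)⁻¹) := by
  obtain ⟨C, hC⟩ := c.exists_abs_inv_β_le
  refine isFiniteMeasure_withDensity ?_
  refine ne_top_of_le_ne_top ?_ (lintegral_mono (g := fun _ => ENNReal.ofReal C) fun x =>
    ENNReal.ofReal_le_ofReal ((le_abs_self _).trans (hC x)))
  rw [lintegral_const]
  exact ENNReal.mul_ne_top ENNReal.ofReal_ne_top (measure_ne_top _ _)

instance : IsFiniteMeasure c.posMeasure := c.isFiniteMeasure_withDensity_inv_β _
instance : IsFiniteMeasure c.negMeasure := c.isFiniteMeasure_withDensity_inv_β _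

theorem setIntegral_withDensity_inv_β (m : Measure ℝ) (u : ℝ → ℂ) {A : Set ℝ}
    (hA : MeasurableSet A) :
    ∫ x in A, u x ∂(m.withDensity fun x => ENNReal.ofReal (c.β x)⁻¹) =
      ∫ x in A, ((c.β x)⁻¹ : ℝ) * u x ∂m := by
  rw [setIntegral_withDensity_eq_setIntegral_toReal_smul
    (f := fun x => ENNReal.ofReal (c.β x)⁻¹) (ENNReal.measurable_ofReal.comp c.β_bv.measurable.inv)
    (Eventually.of_forall fun _ => ENNReal.ofReal_lt_top) _ hA]
  refine integral_congr_ae (Eventually.of_forall fun x => ?_)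
  simp only []
  rw [ENNReal.toReal_ofReal (inv_pos.2 (c.β_pos x)).le, Complex.real_smul]

/-- The singular part of the distribution `V₀ / β` at scale `h²` is the derivative of this
function multiplied by `h`. -/
noncomputable def wiggle (h x : ℝ) : ℝ :=
  (cdfOscillation c.posMeasure (h ^ 2) x - cdfOscillation c.negMeasure (h ^ 2) x) / h

/-- The moving average of `V₀ / β` over intervals of length `h²`. -/
noncomputable def averagedDensity (h x : ℝ) : ℝ :=
  (h ^ 2)⁻¹ * (c.posMeasure.real (Ioc x (x + h ^ 2)) - c.negMeasure.real (Ioc x (x + h ^ 2)))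

/-- The coefficients of the first order system equivalent to `(P(h) - E - iε) u = f`. -/
noncomputable def system (h E : ℝ) (P P' : ℝ → ℝ) : SystemCoefficients where
  a x := (c.α x)⁻¹
  b := c.b
  w := c.wiggle h
  P := P
  P' := P'
  r x := (c.α x)⁻¹ * c.b x ^ 2 + (E - c.V₁ x) * (c.β x)⁻¹ - c.averagedDensity h x
    + (c.α x)⁻¹ * c.wiggle h x ^ 2 - (c.α x)⁻¹ * P x
  γ x := (c.β x)⁻¹

variable {c} {h E ε : ℝ} {P P' : ℝ → ℝ} {f u Φ : ℝ → ℂ}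

/-- Substituting `u'` completes the terms a b² and a w² that `r` contains for this purpose, and `P`
disappears because `r` compensates a P. In this form Φ' can be compared with the differentials of
hαu' + ibu and of wu. -/
theorem rhsΦ_system (hh : 0 < h) (x : ℝ) : (c.system h E P P').rhsΦ h ε f u Φ x =
    -Complex.I * c.b x * (c.system h E P P').rhsU h u Φ x
      - c.wiggle h x * (c.system h E P P').rhsU h u Φ x
      + (h : ℂ)⁻¹ * (c.averagedDensity h x * u x
      + (c.β x : ℂ)⁻¹ * ((c.V₁ x - E - Complex.I * ε) * u x - f x)) := by
  have h1 : (h : ℂ) ≠ 0 := by exact_mod_cast hh.ne'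
  simp only [SystemCoefficients.rhsΦ, SystemCoefficients.rhsU, system]
  push_cast
  linear_combination (-(h : ℂ)⁻¹ * (c.α x : ℂ)⁻¹ * (c.b x)^2 * u x) * Complex.I_sq

theorem measurable_wiggle (h : ℝ) : Measurable (c.wiggle h) :=
  ((measurable_cdfOscillation _).sub (measurable_cdfOscillation _)).div_const _

theorem abs_wiggle_le (hh : 0 < h) (x : ℝ) : |c.wiggle h x| ≤
    (c.posMeasure.real (Ioc x (x + h ^ 2)) + c.negMeasure.real (Ioc x (x + h ^ 2))) / h := by
  rw [wiggle, abs_div, abs_of_pos hh]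
  gcongr
  exact (abs_sub _ _).trans (add_le_add (abs_cdfOscillation_le _ (by positivity) x)
    (abs_cdfOscillation_le _ (by positivity) x))

theorem exists_abs_wiggle_le (hh : 0 < h) : ∃ C, ∀ x, |c.wiggle h x| ≤ C := by
  refine ⟨(c.posMeasure.real univ + c.negMeasure.real univ) / h, fun x =>
    (abs_wiggle_le hh x).trans (div_le_div_of_nonneg_right
      (add_le_add (measureReal_mono (subset_univ _)) (measureReal_mono (subset_univ _))) hh.le)⟩

theorem measurable_averagedDensity (hh : 0 < h) : Measurable (c.averagedDensity h) :=
  ((measurable_real_Ioc _ (by positivity)).sub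
    (measurable_real_Ioc _ (by positivity))).const_mul _

theorem abs_averagedDensity_le (x : ℝ) : |c.averagedDensity h x| ≤ (h ^ 2)⁻¹ *
    (c.posMeasure.real (Ioc x (x + h ^ 2)) + c.negMeasure.real (Ioc x (x + h ^ 2))) := by
  rw [averagedDensity, abs_mul, abs_of_nonneg (by positivity)]
  gcongr
  refine (abs_sub _ _).trans ?_
  rw [abs_of_nonneg measureReal_nonneg, abs_of_nonneg measureReal_nonneg]

theorem exists_abs_averagedDensity_le (h : ℝ) : ∃ C, ∀ x, |c.averagedDensity h x| ≤ C := by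
  refine ⟨(h ^ 2)⁻¹ * (c.posMeasure.real univ + c.negMeasure.real univ), fun x =>
    (abs_averagedDensity_le x).trans (mul_le_mul_of_nonneg_left
      (add_le_add (measureReal_mono (subset_univ _)) (measureReal_mono (subset_univ _)))
      (by positivity))⟩

/-- Multiplication by the magnetic potential. -/
theorem memLp_b₁_mul {p : ℝ≥0∞} (hu : MemLp u p) : MemLp (fun x => (c.b₁ x : ℂ) * u x) p := by
  obtain ⟨C, hC⟩ := c.b₁_bv.exists_abs_le
  exact memLp_ofReal_mul c.b₁_bv.measurable hC hu

theorem memLp_b_mul (hu : MemLp u 2) (hc : Continuous u) {C : ℝ} (hC : ∀ x, ‖u x‖ ≤ C) :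
    MemLp (fun x => (c.b x : ℂ) * u x) 2 := by
  have h1 : MemLp (fun x => (c.b₀ x : ℂ) * u x) 2 := by
    refine c.b₀_L2.of_le_mul (c := C) (c.b₀_L2.ofReal.1.mul hc.aestronglyMeasurable)
      (Eventually.of_forall fun x => ?_)
    rw [norm_mul, Complex.norm_real, mul_comm]
    gcongr
    exact hC x
  refine (h1.add (memLp_b₁_mul (c := c) hu)).ae_eq (Eventually.of_forall fun x => ?_)
  simp [b, add_mul]

/-- Meant for u', for which no supremum bound is available: the `b₀` part is then a product of two
square integrable functions and only integrable. -/
theorem locallyIntegrable_b_mul (hu : MemLp u 2) :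
    LocallyIntegrable (fun x => (c.b x : ℂ) * u x) volume := by
  have h1 : Integrable (fun x => (c.b₀ x : ℂ) * u x) := c.b₀_L2.ofReal.integrable_mul hu
  refine (h1.locallyIntegrable.add
    ((memLp_b₁_mul (c := c) hu).locallyIntegrable (by norm_num))).congr
    (Eventually.of_forall fun x => ?_)
  simp [b, add_mul]

end MagSchro.Coefficients

end

/-! ### Equivalence of the operator equation with the system. -/

theorem MemLp.intervalIntegrable_two {v : ℝ → ℂ} (hv : MemLp v 2) (a b : ℝ) :
    IntervalIntegrable v volume a b :=
  (((hv.locallyIntegrable (by norm_num)).integrableOn_isCompact isCompact_uIcc)).intervalIntegrable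

namespace MagSchro.Coefficients

variable {c : Coefficients} {h E ε : ℝ} {P P' : ℝ → ℝ} {f u u' Φ : ℝ → ℂ}

/-- The product rule for d(wu), where h dw is V₀/β minus its averaged density. It is stated with the
Jordan parts of V₀ so as to match the increments of F. -/
theorem wiggle_mul_sub (hh : 0 < h) (hu : IsPrimitive u u') {a b : ℝ} (hab : a ≤ b) :
    (c.wiggle h b : ℂ) * u b - c.wiggle h a * u a = (h : ℂ)⁻¹ *
      ((∫ x in Ioc a b, ((c.β x)⁻¹ : ℝ) * u x ∂c.V₀.toJordanDecomposition.posPart)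
      - (∫ x in Ioc a b, ((c.β x)⁻¹ : ℝ) * u x ∂c.V₀.toJordanDecomposition.negPart))
      + ∫ x in a..b, ((c.wiggle h x : ℂ) * u' x - (h : ℂ)⁻¹ * (c.averagedDensity h x * u x)) := by
  have hδ : 0 < h ^ 2 := by positivity
  have hh' : (h : ℂ) ≠ 0 := by exact_mod_cast hh.ne'
  have key : ∀ m : Measure ℝ, IsFiniteMeasure m → IntervalIntegrable (fun x =>
      (cdfOscillation m (h ^ 2) x : ℂ) * u' x
        - (((h ^ 2)⁻¹ * m.real (Ioc x (x + h ^ 2)) : ℝ) : ℂ) * u x) volume a b := by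
    intro m _
    refine IntervalIntegrable.sub ?_ ?_
    · have hm : Measurable fun x => (cdfOscillation m (h ^ 2) x : ℂ) :=
        Complex.measurable_ofReal.comp (measurable_cdfOscillation m)
      have hb : ∀ x, ‖(cdfOscillation m (h ^ 2) x : ℂ)‖ ≤ m.real univ := fun x => by
        rw [Complex.norm_real]
        exact (abs_cdfOscillation_le m hδ x).trans (measureReal_mono (subset_univ _))
      exact ⟨(hu.1 a b).1.bdd_mul hm.aestronglyMeasurable (Eventually.of_forall hb),
        (hu.1 a b).2.bdd_mul hm.aestronglyMeasurable (Eventually.of_forall hb)⟩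
    · have hm : Measurable fun x => (((h ^ 2)⁻¹ * m.real (Ioc x (x + h ^ 2)) : ℝ) : ℂ) :=
        Complex.measurable_ofReal.comp ((measurable_real_Ioc m hδ).const_mul _)
      have hb : ∀ x, ‖(((h ^ 2)⁻¹ * m.real (Ioc x (x + h ^ 2)) : ℝ) : ℂ)‖
          ≤ (h ^ 2)⁻¹ * m.real univ := fun x => by
        rw [Complex.norm_real, Real.norm_of_nonneg (by positivity)]
        exact mul_le_mul_of_nonneg_left (measureReal_mono (subset_univ _)) (by positivity)
      have hu2 := hu.continuous.intervalIntegrable (μ := volume) a b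
      exact ⟨hu2.1.bdd_mul hm.aestronglyMeasurable (Eventually.of_forall hb),
        hu2.2.bdd_mul hm.aestronglyMeasurable (Eventually.of_forall hb)⟩
  have h1 := hu.cdfOscillation_mul c.posMeasure hδ hab
  have h2 := hu.cdfOscillation_mul c.negMeasure hδ hab
  rw [posMeasure, c.setIntegral_withDensity_inv_β _ _ measurableSet_Ioc, ← posMeasure] at h1
  rw [negMeasure, c.setIntegral_withDensity_inv_β _ _ measurableSet_Ioc, ← negMeasure] at h2
  have h3 : ∫ x in a..b, ((c.wiggle h x : ℂ) * u' x - (h : ℂ)⁻¹ * (c.averagedDensity h x * u x))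
      = (h : ℂ)⁻¹ * ((∫ x in a..b, ((cdfOscillation c.posMeasure (h ^ 2) x : ℂ) * u' x
        - (((h ^ 2)⁻¹ * c.posMeasure.real (Ioc x (x + h ^ 2)) : ℝ) : ℂ) * u x)) -
        ∫ x in a..b, ((cdfOscillation c.negMeasure (h ^ 2) x : ℂ) * u' x
        - (((h ^ 2)⁻¹ * c.negMeasure.real (Ioc x (x + h ^ 2)) : ℝ) : ℂ) * u x)) := by
    rw [← intervalIntegral.integral_sub (key _ inferInstance) (key _ inferInstance),
      ← intervalIntegral.integral_const_mul]
    refine intervalIntegral.integral_congr fun x _ => ?_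
    simp only [wiggle, averagedDensity]
    push_cast
    field_simp
    ring
  rw [h3]
  simp only [wiggle, Complex.ofReal_div, Complex.ofReal_sub]
  linear_combination (h : ℂ)⁻¹ * h1 - (h : ℂ)⁻¹ * h2

/-- The equation `(P(h) - E - iε) u = f` implies the first order system. -/
theorem Graph.exists_isSolution (hh : 0 < h) {u f : L2}
    (hG : c.Graph h u (f + ((E : ℂ) + Complex.I * ε) • u)) :
    ∃ v Φ : ℝ → ℂ, v =ᵐ[volume] u ∧ (c.system h E P P').IsSolution h ε f v Φ := by
  obtain ⟨v, v', F, hvc, hvu, hv', hwd, hFv, -, hF, H⟩ := hG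
  have hh' : (h : ℂ) ≠ 0 := by exact_mod_cast hh.ne'
  have hv2 : MemLp v 2 := (Lp.memLp u).ae_eq hvu.symm
  have hf2 : MemLp f 2 := Lp.memLp f
  have hvp : IsPrimitive v v' := hwd.isPrimitive hvc
  obtain ⟨Cv, hCv⟩ : ∃ C, ∀ x, ‖v x‖ ≤ C :=
    ⟨_, fun x => Real.le_sqrt_of_sq_le (hvp.norm_sq_le hv2 hv' x)⟩
  obtain ⟨CV, hCV⟩ := c.V₁_bv.exists_abs_le
  obtain ⟨Cα, hCα⟩ := c.α_bv.exists_abs_le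
  obtain ⟨Cβ, hCβ⟩ := c.β_bv.exists_abs_le
  obtain ⟨Cγ, hCγ⟩ := c.exists_abs_inv_β_le
  obtain ⟨Cw, hCw⟩ := c.exists_abs_wiggle_le hh
  obtain ⟨Cd, hCd⟩ := c.exists_abs_averagedDensity_le h
  have hbv := memLp_b_mul (c := c) hv2 hvc hCv
  have hwv := memLp_ofReal_mul (c.measurable_wiggle h) hCw hv2
  have hF2 : MemLp F 2 := by
    have h1 := (memLp_ofReal_mul c.α_bv.measurable hCα hv').const_mul (h : ℂ)
    refine (h1.add (hbv.const_mul Complex.I)).ae_eq ?_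
    filter_upwards [hFv] with x hx
    rw [hx]; simp; ring
  have hR := LocallyBoundedVariationOn.rightLim_ae_eq hF
  -- The right limit is the representative of F whose increments are the values of dF on (a, b].
  -- Subtracting w v trades the V₀ part of dF for an absolutely continuous one.
  set Φ : ℝ → ℂ := fun x => F.rightLim x - c.wiggle h x * v x with hΦ
  have hΦ2 : MemLp Φ 2 := (hF2.ae_eq hR.symm).sub hwv
  have hrhsU : v' =ᵐ[volume] (c.system h E P P').rhsU h v Φ := by
    filter_upwards [hFv, hR] with x hx hx'
    have h1 : (c.α x : ℂ) ≠ 0 := by exact_mod_cast (c.α_pos x).ne'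
    simp only [SystemCoefficients.rhsU, system, hΦ, hx', hx]
    push_cast
    field_simp
    ring
  -- β dF is a sum of three densities: one with respect to Lebesgue measure and one for each Jordan
  -- part of V₀.
  set ρ : Fin 3 → Measure ℝ := ![volume, c.V₀.toJordanDecomposition.posPart,
    c.V₀.toJordanDecomposition.negPart] with hρ
  set g : ℝ → ℂ := fun x => f x + ((E : ℂ) + Complex.I * ε) * v x with hg
  set k₀ : ℝ → ℂ := fun x => (h : ℂ)⁻¹ * ((h : ℂ) * (c.β x) * (-Complex.I * (c.b x * v' x))
    + (c.V₁ x * v x - g x)) with hk₀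
  set k : Fin 3 → ℝ → ℂ := ![k₀, fun x => (h : ℂ)⁻¹ * v x, fun x => -((h : ℂ)⁻¹ * v x)] with hk
  have hg2 : MemLp g 2 := hf2.add (hv2.const_mul _)
  have hVv := memLp_ofReal_mul c.V₁_bv.measurable hCV hv2
  have hbv' := locallyIntegrable_b_mul (c := c) hv'
  have hβbv' : LocallyIntegrable (fun x => (c.β x : ℂ) * (c.b x * v' x)) volume := by
    intro x
    obtain ⟨s, hs, hi⟩ := hbv' x
    refine ⟨s, hs, hi.bdd_mul (c := Cβ)
      (Complex.measurable_ofReal.comp c.β_bv.measurable).aestronglyMeasurable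
      (Eventually.of_forall fun x => ?_)⟩
    rw [Complex.norm_real]; exact hCβ x
  have hk₀l : LocallyIntegrable k₀ volume := by
    have h1 : LocallyIntegrable ((-Complex.I) • fun x => ((c.β x : ℂ) * (c.b x * v' x))) volume :=
      hβbv'.smul _
    have h2 : LocallyIntegrable ((h : ℂ)⁻¹ • ((fun x => (c.V₁ x : ℂ) * v x) - g)) volume :=
      ((hVv.sub hg2).locallyIntegrable (by norm_num)).smul _
    refine (h1.add h2).congr (Eventually.of_forall fun x => ?_)
    simp only [hk₀, Pi.add_apply, Pi.smul_apply, Pi.sub_apply, smul_eq_mul]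
    field_simp
  have hloc : ∀ {w : ℝ → ℂ}, LocallyIntegrable w volume → ∀ r, IntegrableOn w (Ioo (-r) r) :=
    fun hw r => (hw.integrableOn_isCompact isCompact_Icc).mono_set Ioo_subset_Icc_self
  have hvm : ∀ m : Measure ℝ, IsFiniteMeasure m → Integrable v m := fun m _ =>
    Integrable.of_bound hvc.aestronglyMeasurable Cv (Eventually.of_forall hCv)
  have hki : ∀ i r, IntegrableOn (k i) (Ioo (-r) r) (ρ i) := by
    intro i r
    fin_cases i
    · exact hloc hk₀l r
    · exact ((hvm c.V₀.toJordanDecomposition.posPart inferInstance).const_mul _).integrableOn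
    · exact ((hvm c.V₀.toJordanDecomposition.negPart inferInstance).const_mul _).neg.integrableOn
  obtain ⟨mβ, hmβ, hβm⟩ := c.β_inf
  -- The equation of the graph is solved for β dF and then divided by β; no continuity of β is
  -- available, so this is done for measures.
  have hinc := fun a b (hab : a ≤ b) => rightLim_sub_rightLim hF hki c.β_bv.measurable hmβ hβm
    (fun x => (le_abs_self _).trans (hCβ x)) (fun r A hA hAr => by
      have h1 := H r A hA hAr
      rw [setIntegral_signedMeasure _ hvc hCv hA] at h1
      have i1 : IntegrableOn (fun x => (h : ℂ) * c.β x * c.b x * (-Complex.I * v' x)) A := by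
        refine IntegrableOn.mono_set (hloc ?_ r) hAr
        have h1 : LocallyIntegrable ((h * -Complex.I : ℂ) •
          fun x => ((c.β x : ℂ) * (c.b x * v' x))) volume := hβbv'.smul _
        refine h1.congr (Eventually.of_forall fun x => ?_)
        simp only [Pi.smul_apply, smul_eq_mul]; ring
      have i2 : IntegrableOn (fun x => v x * (c.V₁ x : ℂ)) A :=
        (hloc ((hVv.locallyIntegrable (by norm_num)).congr
          (Eventually.of_forall fun x => mul_comm _ _)) r).mono_set hAr
      have i3 : IntegrableOn g A := (hloc (hg2.locallyIntegrable (by norm_num)) r).mono_set hAr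
      have h2 : ∫ x in A, (f + ((E : ℂ) + Complex.I * ε) • u : L2) x = ∫ x in A, g x := by
        refine integral_congr_ae (ae_restrict_of_ae ?_)
        filter_upwards [Lp.coeFn_add f (((E : ℂ) + Complex.I * ε) • u),
          Lp.coeFn_smul ((E : ℂ) + Complex.I * ε) u, hvu] with x h1 h2 h3
        rw [h1, Pi.add_apply, h2, Pi.smul_apply, ← h3, smul_eq_mul]
      have h3 : ∫ x in A, k₀ x = (h : ℂ)⁻¹ *
          ((∫ x in A, (h : ℂ) * c.β x * c.b x * (-Complex.I * v' x))
          + (∫ x in A, v x * (c.V₁ x : ℂ)) - ∫ x in A, g x) := by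
        have i12 : IntegrableOn (fun x => (h : ℂ) * c.β x * c.b x * (-Complex.I * v' x)
          + v x * (c.V₁ x : ℂ)) A := i1.add i2
        rw [← integral_add i1 i2, ← integral_sub i12 i3, ← integral_const_mul]
        refine integral_congr_ae (Eventually.of_forall fun x => ?_)
        simp only [hk₀]
        ring
      rw [h2] at h1
      rw [Fin.sum_univ_three]
      change _ = (∫ x in A, k₀ x) + (∫ x in A, (h : ℂ)⁻¹ * v x
        ∂c.V₀.toJordanDecomposition.posPart) + ∫ x in A, -((h : ℂ)⁻¹ * v x)
        ∂c.V₀.toJordanDecomposition.negPart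
      rw [h3, MeasureTheory.integral_neg, integral_const_mul, integral_const_mul]
      linear_combination -(h : ℂ)⁻¹ * h1
        - (∫ᵛ x in A, c.β x ∂•(dLoc hF r)) * inv_mul_cancel₀ hh') hab
  set R : ℝ → ℂ := fun x => -Complex.I * (c.b x * v' x) - c.wiggle h x * v' x
      + (h : ℂ)⁻¹ * (c.averagedDensity h x * v x
      + (c.β x : ℂ)⁻¹ * ((c.V₁ x - E - Complex.I * ε) * v x - f x)) with hRdef
  have hdv := memLp_ofReal_mul (c.measurable_averagedDensity hh) hCd hv2
  have hwv' := memLp_ofReal_mul (c.measurable_wiggle h) hCw hv'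
  have hγ := memLp_ofReal_mul c.β_bv.measurable.inv hCγ
    (hVv.sub hg2)
  have hγk₀ : LocallyIntegrable (fun x => ((c.β x)⁻¹ : ℝ) * k₀ x) volume := by
    intro x
    obtain ⟨s, hs, hi⟩ := hk₀l x
    refine ⟨s, hs, hi.bdd_mul (c := Cγ)
      (Complex.measurable_ofReal.comp c.β_bv.measurable.inv).aestronglyMeasurable
      (Eventually.of_forall fun x => ?_)⟩
    rw [Complex.norm_real]; exact hCγ x
  have hi₁ : ∀ a b, IntervalIntegrable (fun x => ((c.β x)⁻¹ : ℝ) * k₀ x) volume a b := fun a b =>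
    (hγk₀.integrableOn_isCompact isCompact_uIcc).intervalIntegrable
  have hi₂ : ∀ a b, IntervalIntegrable (fun x => (c.wiggle h x : ℂ) * v' x
      - (h : ℂ)⁻¹ * (c.averagedDensity h x * v x)) volume a b := fun a b =>
    MemLp.intervalIntegrable_two (hwv'.sub (hdv.const_mul _)) a b
  have hRk : ∀ x, R x = ((c.β x)⁻¹ : ℝ) * k₀ x - ((c.wiggle h x : ℂ) * v' x
      - (h : ℂ)⁻¹ * (c.averagedDensity h x * v x)) := by
    intro x
    have h1 : (c.β x : ℂ) ≠ 0 := by exact_mod_cast (c.β_pos x).ne'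
    simp only [hRdef, hk₀, hg]
    push_cast
    field_simp
    ring
  have hΦp : IsPrimitive Φ R := by
    have hRi : ∀ a b, IntervalIntegrable R volume a b := fun a b => by
      rw [funext hRk]; exact (hi₁ a b).sub (hi₂ a b)
    have hle : ∀ a b, a ≤ b → ∫ x in a..b, R x = Φ b - Φ a := by
      intro a b hab
      have h1 := hinc a b hab
      rw [Fin.sum_univ_three] at h1
      change _ = (∫ x in Ioc a b, ((c.β x)⁻¹ : ℝ) * k₀ x) + (∫ x in Ioc a b, ((c.β x)⁻¹ : ℝ) *
        ((h : ℂ)⁻¹ * v x) ∂c.V₀.toJordanDecomposition.posPart) + ∫ x in Ioc a b,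
        ((c.β x)⁻¹ : ℝ) * -((h : ℂ)⁻¹ * v x) ∂c.V₀.toJordanDecomposition.negPart at h1
      -- Its V₀ integrals are exactly those in the increment of F, so Φ has an increment given by
      -- Lebesgue integrals only.
      have h2 := wiggle_mul_sub (c := c) hh hvp hab
      simp_rw [mul_neg, mul_left_comm _ (h : ℂ)⁻¹ (v _)] at h1
      rw [MeasureTheory.integral_neg, integral_const_mul, integral_const_mul,
        ← intervalIntegral.integral_of_le hab] at h1
      rw [funext hRk, intervalIntegral.integral_sub (hi₁ a b) (hi₂ a b)]
      simp only [hΦ]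
      linear_combination -h1 + h2
    refine ⟨hRi, fun a b => ?_⟩
    rcases le_total a b with hab | hab
    · exact hle a b hab
    · rw [intervalIntegral.integral_symm, hle b a hab, neg_sub]
  refine ⟨v, Φ, hvu, hv2, hΦ2, hvp.congr_deriv hrhsU, hΦp.congr_deriv ?_⟩
  filter_upwards [hrhsU] with x hx
  rw [rhsΦ_system hh, ← hx, hRdef]
  ring

end MagSchro.Coefficients

namespace MagSchro.Coefficients

variable {c : Coefficients} {h E ε K : ℝ} {P P' : ℝ → ℝ}

/-- A square integrable solution of the first order system solves `(P(h) - E - iε) u = f`. -/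
theorem graph_of_isSolution (hq : (c.system h E P P').Bounded h K) {u f : L2} {v Φ : ℝ → ℂ}
    (hvu : v =ᵐ[volume] u) (hs : (c.system h E P P').IsSolution h ε f v Φ) :
    c.Graph h u (f + ((E : ℂ) + Complex.I * ε) • u) := by
  have hh := hq.h_pos
  have hh' : (h : ℂ) ≠ 0 := by exact_mod_cast hh.ne'
  have hv2 := hs.u_L2
  have hf2 : MemLp f 2 := Lp.memLp f
  have hvc := hs.u_prim.continuous
  obtain ⟨Cv, hCv⟩ : ∃ C, ∀ x, ‖v x‖ ≤ C :=
    ⟨_, fun x => Real.le_sqrt_of_sq_le (hs.norm_sq_u_le hq x)⟩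
  -- The energy estimate is used here only qualitatively, to see that F will be bounded.
  obtain ⟨CΦ, hCΦ⟩ : ∃ C, ∀ x, ‖Φ x‖ ≤ C :=
    ⟨_, fun x => Real.le_sqrt_of_sq_le ((le_add_of_nonneg_right
      (mul_nonneg (hq.P_pos x).le (sq_nonneg _))).trans (hs.energy_le hq hf2 x))⟩
  obtain ⟨CV, hCV⟩ := c.V₁_bv.exists_abs_le
  obtain ⟨Cβ, hCβ⟩ := c.β_bv.exists_abs_le
  obtain ⟨Ca, hCa⟩ := c.exists_abs_inv_α_le
  obtain ⟨Cw, hCw⟩ := c.exists_abs_wiggle_le hh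
  obtain ⟨Cd, hCd⟩ := c.exists_abs_averagedDensity_le h
  have hbv := memLp_b_mul (c := c) hv2 hvc hCv
  have hwv := memLp_ofReal_mul (c.measurable_wiggle h) hCw hv2
  set v' := (c.system h E P P').rhsU h v Φ with hv'def
  set F : ℝ → ℂ := fun x => Φ x + c.wiggle h x * v x with hF
  have hFeq : ∀ x, F x = (h : ℂ) * c.α x * v' x + Complex.I * c.b x * v x := by
    intro x
    have h1 : (c.α x : ℂ) ≠ 0 := by exact_mod_cast (c.α_pos x).ne'
    simp only [hv'def, SystemCoefficients.rhsU, system, hF]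
    push_cast
    field_simp
    ring
  have hF2 : MemLp F 2 := hs.Φ_L2.add hwv
  have hv' : MemLp v' 2 := by
    refine ((memLp_ofReal_mul c.α_bv.measurable.inv hCa
      (hF2.sub (hbv.const_mul Complex.I))).const_mul (h : ℂ)⁻¹).ae_eq
      (Eventually.of_forall fun x => ?_)
    have h1 : (c.α x : ℂ) ≠ 0 := by exact_mod_cast (c.α_pos x).ne'
    simp only [Pi.inv_apply, Pi.sub_apply, hFeq]
    push_cast
    field_simp
    ring
  have hFtop : MemLp F ⊤ := by
    refine memLp_top_of_bound hF2.1 (CΦ + Cw * Cv) (Eventually.of_forall fun x => ?_)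
    refine (norm_add_le _ _).trans (add_le_add (hCΦ x) ?_)
    rw [norm_mul, Complex.norm_real]
    exact mul_le_mul (hCw x) (hCv x) (norm_nonneg _) ((abs_nonneg _).trans (hCw x))
  set R := (c.system h E P P').rhsΦ h ε f v Φ with hR
  set g : ℝ → ℂ := fun x => f x + ((E : ℂ) + Complex.I * ε) * v x with hg
  -- The Lebesgue density of dF: the derivative of Φ plus the absolutely continuous part of d(wv).
  set k₀ : ℝ → ℂ := fun x => R x + ((c.wiggle h x : ℂ) * v' x
    - (h : ℂ)⁻¹ * (c.averagedDensity h x * v x)) with hk₀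
  set k₁ : ℝ → ℂ := fun x => (h : ℂ)⁻¹ * (((c.β x)⁻¹ : ℝ) * v x) with hk₁
  set ρ : Fin 3 → Measure ℝ := ![volume, c.V₀.toJordanDecomposition.posPart,
    c.V₀.toJordanDecomposition.negPart] with hρ
  set k : Fin 3 → ℝ → ℂ := ![k₀, k₁, fun x => -k₁ x] with hk
  have hi₂ : ∀ a b, IntervalIntegrable (fun x => (c.wiggle h x : ℂ) * v' x
      - (h : ℂ)⁻¹ * (c.averagedDensity h x * v x)) volume a b := fun a b =>
    MemLp.intervalIntegrable_two ((memLp_ofReal_mul (c.measurable_wiggle h) hCw hv').sub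
      ((memLp_ofReal_mul (c.measurable_averagedDensity hh) hCd hv2).const_mul _)) a b
  have hk₀i : ∀ a b, IntervalIntegrable k₀ volume a b := fun a b =>
    (hs.Φ_prim.1 a b).add (hi₂ a b)
  have hvm : ∀ m : Measure ℝ, IsFiniteMeasure m → Integrable v m := fun m _ =>
    Integrable.of_bound hvc.aestronglyMeasurable Cv (Eventually.of_forall hCv)
  obtain ⟨Cγ, hCγ⟩ := c.exists_abs_inv_β_le
  have hk₁m : ∀ m : Measure ℝ, IsFiniteMeasure m → Integrable k₁ m := fun m hm =>
    ((hvm m hm).bdd_mul (c := Cγ)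
      (Complex.measurable_ofReal.comp c.β_bv.measurable.inv).aestronglyMeasurable
      (Eventually.of_forall fun x => by rw [Function.comp_apply, Complex.norm_real]; exact hCγ x)).const_mul _
  have hki : ∀ i a b, IntegrableOn (k i) (Ioc a b) (ρ i) := by
    intro i a b
    fin_cases i
    · exact (hk₀i a b).1
    · exact (hk₁m c.V₀.toJordanDecomposition.posPart inferInstance).integrableOn
    · exact (hk₁m c.V₀.toJordanDecomposition.negPart inferInstance).neg.integrableOn
  obtain ⟨hFbv, H⟩ := exists_dLoc_eq (F := F) hki fun a b hab => by
    rw [Fin.sum_univ_three]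
    change _ = (∫ x in Ioc a b, k₀ x) + (∫ x in Ioc a b, k₁ x
      ∂c.V₀.toJordanDecomposition.posPart) + ∫ x in Ioc a b, -k₁ x
      ∂c.V₀.toJordanDecomposition.negPart
    have h1 := wiggle_mul_sub (c := c) hh hs.u_prim hab
    have h2 := hs.Φ_prim.2 a b
    rw [← intervalIntegral.integral_of_le hab, intervalIntegral.integral_add (hs.Φ_prim.1 a b)
      (hi₂ a b), MeasureTheory.integral_neg, integral_const_mul, integral_const_mul]
    simp only [hF]
    linear_combination -h2 + h1
  refine ⟨v, v', F, hvc, hvu, hv', hs.u_prim.hasWeakDeriv, Eventually.of_forall hFeq, hFtop,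
    hFbv, fun r A hA hAr => ?_⟩
  rw [H c.β Cβ c.β_bv.measurable hCβ r A hA hAr, Fin.sum_univ_three,
    setIntegral_signedMeasure _ hvc hCv hA]
  change -(h : ℂ) * ((∫ x in A, (c.β x : ℂ) * k₀ x) + (∫ x in A, (c.β x : ℂ) * k₁ x
      ∂c.V₀.toJordanDecomposition.posPart) + ∫ x in A, (c.β x : ℂ) * -k₁ x
      ∂c.V₀.toJordanDecomposition.negPart) + _ + _ = _
  have hβk₁ : ∀ x, (c.β x : ℂ) * k₁ x = (h : ℂ)⁻¹ * v x := fun x => by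
    have h1 : (c.β x : ℂ) ≠ 0 := by exact_mod_cast (c.β_pos x).ne'
    simp only [hk₁]
    push_cast
    field_simp
  simp_rw [mul_neg, hβk₁]
  rw [MeasureTheory.integral_neg, integral_const_mul, integral_const_mul]
  have hloc : ∀ {w : ℝ → ℂ}, LocallyIntegrable w volume → IntegrableOn w A :=
    fun hw => ((hw.integrableOn_isCompact isCompact_Icc).mono_set Ioo_subset_Icc_self).mono_set hAr
  have hbdd : ∀ {w : ℝ → ℂ}, IntegrableOn w A → IntegrableOn (fun x => (c.β x : ℂ) * w x) A :=
    fun hw => hw.bdd_mul (c := Cβ)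
      (Complex.measurable_ofReal.comp c.β_bv.measurable).aestronglyMeasurable
      (Eventually.of_forall fun x => by rw [Complex.norm_real]; exact hCβ x)
  have i0 : IntegrableOn (fun x => (c.β x : ℂ) * k₀ x) A :=
    hbdd (((hk₀i (-r) r).1.mono_set Ioo_subset_Ioc_self).mono_set hAr)
  have i1 : IntegrableOn (fun x => (h : ℂ) * c.β x * c.b x * (-Complex.I * v' x)) A := by
    refine ((hbdd (hloc (locallyIntegrable_b_mul (c := c) hv'))).const_mul
      ((h : ℂ) * -Complex.I)).congr (Eventually.of_forall fun x => ?_)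
    simp only []
    ring
  have i2 : IntegrableOn (fun x => v x * (c.V₁ x : ℂ)) A := by
    simp_rw [mul_comm (v _)]
    exact hloc ((memLp_ofReal_mul c.V₁_bv.measurable hCV hv2).locallyIntegrable (by norm_num))
  have h2 : ∫ x in A, (f + ((E : ℂ) + Complex.I * ε) • u : L2) x = ∫ x in A, g x := by
    refine integral_congr_ae (ae_restrict_of_ae ?_)
    filter_upwards [Lp.coeFn_add f (((E : ℂ) + Complex.I * ε) • u),
      Lp.coeFn_smul ((E : ℂ) + Complex.I * ε) u, hvu] with x h1 h2 h3
    rw [h1, Pi.add_apply, h2, Pi.smul_apply, ← h3, smul_eq_mul]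
  have i01 : IntegrableOn (fun x => -(h : ℂ) * ((c.β x : ℂ) * k₀ x)
      + (h : ℂ) * c.β x * c.b x * (-Complex.I * v' x)) A := (i0.const_mul _).add i1
  have h3 : ∫ x in A, g x = -(h : ℂ) * (∫ x in A, (c.β x : ℂ) * k₀ x)
      + (∫ x in A, (h : ℂ) * c.β x * c.b x * (-Complex.I * v' x))
      + ∫ x in A, v x * (c.V₁ x : ℂ) := by
    rw [← integral_const_mul, ← integral_add (i0.const_mul _) i1, ← integral_add i01 i2]
    refine integral_congr_ae (Eventually.of_forall fun x => ?_)
    have h1 : (c.β x : ℂ) ≠ 0 := by exact_mod_cast (c.β_pos x).ne'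
    simp only [hk₀, hR, rhsΦ_system hh, ← hv'def, hg]
    field_simp
    ring
  rw [h2, h3]
  linear_combination (-(∫ x in A, v x ∂c.V₀.toJordanDecomposition.posPart)
    + ∫ x in A, v x ∂c.V₀.toJordanDecomposition.negPart) * mul_inv_cancel₀ hh'

end MagSchro.Coefficients

-- The form method on H¹.

local notation "⟪" x ", " y "⟫" => inner ℂ x y

theorem exists_mul_operator {k : ℝ → ℂ} (hk : Measurable k) {C : ℝ} (hC : ∀ x, ‖k x‖ ≤ C) :
    ∃ M : L2 →L[ℂ] L2, ∀ u : L2, M u =ᵐ[volume] fun x => k x * u x := by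
  have h1 : MemLp k ⊤ volume := memLp_top_of_bound hk.aestronglyMeasurable C
    (Eventually.of_forall hC)
  refine ⟨(ContinuousLinearMap.mul ℂ ℂ).holderL volume ⊤ 2 2 h1.toLp, fun u => ?_⟩
  have h2 := (ContinuousLinearMap.mul ℂ ℂ).coeFn_holder (r := 2) h1.toLp u
  filter_upwards [h2, h1.coeFn_toLp] with x hx hx'
  rw [← hx']
  exact hx

theorem inner_L2_eq (u v : L2) : ⟪u, v⟫ = ∫ x, starRingEnd ℂ (u x) * v x := by
  rw [MeasureTheory.L2.inner_def]
  refine integral_congr_ae (Eventually.of_forall fun x => ?_)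
  simp only [RCLike.inner_apply]
  ring

theorem integral_norm_sq_L2 (u : L2) : ∫ x, ‖u x‖ ^ 2 = ‖u‖ ^ 2 := by
  have h1 := inner_self_eq_norm_sq_to_K (𝕜 := ℂ) u
  rw [inner_L2_eq] at h1
  have h2 : ∀ x, starRingEnd ℂ (u x) * u x = ((‖u x‖ ^ 2 : ℝ) : ℂ) := fun x => by
    rw [mul_comm, Complex.mul_conj, Complex.sq_norm]
  simp_rw [h2] at h1
  rw [integral_complex_ofReal] at h1
  exact Complex.ofReal_injective (h1.trans (Complex.ofReal_pow _ _).symm)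

theorem integrable_norm_sq_L2 (u : L2) : Integrable fun x => ‖u x‖ ^ 2 := by
  simpa using (Lp.memLp u).integrable_norm_pow (by simp)

/-- Lower bounds for the quadratic form of a multiplication operator. -/
theorem mul_norm_sq_le_re_inner {M : L2 →L[ℂ] L2} {k : ℝ → ℂ}
    (hM : ∀ u : L2, M u =ᵐ[volume] fun x => k x * u x) {z : ℂ} {m : ℝ}
    (hz : ∀ x, m ≤ (z * k x).re) (u : L2) : m * ‖u‖ ^ 2 ≤ (z * ⟪u, M u⟫).re := by
  have hi : Integrable fun x => starRingEnd ℂ (u x) * (M u) x := by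
    have := L2.integrable_inner (𝕜 := ℂ) u (M u)
    refine this.congr (Eventually.of_forall fun x => ?_)
    simp only [RCLike.inner_apply]
    ring
  have h2 : z * ⟪u, M u⟫ = ∫ x, z * (starRingEnd ℂ (u x) * (M u) x) := by
    rw [inner_L2_eq, integral_const_mul]
  rw [h2, ← integral_norm_sq_L2, ← integral_const_mul]
  have h3 := integral_re (hi.const_mul z)
  change _ = (∫ x, z * (starRingEnd ℂ (u x) * (M u) x)).re at h3
  rw [← h3]
  refine integral_mono_ae ((integrable_norm_sq_L2 u).const_mul m) (hi.const_mul z).re ?_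
  filter_upwards [hM u] with x hx
  have h4 : z * (starRingEnd ℂ (u x) * (M u) x) = z * k x * ((‖u x‖ ^ 2 : ℝ) : ℂ) := by
    rw [hx, Complex.sq_norm, ← Complex.mul_conj]; ring
  change m * ‖u x‖ ^ 2 ≤ (z * (starRingEnd ℂ (u x) * (M u) x)).re
  rw [h4, Complex.re_mul_ofReal]
  exact mul_le_mul_of_nonneg_right (hz x) (sq_nonneg _)

/-- Invertibility of form operators whose imaginary part controls the lower order terms. -/
theorem isUnit_of_form {H L : Type*} [NormedAddCommGroup H] [InnerProductSpace ℂ H]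
    [CompleteSpace H] [NormedAddCommGroup L] [InnerProductSpace ℂ L] [CompleteSpace L]
    {D J T : H →L[ℂ] L} {A : H →L[ℂ] H} {M₁ M₂ : L →L[ℂ] L} {m ε C : ℝ} (hm : 0 < m) (hε : ε ≠ 0)
    (hC : 0 ≤ C)
    (hA : ∀ U V, ⟪V, A U⟫ = ⟪D V, M₁ (D U)⟫ + ⟪D V, T U⟫ + ⟪T V, D U⟫ + ⟪J V, M₂ (J U)⟫)
    (hH : ∀ U, ‖U‖ ^ 2 = ‖J U‖ ^ 2 + ‖D U‖ ^ 2)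
    (h1 : ∀ u, m * ‖u‖ ^ 2 ≤ (⟪u, M₁ u⟫).re) (h1' : ∀ u, (⟪u, M₁ u⟫).im = 0)
    (h2 : ∀ u, -C * ‖u‖ ^ 2 ≤ (⟪u, M₂ u⟫).re)
    (h2' : ∀ u, m * ε ^ 2 * ‖u‖ ^ 2 ≤ (Complex.I * ε * ⟪u, M₂ u⟫).re)
    (hT : ∀ U, ‖T U‖ ≤ m / 4 * ‖D U‖ + C * ‖J U‖) : IsUnit A := by
  set C₁ := 4 * C ^ 2 / m + C with hC₁
  set C₂ := (m * |ε|)⁻¹ with hC₂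
  have hε' : 0 < |ε| := abs_pos.2 hε
  have hC₂0 : 0 < C₂ := by positivity
  have hC₁0 : 0 ≤ C₁ := by positivity
  have hκ : 0 < C₂ + 4 / m * (1 + C₁ * C₂) := by positivity
  -- Lax-Milgram: it suffices to bound the square of the norm by a multiple of the modulus of the
  -- form.
  refine ContinuousLinearMap.isUnit_of_forall_le_norm_inner_map A
    (c := (C₂ + 4 / m * (1 + C₁ * C₂))⁻¹.toNNReal) (Real.toNNReal_pos.2 (inv_pos.2 hκ))
    fun U => ?_
  rw [← inner_conj_symm, RCLike.norm_conj]
  set N := ‖⟪U, A U⟫‖ with hN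
  set X := ‖D U‖
  set Y := ‖J U‖
  have hconj : ⟪T U, D U⟫ = starRingEnd ℂ ⟪D U, T U⟫ := (inner_conj_symm _ _).symm
  have hre : |(⟪D U, T U⟫).re| ≤ X * ‖T U‖ :=
    (Complex.abs_re_le_norm _).trans (norm_inner_le_norm _ _)
  have e1 : m * X ^ 2 - 2 * (X * ‖T U‖) - C * Y ^ 2 ≤ N := by
    refine le_trans ?_ (Complex.re_le_norm _)
    rw [hA, hconj]
    simp only [Complex.add_re, Complex.conj_re]
    have := h1 (D U)
    have := h2 (J U)
    have := (abs_le.1 hre).1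
    linarith
  -- Multiplication by iε isolates the imaginary part. The `M₁` term is real and the two `T` terms
  -- are conjugate to each other, so only `M₂` contributes.
  have e2 : m * ε ^ 2 * Y ^ 2 ≤ |ε| * N := by
    have h3 : (Complex.I * ε * ⟪U, A U⟫).re ≤ |ε| * N := by
      refine (Complex.re_le_norm _).trans ?_
      rw [norm_mul, norm_mul, Complex.norm_I, Complex.norm_real, one_mul, Real.norm_eq_abs]
    refine le_trans ?_ h3
    refine (h2' (J U)).trans (le_of_eq ?_)
    rw [hA, hconj]
    have := h1' (D U)
    simp only [mul_add, Complex.add_re, Complex.mul_re, Complex.mul_im, Complex.I_re, Complex.I_im,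
      Complex.ofReal_re, Complex.ofReal_im, Complex.conj_re, Complex.conj_im, this]
    ring
  have e3 : Y ^ 2 ≤ C₂ * N := by
    rw [hC₂, ← sq_abs ε] at *
    rw [← div_eq_inv_mul, le_div_iff₀ (by positivity)]
    nlinarith
  -- The cross terms use up 3m/4 of the coefficient of X²: m/2 from the relative bound of `T` and
  -- m/4 from Young's inequality.
  have e4 : m / 4 * X ^ 2 - C₁ * Y ^ 2 ≤ N := by
    refine le_trans ?_ e1
    have h3 : X * ‖T U‖ ≤ X * (m / 4 * X + C * Y) :=
      mul_le_mul_of_nonneg_left (hT U) (norm_nonneg _)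
    have h4 : 2 * C * X * Y ≤ m / 4 * X ^ 2 + 4 * C ^ 2 / m * Y ^ 2 := by
      have h5 : m / 4 * X ^ 2 + 4 * C ^ 2 / m * Y ^ 2 - 2 * C * X * Y
          = (m * X - 4 * C * Y) ^ 2 / (4 * m) := by field_simp; ring
      have : 0 ≤ (m * X - 4 * C * Y) ^ 2 / (4 * m) := by positivity
      linarith
    rw [hC₁]
    nlinarith
  rw [hH, Real.coe_toNNReal _ (inv_pos.2 hκ).le, ← div_eq_mul_inv, div_le_iff₀ hκ]
  have e5 : X ^ 2 ≤ 4 / m * (1 + C₁ * C₂) * N := by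
    have h3 : m / 4 * X ^ 2 ≤ N + C₁ * (C₂ * N) := by
      have := mul_le_mul_of_nonneg_left e3 hC₁0
      linarith
    have h4 : X ^ 2 = 4 / m * (m / 4 * X ^ 2) := by field_simp
    rw [h4]
    calc 4 / m * (m / 4 * X ^ 2) ≤ 4 / m * (N + C₁ * (C₂ * N)) := by gcongr
      _ = _ := by ring
  linarith

/-- The pairs `(φ', φ)` of smooth compactly supported real functions. -/
def testPairs : Set (WithLp 2 (L2 × L2)) :=
  {U | ∃ φ : ℝ → ℝ, ContDiff ℝ ∞ φ ∧ HasCompactSupport φ ∧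
    (U.fst =ᵐ[volume] fun x => ((deriv φ x : ℝ) : ℂ)) ∧ U.snd =ᵐ[volume] fun x => (φ x : ℂ)}

/-- The Sobolev space `H¹(ℝ)` as the space of pairs `(u, u')`. -/
noncomputable def sobolevPairs : Submodule ℂ (WithLp 2 (L2 × L2)) := (Submodule.span ℂ testPairs)ᗮ

theorem memLp_ofReal_test {φ : ℝ → ℝ} (hφ : Continuous φ) (hs : HasCompactSupport φ) :
    MemLp (fun x => (φ x : ℂ)) 2 :=
  (hφ.memLp_of_hasCompactSupport hs).ofReal

/-- Test functions are real, so orthogonality to (φ', φ) is the definition of the weak derivative.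
As an orthogonal complement the space is closed, hence a Hilbert space. -/
theorem mem_sobolevPairs {U : WithLp 2 (L2 × L2)} :
    U ∈ sobolevPairs ↔ HasWeakDeriv U.fst U.snd := by
  have h1 : U ∈ sobolevPairs ↔ ∀ V ∈ testPairs, ⟪V, U⟫ = 0 := by
    rw [sobolevPairs, Submodule.mem_orthogonal]
    refine ⟨fun h V hV => h V (Submodule.subset_span hV), fun h V hV => ?_⟩
    induction hV using Submodule.span_induction with
    | mem V hV => exact h V hV
    | zero => exact inner_zero_left _
    | add V W _ _ hV hW => rw [inner_add_left, hV, hW, add_zero]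
    | smul a V _ hV => rw [inner_smul_left, hV, mul_zero]
  have h2 : ∀ V : WithLp 2 (L2 × L2), ∀ φ : ℝ → ℝ,
      V.fst =ᵐ[volume] (fun x => ((deriv φ x : ℝ) : ℂ)) → V.snd =ᵐ[volume] (fun x => (φ x : ℂ)) →
      ⟪V, U⟫ = (∫ x, ((deriv φ x : ℝ) : ℂ) * U.fst x) + ∫ x, (φ x : ℂ) * U.snd x := by
    intro V φ h1 h2
    rw [WithLp.prod_inner_apply, inner_L2_eq, inner_L2_eq]
    congr 1
    · refine integral_congr_ae ?_
      filter_upwards [h1] with x hx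
      have hx' : (WithLp.ofLp V).1 x = _ := hx
      rw [hx', Complex.conj_ofReal]; rfl
    · refine integral_congr_ae ?_
      filter_upwards [h2] with x hx
      have hx' : (WithLp.ofLp V).2 x = _ := hx
      rw [hx', Complex.conj_ofReal]; rfl
  rw [h1]
  constructor
  · intro h
    refine ⟨(Lp.memLp _).locallyIntegrable (by norm_num),
      (Lp.memLp _).locallyIntegrable (by norm_num), fun φ hφ hs => ?_⟩
    have m1 := memLp_ofReal_test (hφ.continuous_deriv (by simp)) hs.deriv
    have m2 := memLp_ofReal_test hφ.continuous hs
    have h3 := h (WithLp.toLp 2 (m1.toLp, m2.toLp)) ⟨φ, hφ, hs, m1.coeFn_toLp, m2.coeFn_toLp⟩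
    rw [h2 (WithLp.toLp 2 (m1.toLp, m2.toLp)) φ m1.coeFn_toLp m2.coeFn_toLp] at h3
    exact eq_neg_of_add_eq_zero_left h3
  · rintro ⟨-, -, h⟩ V ⟨φ, hφ, hs, h3, h4⟩
    rw [h2 V φ h3 h4, h φ hφ hs, neg_add_cancel]

theorem integral_norm_mul_norm_le {E F : Type*} [NormedAddCommGroup E] [NormedAddCommGroup F]
    {u : ℝ → E} {v : ℝ → F} (hu : MemLp u 2) (hv : MemLp v 2) :
    ∫ x, ‖u x‖ * ‖v x‖ ≤ √(∫ x, ‖u x‖ ^ 2) * √(∫ x, ‖v x‖ ^ 2) := by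
  have h1 := integral_mul_norm_le_Lp_mul_Lq (μ := volume) (f := fun x => ‖u x‖)
    (g := fun x => ‖v x‖) Real.HolderConjugate.two_two (by simpa using hu.norm)
    (by simpa using hv.norm)
  simpa [Real.sqrt_eq_rpow] using h1

instance : CompleteSpace sobolevPairs :=
  (Submodule.isClosed_orthogonal _).completeSpace_coe

/-- The value of an element of the Sobolev space. -/
noncomputable def sobolevVal : sobolevPairs →L[ℂ] L2 :=
  ContinuousLinearMap.fst ℂ L2 L2 ∘L
    ((WithLp.prodContinuousLinearEquiv 2 ℂ L2 L2 : WithLp 2 (L2 × L2) →L[ℂ] L2 × L2) ∘L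
      sobolevPairs.subtypeL)

/-- The derivative of an element of the Sobolev space. -/
noncomputable def sobolevDeriv : sobolevPairs →L[ℂ] L2 :=
  ContinuousLinearMap.snd ℂ L2 L2 ∘L
    ((WithLp.prodContinuousLinearEquiv 2 ℂ L2 L2 : WithLp 2 (L2 × L2) →L[ℂ] L2 × L2) ∘L
      sobolevPairs.subtypeL)

theorem sobolev_norm_sq (U : sobolevPairs) :
    ‖U‖ ^ 2 = ‖sobolevVal U‖ ^ 2 + ‖sobolevDeriv U‖ ^ 2 :=
  WithLp.prod_norm_sq_eq_of_L2 (U : WithLp 2 (L2 × L2))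

theorem sobolev_hasWeakDeriv (U : sobolevPairs) : HasWeakDeriv (sobolevVal U) (sobolevDeriv U) :=
  mem_sobolevPairs.1 U.2

/-- The elementary Sobolev inequality followed by Cauchy-Schwarz. The product of norms, rather than
their sum, is what later yields relative bound zero. -/
theorem sobolev_exists_continuous (U : sobolevPairs) : ∃ v : ℝ → ℂ,
    IsPrimitive v (sobolevDeriv U) ∧ (sobolevVal U =ᵐ[volume] v) ∧
    ∀ x, ‖v x‖ ≤ √(2 * (‖sobolevVal U‖ * ‖sobolevDeriv U‖)) := by
  obtain ⟨v, hv, huv⟩ := (sobolev_hasWeakDeriv U).exists_isPrimitive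
  refine ⟨v, hv, huv, fun x => Real.le_sqrt_of_sq_le ?_⟩
  have hv2 : MemLp v 2 := (Lp.memLp (sobolevVal U)).ae_eq huv
  have hd2 : MemLp (sobolevDeriv U) 2 := Lp.memLp _
  have h2 : ∫ t, ‖v t‖ ^ 2 = ‖sobolevVal U‖ ^ 2 := by
    rw [← integral_norm_sq_L2]
    refine integral_congr_ae ?_
    filter_upwards [huv] with t ht
    rw [ht]
  have h3 := integral_norm_mul_norm_le hv2 hd2
  rw [h2, integral_norm_sq_L2, Real.sqrt_sq (norm_nonneg _), Real.sqrt_sq (norm_nonneg _)] at h3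
  have := hv.norm_sq_le hv2 hd2 x
  linarith

theorem sobolev_mul_norm_le (U : sobolevPairs) {k w : L2}
    (hw : w =ᵐ[volume] fun x => k x * sobolevVal U x) :
    ‖w‖ ≤ √(2 * (‖sobolevVal U‖ * ‖sobolevDeriv U‖)) * ‖k‖ := by
  obtain ⟨v, -, huv, hb⟩ := sobolev_exists_continuous U
  refine Lp.norm_le_mul_norm_of_ae_le_mul ?_
  filter_upwards [hw, huv] with x hx hx'
  rw [hx, hx', norm_mul, mul_comm]
  gcongr
  exact hb x

theorem sobolev_memLp_mul (U : sobolevPairs) (k : L2) :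
    MemLp (fun x => k x * sobolevVal U x) 2 := by
  obtain ⟨v, -, huv, hb⟩ := sobolev_exists_continuous U
  refine (Lp.memLp k).of_le_mul (c := √(2 * (‖sobolevVal U‖ * ‖sobolevDeriv U‖)))
    ((Lp.memLp k).1.mul (Lp.memLp _).1) ?_
  filter_upwards [huv] with x hx'
  rw [hx', norm_mul, mul_comm]
  gcongr
  exact hb x

/-- Multiplication by a square integrable function, from the Sobolev space to `L²`. -/
theorem exists_sobolev_mul_L2 (k : L2) : ∃ T : sobolevPairs →L[ℂ] L2,
    ∀ U, T U =ᵐ[volume] fun x => k x * sobolevVal U x := by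
  let T₀ : sobolevPairs →ₗ[ℂ] L2 :=
    { toFun := fun U => (sobolev_memLp_mul U k).toLp
      map_add' := fun U V => by
        rw [← MemLp.toLp_add]
        refine MemLp.toLp_congr _ _ ?_
        rw [map_add]
        filter_upwards [Lp.coeFn_add (sobolevVal U) (sobolevVal V)] with x hx
        rw [hx, Pi.add_apply, mul_add]; rfl
      map_smul' := fun a U => by
        rw [RingHom.id_apply, ← MemLp.toLp_const_smul]
        refine MemLp.toLp_congr _ _ ?_
        rw [map_smul]
        filter_upwards [Lp.coeFn_smul a (sobolevVal U)] with x hx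
        rw [hx, Pi.smul_apply, smul_eq_mul, Pi.smul_apply, smul_eq_mul, mul_left_comm] }
  refine ⟨T₀.mkContinuous ‖k‖ fun U => ?_, fun U => (sobolev_memLp_mul U k).coeFn_toLp⟩
  refine (sobolev_mul_norm_le U (sobolev_memLp_mul U k).coeFn_toLp).trans ?_
  rw [mul_comm]
  gcongr
  rw [Real.sqrt_le_left (norm_nonneg _), sobolev_norm_sq]
  nlinarith [sq_nonneg (‖sobolevVal U‖ - ‖sobolevDeriv U‖)]

/-- Multiplication by the sum of a square integrable function and a bounded function, as an
operator that is bounded relatively to the derivative with bound zero. -/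
theorem exists_sobolev_mul {k₀ k₁ : ℝ → ℂ} (hk₀ : MemLp k₀ 2) (hk₁ : Measurable k₁) {B : ℝ}
    (hB : ∀ x, ‖k₁ x‖ ≤ B) {η : ℝ} (hη : 0 < η) : ∃ T : sobolevPairs →L[ℂ] L2,
    (∀ U, T U =ᵐ[volume] fun x => (k₀ x + k₁ x) * sobolevVal U x) ∧
    ∃ C, ∀ U, ‖T U‖ ≤ η * ‖sobolevDeriv U‖ + C * ‖sobolevVal U‖ := by
  obtain ⟨T₀, hT₀⟩ := exists_sobolev_mul_L2 hk₀.toLp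
  obtain ⟨M, hM⟩ := exists_mul_operator hk₁ hB
  -- The coefficient ‖k₀‖²/(2η) is the one for which the Sobolev bound follows from 4ab ≤ (a + b)².
  refine ⟨T₀ + M ∘L sobolevVal, fun U => ?_, ‖hk₀.toLp‖ ^ 2 / (2 * η) + ‖M‖, fun U => ?_⟩
  · filter_upwards [Lp.coeFn_add (T₀ U) (M (sobolevVal U)), hT₀ U, hM (sobolevVal U),
      hk₀.coeFn_toLp] with x h1 h2 h3 h4
    change (T₀ U + M (sobolevVal U) : L2) x = _
    rw [h1, Pi.add_apply, h2, h3, h4, add_mul]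
  · have h1 := sobolev_mul_norm_le U (hT₀ U)
    have h2 : √(2 * (‖sobolevVal U‖ * ‖sobolevDeriv U‖)) * ‖hk₀.toLp‖ ≤
        η * ‖sobolevDeriv U‖ + ‖hk₀.toLp‖ ^ 2 / (2 * η) * ‖sobolevVal U‖ := by
      refine abs_le_of_sq_le_sq' ?_ (by positivity) |>.2
      rw [mul_pow, Real.sq_sqrt (by positivity)]
      have h3 : (η * ‖sobolevDeriv U‖ + ‖hk₀.toLp‖ ^ 2 / (2 * η) * ‖sobolevVal U‖) ^ 2
          - 2 * (‖sobolevVal U‖ * ‖sobolevDeriv U‖) * ‖hk₀.toLp‖ ^ 2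
          = (η * ‖sobolevDeriv U‖ - ‖hk₀.toLp‖ ^ 2 / (2 * η) * ‖sobolevVal U‖) ^ 2 := by
        field_simp
        ring
      nlinarith [sq_nonneg (η * ‖sobolevDeriv U‖ - ‖hk₀.toLp‖ ^ 2 / (2 * η) * ‖sobolevVal U‖)]
    change ‖T₀ U + M (sobolevVal U)‖ ≤ _
    have h3 := norm_add_le (T₀ U) (M (sobolevVal U))
    have h4 := M.le_opNorm (sobolevVal U)
    linarith

/-- Solvability of `-(p u' + k u)' + k̄ u' + (e - i ε g) u = f`. -/
theorem exists_weak_solution {p e g : ℝ → ℝ} {k₀ k₁ : ℝ → ℂ} {m C ε : ℝ} (hm : 0 < m)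
    (hp : Measurable p) (hpm : ∀ x, m ≤ p x) (hpC : ∀ x, p x ≤ C)
    (he : Measurable e) (heC : ∀ x, |e x| ≤ C)
    (hg : Measurable g) (hgm : ∀ x, m ≤ g x) (hgC : ∀ x, g x ≤ C)
    (hk₀ : MemLp k₀ 2) (hk₁ : Measurable k₁) (hk₁C : ∀ x, ‖k₁ x‖ ≤ C) (hε : ε ≠ 0) (f : L2) :
    ∃ u u' : ℝ → ℂ, IsPrimitive u u' ∧ MemLp u 2 ∧ MemLp u' 2 ∧
      HasWeakDeriv (fun x => p x * u' x + (k₀ x + k₁ x) * u x)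
        (fun x => starRingEnd ℂ (k₀ x + k₁ x) * u' x
          + (e x - Complex.I * ε * g x) * u x - f x) := by
  have hC : 0 ≤ C := (abs_nonneg _).trans (heC 0)
  obtain ⟨M₁, hM₁⟩ := exists_mul_operator (Complex.measurable_ofReal.comp hp) (C := C)
    fun x => by
      rw [Function.comp_apply, Complex.norm_real, Real.norm_of_nonneg (hm.le.trans (hpm x))]
      exact hpC x
  obtain ⟨M₂, hM₂⟩ := exists_mul_operator
    (k := fun x => (e x - Complex.I * ε * g x : ℂ)) (C := C + |ε| * C)
    (((Complex.measurable_ofReal.comp he)).sub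
      ((Complex.measurable_ofReal.comp hg).const_mul _)) fun x => by
      refine (norm_sub_le _ _).trans (add_le_add ?_ ?_)
      · rw [Complex.norm_real]; exact heC x
      · rw [norm_mul, norm_mul, Complex.norm_I, Complex.norm_real, Complex.norm_real, one_mul,
          Real.norm_of_nonneg (hm.le.trans (hgm x)), Real.norm_eq_abs]
        exact mul_le_mul_of_nonneg_left (hgC x) (abs_nonneg _)
  -- m/4 is the relative bound that `isUnit_of_form` admits.
  obtain ⟨T, hT, CT, hCT⟩ := exists_sobolev_mul hk₀ hk₁ hk₁C (η := m / 4) (by positivity)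
  set A : sobolevPairs →L[ℂ] sobolevPairs :=
    (ContinuousLinearMap.adjoint sobolevDeriv) ∘L M₁ ∘L sobolevDeriv
    + (ContinuousLinearMap.adjoint sobolevDeriv) ∘L T
    + (ContinuousLinearMap.adjoint T) ∘L sobolevDeriv
    + (ContinuousLinearMap.adjoint sobolevVal) ∘L M₂ ∘L sobolevVal with hAdef
  have hA : ∀ U V, ⟪V, A U⟫ = ⟪sobolevDeriv V, M₁ (sobolevDeriv U)⟫ + ⟪sobolevDeriv V, T U⟫
      + ⟪T V, sobolevDeriv U⟫ + ⟪sobolevVal V, M₂ (sobolevVal U)⟫ := fun U V => by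
    simp only [hAdef, add_apply, ContinuousLinearMap.comp_apply,
      inner_add_right, ContinuousLinearMap.adjoint_inner_right]
  have hunit : IsUnit A := by
    refine isUnit_of_form (C := max C |CT|) hm hε (hC.trans (le_max_left _ _)) hA sobolev_norm_sq
      (fun u => ?_) (fun u => ?_) (fun u => ?_) (fun u => ?_) (fun U => ?_)
    · simpa using mul_norm_sq_le_re_inner hM₁ (z := 1) (m := m) (fun x => by simpa using hpm x) u
    -- The imaginary part vanishes because the lower bound zero holds for both i and -i.
    · have h1 := mul_norm_sq_le_re_inner hM₁ (z := Complex.I) (m := 0) (fun x => by simp) u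
      have h2 := mul_norm_sq_le_re_inner hM₁ (z := -Complex.I) (m := 0) (fun x => by simp) u
      simp at h1 h2
      exact le_antisymm h1 h2
    · simpa using mul_norm_sq_le_re_inner hM₂ (z := 1) (m := -max C |CT|) (fun x => by
        have h1 := (abs_le.1 (heC x)).1
        have h2 := le_max_left C |CT|
        simp
        linarith) u
    · refine mul_norm_sq_le_re_inner hM₂ (z := Complex.I * ε) (m := m * ε ^ 2) (fun x => ?_) u
      simp
      nlinarith [mul_le_mul_of_nonneg_right (hgm x) (sq_nonneg ε)]
    · refine (hCT U).trans ?_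
      gcongr
      exact (le_abs_self _).trans (le_max_right _ _)
  obtain ⟨U, hU⟩ : ∃ U, A U = ContinuousLinearMap.adjoint sobolevVal f := by
    obtain ⟨a, ha⟩ := hunit
    refine ⟨(↑a⁻¹ : sobolevPairs →L[ℂ] sobolevPairs) (ContinuousLinearMap.adjoint sobolevVal f), ?_⟩
    rw [← ha, ← mul_apply_eq_comp, Units.mul_inv, one_apply_eq_self]
  obtain ⟨u, hu, huv, -⟩ := sobolev_exists_continuous U
  have hu2 : MemLp u 2 := (Lp.memLp (sobolevVal U)).ae_eq huv
  have hd2 : MemLp (sobolevDeriv U) 2 := Lp.memLp _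
  refine ⟨u, sobolevDeriv U, hu, hu2, hd2, ?_⟩
  have hX : MemLp (fun x => (p x : ℂ) * sobolevDeriv U x + (k₀ x + k₁ x) * u x) 2 := by
    refine ((Lp.memLp (M₁ (sobolevDeriv U))).add (Lp.memLp (T U))).ae_eq ?_
    filter_upwards [hM₁ (sobolevDeriv U), hT U, huv] with x h1 h2 h3
    rw [Pi.add_apply, h1, h2, h3]; rfl
  have hkU : LocallyIntegrable (fun x => starRingEnd ℂ (k₀ x + k₁ x) * sobolevDeriv U x) volume := by
    have h0 : MemLp (fun x => starRingEnd ℂ (k₀ x)) 2 := hk₀.star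
    have h1 : Integrable fun x => starRingEnd ℂ (k₀ x) * sobolevDeriv U x := h0.integrable_mul hd2
    have h2 : MemLp (fun x => starRingEnd ℂ (k₁ x) * sobolevDeriv U x) 2 := by
      refine hd2.of_le_mul (c := C)
        ((Complex.continuous_conj.measurable.comp hk₁).aestronglyMeasurable.mul hd2.1)
        (Eventually.of_forall fun x => ?_)
      rw [norm_mul, RCLike.norm_conj]
      gcongr
      exact hk₁C x
    refine (h1.locallyIntegrable.add (h2.locallyIntegrable (by norm_num))).congr
      (Eventually.of_forall fun x => ?_)
    simp [add_mul]
  have hM₂u : MemLp (fun x => (e x - Complex.I * ε * g x : ℂ) * u x) 2 := by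
    refine (Lp.memLp (M₂ (sobolevVal U))).ae_eq ?_
    filter_upwards [hM₂ (sobolevVal U), huv] with x h1 h2
    rw [h1, h2]
  have hlY : LocallyIntegrable (fun x => (e x - Complex.I * ε * g x : ℂ) * u x) volume :=
    hM₂u.locallyIntegrable (by norm_num)
  have hlf : LocallyIntegrable f volume := (Lp.memLp f).locallyIntegrable (by norm_num)
  refine ⟨hX.locallyIntegrable (by norm_num), (hkU.add hlY).sub hlf, fun φ hφ hs => ?_⟩
  have m1 := memLp_ofReal_test (hφ.continuous_deriv (by simp)) hs.deriv
  have m2 := memLp_ofReal_test hφ.continuous hs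
  -- A test function seen as an element of H¹; the order (φ, φ') is opposite to that in `testPairs`.
  have hV : WithLp.toLp 2 (m2.toLp, m1.toLp) ∈ sobolevPairs := by
    rw [mem_sobolevPairs]
    obtain ⟨h1, h2, h3⟩ := (isPrimitive_ofReal_of_contDiff hφ).hasWeakDeriv
    refine ⟨(Lp.memLp _).locallyIntegrable (by norm_num),
      (Lp.memLp _).locallyIntegrable (by norm_num), fun ψ hψ hs' => ?_⟩
    have e1 : ∫ x, ((deriv ψ x : ℝ) : ℂ) * (m2.toLp : L2) x = ∫ x, ((deriv ψ x : ℝ) : ℂ) * φ x :=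
      integral_congr_ae (by filter_upwards [m2.coeFn_toLp] with x hx; rw [hx])
    have e2 : ∫ x, ((ψ x : ℝ) : ℂ) * (m1.toLp : L2) x = ∫ x, (ψ x : ℂ) * (deriv φ x : ℝ) :=
      integral_congr_ae (by filter_upwards [m1.coeFn_toLp] with x hx; rw [hx])
    exact e1.trans ((h3 ψ hψ hs').trans (congrArg Neg.neg e2.symm))
  set V : sobolevPairs := ⟨_, hV⟩
  have hVv : sobolevVal V =ᵐ[volume] fun x => (φ x : ℂ) := m2.coeFn_toLp
  have hVd : sobolevDeriv V =ᵐ[volume] fun x => ((deriv φ x : ℝ) : ℂ) := m1.coeFn_toLp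
  have h1 := hA U V
  rw [hU, ContinuousLinearMap.adjoint_inner_right] at h1
  simp only [inner_L2_eq] at h1
  have c1 : ∫ x, starRingEnd ℂ (sobolevVal V x) * f x = ∫ x, (φ x : ℂ) * f x :=
    integral_congr_ae (by filter_upwards [hVv] with x hx; rw [hx, Complex.conj_ofReal])
  have c2 : ∫ x, starRingEnd ℂ (sobolevDeriv V x) * M₁ (sobolevDeriv U) x
      = ∫ x, ((deriv φ x : ℝ) : ℂ) * (p x * sobolevDeriv U x) :=
    integral_congr_ae (by
      filter_upwards [hVd, hM₁ (sobolevDeriv U)] with x hx hx'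
      rw [hx, hx', Complex.conj_ofReal]; rfl)
  have c3 : ∫ x, starRingEnd ℂ (sobolevDeriv V x) * T U x
      = ∫ x, ((deriv φ x : ℝ) : ℂ) * ((k₀ x + k₁ x) * u x) :=
    integral_congr_ae (by
      filter_upwards [hVd, hT U, huv] with x hx hx' h3
      rw [hx, hx', Complex.conj_ofReal, h3])
  have c4 : ∫ x, starRingEnd ℂ (T V x) * sobolevDeriv U x
      = ∫ x, (φ x : ℂ) * (starRingEnd ℂ (k₀ x + k₁ x) * sobolevDeriv U x) :=
    integral_congr_ae (by
      filter_upwards [hVv, hT V] with x hx hx'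
      rw [hx', hx, map_mul, Complex.conj_ofReal]; ring)
  have c5 : ∫ x, starRingEnd ℂ (sobolevVal V x) * M₂ (sobolevVal U) x
      = ∫ x, (φ x : ℂ) * ((e x - Complex.I * ε * g x) * u x) :=
    integral_congr_ae (by
      filter_upwards [hVv, hM₂ (sobolevVal U), huv] with x hx hx' h3
      rw [hx, hx', Complex.conj_ofReal, h3])
  rw [c1, c2, c3, c4, c5] at h1
  have hφ' := hφ.continuous_deriv (by simp)
  have hpu : LocallyIntegrable (fun x => (p x : ℂ) * sobolevDeriv U x) volume :=
    ((Lp.memLp (M₁ (sobolevDeriv U))).ae_eq (hM₁ (sobolevDeriv U))).locallyIntegrable (by norm_num)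
  have hku : LocallyIntegrable (fun x => (k₀ x + k₁ x) * u x) volume := by
    refine MemLp.locallyIntegrable (p := 2) ((Lp.memLp (T U)).ae_eq ?_) (by norm_num)
    filter_upwards [hT U, huv] with x h2 h3
    rw [h2, h3]
  have i1 := integrable_ofReal_mul hφ' hs.deriv hpu
  have i2 := integrable_ofReal_mul hφ' hs.deriv hku
  have i3 := integrable_ofReal_mul hφ.continuous hs hkU
  have i4 := integrable_ofReal_mul hφ.continuous hs hlY
  have i5 := integrable_ofReal_mul hφ.continuous hs hlf
  have s1 : ∫ x, ((deriv φ x : ℝ) : ℂ) * (p x * sobolevDeriv U x + (k₀ x + k₁ x) * u x)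
      = (∫ x, ((deriv φ x : ℝ) : ℂ) * (p x * sobolevDeriv U x))
        + ∫ x, ((deriv φ x : ℝ) : ℂ) * ((k₀ x + k₁ x) * u x) := by
    rw [← integral_add i1 i2]; simp only [mul_add]
  have s2 : ∫ x, (φ x : ℂ) * (starRingEnd ℂ (k₀ x + k₁ x) * sobolevDeriv U x
          + (e x - Complex.I * ε * g x) * u x - f x)
      = (∫ x, (φ x : ℂ) * (starRingEnd ℂ (k₀ x + k₁ x) * sobolevDeriv U x))
        + (∫ x, (φ x : ℂ) * ((e x - Complex.I * ε * g x) * u x)) - ∫ x, (φ x : ℂ) * f x := by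
    have i34 : Integrable fun x => (φ x : ℂ) * (starRingEnd ℂ (k₀ x + k₁ x) * sobolevDeriv U x)
      + (φ x : ℂ) * ((e x - Complex.I * ε * g x) * u x) := i3.add i4
    rw [← integral_add i3 i4, ← integral_sub i34 i5]; simp only [mul_add, mul_sub]
  rw [s1, s2]
  linear_combination -h1

/-! ### Existence of solutions of the system. -/

namespace MagSchro.Coefficients

/-- The first order system has a square integrable solution for every square integrable `f`. -/
theorem exists_isSolution (c : Coefficients) {h ε : ℝ} (hh : 0 < h) (hε : ε ≠ 0) (E : ℝ)
    (P P' : ℝ → ℝ) (f : L2) : ∃ u Φ, (c.system h E P P').IsSolution h ε f u Φ := by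
  have hh' : (h : ℂ) ≠ 0 := by exact_mod_cast hh.ne'
  obtain ⟨CV, hCV⟩ := c.V₁_bv.exists_abs_le
  obtain ⟨Cα, hCα⟩ := c.α_bv.exists_abs_le
  obtain ⟨Cβ, hCβ⟩ := c.β_bv.exists_abs_le
  obtain ⟨Cb, hCb⟩ := c.b₁_bv.exists_abs_le
  obtain ⟨Cγ, hCγ⟩ := c.exists_abs_inv_β_le
  obtain ⟨Cw, hCw⟩ := c.exists_abs_wiggle_le hh
  obtain ⟨Cd, hCd⟩ := c.exists_abs_averagedDensity_le h
  obtain ⟨m, hm, hαm⟩ := c.α_inf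
  have hVm := c.V₁_bv.measurable
  have hβm := c.β_bv.measurable
  have hαmeas := c.α_bv.measurable
  have hbm := c.b₁_bv.measurable
  have hCβ0 : 0 < Cβ := (c.β_pos 0).trans_le ((le_abs_self _).trans (hCβ 0))
  have hCγ0 : 0 ≤ Cγ := (abs_nonneg _).trans (hCγ 0)
  set e : ℝ → ℝ := fun x => c.averagedDensity h x + (c.β x)⁻¹ * (c.V₁ x - E) with he
  -- Eliminating Φ gives a second order equation with flux h²αu' + h(ib - w)u = hΦ. The coefficient
  -- of u' in the derivative of the flux is -h(ib + w), the conjugate of h(ib - w), as the form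
  -- requires. The source becomes f/β.
  set k₁ : ℝ → ℂ := fun x => Complex.I * h * c.b₁ x - h * c.wiggle h x with hk₁
  have hk₀ : MemLp (fun x => Complex.I * h * c.b₀ x) 2 := c.b₀_L2.ofReal.const_mul _
  have hk₁m : Measurable k₁ :=
    ((Complex.measurable_ofReal.comp hbm).const_mul _).sub
      ((Complex.measurable_ofReal.comp (c.measurable_wiggle h)).const_mul _)
  have hk₁C : ∀ x, ‖k₁ x‖ ≤ h * Cb + h * Cw := fun x => by
    refine (norm_sub_le _ _).trans ?_
    rw [norm_mul, norm_mul, norm_mul, Complex.norm_I, one_mul, Complex.norm_real, Complex.norm_real,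
      Complex.norm_real, Real.norm_of_nonneg hh.le]
    exact add_le_add (mul_le_mul_of_nonneg_left (hCb x) hh.le)
      (mul_le_mul_of_nonneg_left (hCw x) hh.le)
  have hem : Measurable e :=
    (c.measurable_averagedDensity hh).add (hβm.inv.mul (hVm.sub_const E))
  have heC : ∀ x, |e x| ≤ Cd + Cγ * (CV + |E|) := fun x => by
    refine (abs_add_le _ _).trans (add_le_add (hCd x) ?_)
    rw [abs_mul]
    exact mul_le_mul (hCγ x) ((abs_sub _ _).trans (add_le_add_left (hCV x) _))
      (abs_nonneg _) hCγ0
  have hγf := memLp_ofReal_mul hβm.inv hCγ (Lp.memLp f)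
  set C := max (h ^ 2 * Cα) (max (h * Cb + h * Cw) (max (Cd + Cγ * (CV + |E|)) Cγ))
  obtain ⟨u, u', hu, hu2, hu'2, hw⟩ := exists_weak_solution (p := fun x => h ^ 2 * c.α x) (e := e)
    (g := fun x => (c.β x)⁻¹) (m := min (h ^ 2 * m) Cβ⁻¹) (C := C) (ε := ε)
    (by positivity) (hαmeas.const_mul _)
    (fun x => (min_le_left _ _).trans (mul_le_mul_of_nonneg_left (hαm x) (by positivity)))
    (fun x => (mul_le_mul_of_nonneg_left ((le_abs_self _).trans (hCα x)) (by positivity)).trans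
      (le_max_left _ _)) hem
    (fun x => (heC x).trans ((le_max_left _ _).trans ((le_max_right _ _).trans (le_max_right _ _))))
    hβm.inv
    (fun x => (min_le_right _ _).trans (inv_anti₀ (c.β_pos x) ((le_abs_self _).trans (hCβ x))))
    (fun x => ((le_abs_self _).trans (hCγ x)).trans
      ((le_max_right _ _).trans ((le_max_right _ _).trans (le_max_right _ _)))) hk₀ hk₁m
    (fun x => (hk₁C x).trans ((le_max_left _ _).trans (le_max_right _ _))) hε hγf.toLp
  obtain ⟨Ψ, hΨ, hXΨ⟩ := hw.exists_isPrimitive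
  obtain ⟨Cu, hCu⟩ : ∃ C, ∀ x, ‖u x‖ ≤ C :=
    ⟨_, fun x => Real.le_sqrt_of_sq_le (hu.norm_sq_le hu2 hu'2 x)⟩
  have hΨ2 : MemLp Ψ 2 := by
    refine ((((memLp_ofReal_mul hαmeas hCα hu'2).const_mul ((h : ℂ) ^ 2)).add
      ((memLp_b_mul (c := c) hu2 hu.continuous hCu).const_mul (Complex.I * h))).sub
      ((memLp_ofReal_mul (c.measurable_wiggle h) hCw hu2).const_mul (h : ℂ))).ae_eq ?_
    filter_upwards [hXΨ] with x hx
    rw [← hx]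
    simp only [Pi.add_apply, Pi.sub_apply, hk₁, b]
    push_cast
    ring
  set Φ : ℝ → ℂ := fun x => (h : ℂ)⁻¹ * Ψ x with hΦ
  have hrhs : u' =ᵐ[volume] (c.system h E P P').rhsU h u Φ := by
    filter_upwards [hXΨ] with x hx
    have h1 : (c.α x : ℂ) ≠ 0 := by exact_mod_cast (c.α_pos x).ne'
    simp only [SystemCoefficients.rhsU, system, hΦ, ← hx, hk₁, b]
    push_cast
    field_simp
    ring
  refine ⟨u, Φ, hu2, hΨ2.const_mul _, hu.congr_deriv hrhs, ?_⟩
  have h1 := hΨ.clm_comp (ContinuousLinearMap.mul ℝ ℂ (h : ℂ)⁻¹)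
  refine h1.congr_deriv ?_
  filter_upwards [hrhs, hγf.coeFn_toLp] with x hx hx'
  rw [rhsΦ_system hh, ← hx, ContinuousLinearMap.mul_apply', hx']
  simp only [hk₁, he, b, Pi.inv_apply]
  push_cast
  simp only [map_add, map_sub, map_mul, Complex.conj_I, Complex.conj_ofReal]
  field_simp
  ring

end MagSchro.Coefficients

/-! ### Uniform bounds for the long range coefficients. -/

theorem isFiniteMeasure_totalVariation (μ : SignedMeasure ℝ) :
    IsFiniteMeasure μ.totalVariation := by
  rw [SignedMeasure.totalVariation]; infer_instance

/-- The oscillation of a function of bounded variation between two points of continuity. -/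
theorem BoundedVariationOn.abs_sub_le {f : ℝ → ℝ} (hf : BoundedVariationOn f univ) {x y : ℝ}
    (hxy : x ≤ y) (hx : ContinuousAt f x) (hy : ContinuousAt f y) :
    |f y - f x| ≤ (dBV hf).totalVariation.real (Ioc x y) := by
  have := isFiniteMeasure_totalVariation (dBV hf)
  have h1 : dBV hf (Ioc x y) = f y - f x := by
    rw [dBV, hf.vectorMeasure_Ioc hxy,
      rightLim_eq_of_tendsto (hx.tendsto.mono_left nhdsWithin_le_nhds),
      rightLim_eq_of_tendsto (hy.tendsto.mono_left nhdsWithin_le_nhds)]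
  rw [← h1]
  have h2 := (dBV hf).enorm_le_totalVariation (Ioc x y)
  rw [← Real.norm_eq_abs, ← toReal_enorm]
  exact ENNReal.toReal_mono (measure_ne_top _ _) h2

namespace MagSchro.Coefficients

/-- The sum of the total variations of `α`, `β`, `V₁` and `b₁`. -/
noncomputable def variationMeasure (c : Coefficients) : Measure ℝ :=
  (dBV c.α_bv).totalVariation + (dBV c.β_bv).totalVariation + (dBV c.V₁_bv).totalVariation
    + (dBV c.b₁_bv).totalVariation

instance (c : Coefficients) : IsFiniteMeasure c.variationMeasure := by
  have := isFiniteMeasure_totalVariation (dBV c.α_bv)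
  have := isFiniteMeasure_totalVariation (dBV c.β_bv)
  have := isFiniteMeasure_totalVariation (dBV c.V₁_bv)
  have := isFiniteMeasure_totalVariation (dBV c.b₁_bv)
  rw [variationMeasure]; infer_instance

/-- The quantity `β⁻¹ α (E - V₁) + b₁²` whose sign decides whether the motion is allowed. -/
noncomputable def symbol (c : Coefficients) (E x : ℝ) : ℝ :=
  (c.β x)⁻¹ * c.α x * (E - c.V₁ x) + c.b₁ x ^ 2

/-- The function that is `symbol` for `R ≤ |x|` and `1` otherwise. -/
noncomputable def cutSymbol (c : Coefficients) (E R x : ℝ) : ℝ :=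
  if R ≤ |x| then c.symbol E x else 1

/-- Bounds on the coefficients that are uniform in the semiclassical parameter. -/
structure UniformBounds (c : Coefficients) (E M m τ R : ℝ) : Prop where
  m_pos : 0 < m
  τ_pos : 0 < τ
  R_pos : 0 < R
  α_ge : ∀ x, m ≤ c.α x
  β_ge : ∀ x, m ≤ c.β x
  α_le : ∀ x, c.α x ≤ M
  β_le : ∀ x, c.β x ≤ M
  V₁_le : ∀ᵐ x, |c.V₁ x| ≤ M
  b₁_le : ∀ᵐ x, |c.b₁ x| ≤ M
  variation_le : c.variationMeasure.real univ ≤ M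
  E_le : |E| ≤ M
  symbol_ge : ∀ x, R ≤ |x| → τ ≤ c.symbol E x
  V₀_le : c.V₀.totalVariation.real univ ≤ M
  b₀_L1_le : ∫ x, |c.b₀ x| ≤ M
  b₀_L2_le : ∫ x, c.b₀ x ^ 2 ≤ M

/-- Points at which the long range coefficients are continuous and obey the uniform bounds. -/
structure Regular (c : Coefficients) (M x : ℝ) : Prop where
  α_cont : ContinuousAt c.α x
  β_cont : ContinuousAt c.β x
  V₁_cont : ContinuousAt c.V₁ x
  b₁_cont : ContinuousAt c.b₁ x
  V₁_le : |c.V₁ x| ≤ M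
  b₁_le : |c.b₁ x| ≤ M

variable {c : Coefficients} {E M m τ R h : ℝ}

namespace UniformBounds

/-- Functions of bounded variation are differentiable almost everywhere. Continuity is wanted
because the measures `dBV` see right limits, not the values at jumps. -/
theorem ae_regular (hc : c.UniformBounds E M m τ R) : ∀ᵐ x, c.Regular M x := by
  filter_upwards [hc.V₁_le, hc.b₁_le, c.α_bv.locallyBoundedVariationOn.ae_differentiableAt,
    c.β_bv.locallyBoundedVariationOn.ae_differentiableAt,
    c.V₁_bv.locallyBoundedVariationOn.ae_differentiableAt,
    c.b₁_bv.locallyBoundedVariationOn.ae_differentiableAt] with x h1 h2 h3 h4 h5 h6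
  exact ⟨h3.continuousAt, h4.continuousAt, h5.continuousAt, h6.continuousAt, h1, h2⟩

theorem M_pos (hc : c.UniformBounds E M m τ R) : 0 < M :=
  hc.m_pos.trans_le ((hc.α_ge 0).trans (hc.α_le 0))

theorem inv_β_le (hc : c.UniformBounds E M m τ R) (x : ℝ) : (c.β x)⁻¹ ≤ m⁻¹ :=
  inv_anti₀ hc.m_pos (hc.β_ge x)

theorem inv_α_le (hc : c.UniformBounds E M m τ R) (x : ℝ) : (c.α x)⁻¹ ≤ m⁻¹ :=
  inv_anti₀ hc.m_pos (hc.α_ge x)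

theorem abs_symbol_le (hc : c.UniformBounds E M m τ R) {x : ℝ} (hx : c.Regular M x) :
    |c.symbol E x| ≤ m⁻¹ * M * (2 * M) + M ^ 2 := by
  have hM := hc.M_pos
  have hm := hc.m_pos
  refine (abs_add_le _ _).trans (add_le_add ?_ ?_)
  · rw [abs_mul, abs_mul, abs_of_pos (inv_pos.2 (c.β_pos x)), abs_of_pos (c.α_pos x)]
    have h1 : |E - c.V₁ x| ≤ 2 * M := (abs_sub _ _).trans (by linarith [hc.E_le, hx.V₁_le])
    have := hc.inv_β_le x
    have := hc.α_le x
    have := (c.α_pos x).le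
    gcongr
  · rw [abs_of_nonneg (sq_nonneg _), ← sq_abs]
    have := hx.b₁_le
    gcongr

/-- A bound for the Lipschitz constant of `symbol` as a function of the coefficients. -/
theorem abs_symbol_sub_le (hc : c.UniformBounds E M m τ R) {x y : ℝ} (hxy : x ≤ y)
    (hx : c.Regular M x) (hy : c.Regular M y) : |c.symbol E y - c.symbol E x| ≤
      (m⁻¹ * m⁻¹ * M * (2 * M) + m⁻¹ * (2 * M) + m⁻¹ * M + 2 * M)
        * c.variationMeasure.real (Ioc x y) := by
  have hM := hc.M_pos
  have hm := hc.m_pos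
  have i1 := isFiniteMeasure_totalVariation (dBV c.α_bv)
  have i2 := isFiniteMeasure_totalVariation (dBV c.β_bv)
  have i3 := isFiniteMeasure_totalVariation (dBV c.V₁_bv)
  have i4 := isFiniteMeasure_totalVariation (dBV c.b₁_bv)
  set v := c.variationMeasure.real (Ioc x y) with hv
  have hveq : v = (dBV c.α_bv).totalVariation.real (Ioc x y)
      + (dBV c.β_bv).totalVariation.real (Ioc x y) + (dBV c.V₁_bv).totalVariation.real (Ioc x y)
      + (dBV c.b₁_bv).totalVariation.real (Ioc x y) := by
    rw [hv, variationMeasure, measureReal_add_apply, measureReal_add_apply, measureReal_add_apply]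
  have n1 := measureReal_nonneg (μ := (dBV c.α_bv).totalVariation) (s := Ioc x y)
  have n2 := measureReal_nonneg (μ := (dBV c.β_bv).totalVariation) (s := Ioc x y)
  have n3 := measureReal_nonneg (μ := (dBV c.V₁_bv).totalVariation) (s := Ioc x y)
  have n4 := measureReal_nonneg (μ := (dBV c.b₁_bv).totalVariation) (s := Ioc x y)
  have hv0 : 0 ≤ v := measureReal_nonneg
  have d1 : |c.α y - c.α x| ≤ v := (c.α_bv.abs_sub_le hxy hx.α_cont hy.α_cont).trans (by linarith)
  have d2 : |c.β y - c.β x| ≤ v := (c.β_bv.abs_sub_le hxy hx.β_cont hy.β_cont).trans (by linarith)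
  have d3 : |c.V₁ y - c.V₁ x| ≤ v :=
    (c.V₁_bv.abs_sub_le hxy hx.V₁_cont hy.V₁_cont).trans (by linarith)
  have d4 : |c.b₁ y - c.b₁ x| ≤ v :=
    (c.b₁_bv.abs_sub_le hxy hx.b₁_cont hy.b₁_cont).trans (by linarith)
  have hEV : |E - c.V₁ y| ≤ 2 * M := (abs_sub _ _).trans (by linarith [hc.E_le, hy.V₁_le])
  have hβx := hc.inv_β_le x
  have hβy := hc.inv_β_le y
  have hβx0 := inv_pos.2 (c.β_pos x)
  have hβy0 := inv_pos.2 (c.β_pos y)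
  have hαx := hc.α_le x
  have hαx0 := c.α_pos x
  have hαy := hc.α_le y
  have hαy0 := c.α_pos y
  have d5 : |(c.β y)⁻¹ - (c.β x)⁻¹| ≤ m⁻¹ * m⁻¹ * v := by
    have h1 : (c.β y)⁻¹ - (c.β x)⁻¹ = -((c.β y)⁻¹ * (c.β x)⁻¹ * (c.β y - c.β x)) := by
      have := (c.β_pos x).ne'
      have := (c.β_pos y).ne'
      field_simp
      ring
    rw [h1, abs_neg, abs_mul, abs_mul, abs_of_pos hβx0, abs_of_pos hβy0]
    gcongr
  -- The coefficients are changed from x to y one at a time.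
  have key : c.symbol E y - c.symbol E x = ((c.β y)⁻¹ - (c.β x)⁻¹) * c.α y * (E - c.V₁ y)
      + (c.β x)⁻¹ * (c.α y - c.α x) * (E - c.V₁ y) + -((c.β x)⁻¹ * c.α x * (c.V₁ y - c.V₁ x))
      + (c.b₁ y + c.b₁ x) * (c.b₁ y - c.b₁ x) := by
    simp only [symbol]; ring
  have e1 : |((c.β y)⁻¹ - (c.β x)⁻¹) * c.α y * (E - c.V₁ y)| ≤ m⁻¹ * m⁻¹ * v * M * (2 * M) := by
    rw [abs_mul, abs_mul, abs_of_pos hαy0]; gcongr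
  have e2 : |(c.β x)⁻¹ * (c.α y - c.α x) * (E - c.V₁ y)| ≤ m⁻¹ * v * (2 * M) := by
    rw [abs_mul, abs_mul, abs_of_pos hβx0]; gcongr
  have e3 : |-((c.β x)⁻¹ * c.α x * (c.V₁ y - c.V₁ x))| ≤ m⁻¹ * M * v := by
    rw [abs_neg, abs_mul, abs_mul, abs_of_pos hβx0, abs_of_pos hαx0]; gcongr
  have e4 : |(c.b₁ y + c.b₁ x) * (c.b₁ y - c.b₁ x)| ≤ 2 * M * v := by
    rw [abs_mul]
    have : |c.b₁ y + c.b₁ x| ≤ 2 * M := (abs_add_le _ _).trans (by linarith [hx.b₁_le, hy.b₁_le])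
    gcongr
  rw [key]
  refine (abs_add_le _ _).trans ((add_le_add ((abs_add_le _ _).trans (add_le_add
    ((abs_add_le _ _).trans (add_le_add e1 e2)) e3)) e4).trans (le_of_eq (by ring)))

theorem measurable_cutSymbol : Measurable (c.cutSymbol E R) := by
  refine Measurable.ite (measurableSet_le measurable_const measurable_id.abs) ?_ measurable_const
  exact ((c.β_bv.measurable.inv.mul c.α_bv.measurable).mul
    (measurable_const.sub c.V₁_bv.measurable)).add (c.b₁_bv.measurable.pow_const 2)

theorem cutSymbol_ge (hc : c.UniformBounds E M m τ R) (x : ℝ) : min τ 1 ≤ c.cutSymbol E R x := by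
  rw [cutSymbol]
  split_ifs with hx
  · exact (min_le_left _ _).trans (hc.symbol_ge x hx)
  · exact min_le_right _ _

theorem cutSymbol_pos (hc : c.UniformBounds E M m τ R) (x : ℝ) : 0 < c.cutSymbol E R x :=
  (lt_min hc.τ_pos one_pos).trans_le (hc.cutSymbol_ge x)

theorem cutSymbol_le (hc : c.UniformBounds E M m τ R) {x : ℝ} (hx : c.Regular M x) :
    c.cutSymbol E R x ≤ m⁻¹ * M * (2 * M) + M ^ 2 + 1 := by
  have h1 := hc.abs_symbol_le hx
  have h2 := le_abs_self (c.symbol E x)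
  rw [cutSymbol]
  split_ifs
  · linarith
  · linarith [abs_nonneg (c.symbol E x)]

/-- A bound for the oscillation of `cutSymbol` to the right of `x` on the unit scale. -/
noncomputable def oscBound (c : Coefficients) (M m R x : ℝ) : ℝ :=
  (m⁻¹ * m⁻¹ * M * (2 * M) + m⁻¹ * (2 * M) + m⁻¹ * M + 2 * M)
    * c.variationMeasure.real (Ioc x (x + 1))
  + (Icc (-R - 1) R).indicator (fun _ => m⁻¹ * M * (2 * M) + M ^ 2 + 1) x

/-- Away from the cut the variation measure controls the oscillation. The jump made by cutting is
paid for by the supremum bound on an interval of length 2R + 1, which is integrable. -/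
theorem abs_cutSymbol_sub_le (hc : c.UniformBounds E M m τ R) {x y : ℝ} (hxy : x ≤ y)
    (hyx : y ≤ x + 1) (hx : c.Regular M x) (hy : c.Regular M y) :
    |c.cutSymbol E R y - c.cutSymbol E R x| ≤ oscBound c M m R x := by
  have hM := hc.M_pos
  have hm := hc.m_pos
  rw [oscBound]
  by_cases hR : R ≤ |x| ∧ R ≤ |y|
  · have h1 := hc.abs_symbol_sub_le hxy hx hy
    rw [cutSymbol, cutSymbol, if_pos hR.1, if_pos hR.2]
    refine h1.trans ((mul_le_mul_of_nonneg_left (measureReal_mono (Ioc_subset_Ioc_right hyx))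
      (by positivity)).trans (le_add_of_nonneg_right (indicator_nonneg (fun _ _ => ?_) _)))
    positivity
  -- Either x or y has modulus below R, and y is at most x + 1; hence the extra unit on the left
  -- only.
  · have hx' : x ∈ Icc (-R - 1) R := by
      rw [not_and_or, not_le, not_le, abs_lt, abs_lt] at hR
      rcases hR with hR | hR
      · exact ⟨by linarith, by linarith⟩
      · exact ⟨by linarith, by linarith⟩
    rw [indicator_of_mem hx']
    refine le_trans ?_ (le_add_of_nonneg_left (by positivity))
    have h1 := hc.cutSymbol_pos x
    have h2 := hc.cutSymbol_pos y
    have h3 := hc.cutSymbol_le hx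
    have h4 := hc.cutSymbol_le hy
    rw [abs_le]
    constructor <;> linarith

theorem integrable_oscBound : Integrable (oscBound c M m R) :=
  ((integrable_real_Ioc _ one_pos).const_mul _).add
    ((integrable_indicator_iff measurableSet_Icc).2 (integrableOn_const (by simp)))

theorem integral_oscBound_le (hc : c.UniformBounds E M m τ R) : ∫ x, oscBound c M m R x ≤
    (m⁻¹ * m⁻¹ * M * (2 * M) + m⁻¹ * (2 * M) + m⁻¹ * M + 2 * M) * M
      + (2 * R + 1) * (m⁻¹ * M * (2 * M) + M ^ 2 + 1) := by
  have hM := hc.M_pos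
  have hm := hc.m_pos
  have hR := hc.R_pos
  simp only [oscBound]
  rw [integral_add ((integrable_real_Ioc _ one_pos).const_mul _)
    ((integrable_indicator_iff measurableSet_Icc).2 (integrableOn_const (by simp))),
    integral_const_mul, integral_real_Ioc _ one_pos, one_mul, integral_indicator measurableSet_Icc,
    setIntegral_const, Real.volume_real_Icc_of_le (by linarith), smul_eq_mul]
  have := hc.variation_le
  gcongr
  linarith

theorem locallyIntegrable_cutSymbol (hc : c.UniformBounds E M m τ R) :
    LocallyIntegrable (c.cutSymbol E R) volume := by
  refine (locallyIntegrable_const (m⁻¹ * M * (2 * M) + M ^ 2 + 1)).mono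
    measurable_cutSymbol.aestronglyMeasurable ?_
  filter_upwards [hc.ae_regular] with x hx
  rw [Real.norm_of_nonneg (hc.cutSymbol_pos x).le]
  exact (hc.cutSymbol_le hx).trans (le_abs_self _)

/-- The moving average of `cutSymbol` over intervals of unit length. -/
noncomputable def meanSymbol (c : Coefficients) (E R x : ℝ) : ℝ :=
  ∫ t in x..x + 1, c.cutSymbol E R t

/-- The derivative of `meanSymbol`. -/
noncomputable def meanSymbolDeriv (c : Coefficients) (E R x : ℝ) : ℝ :=
  c.cutSymbol E R (x + 1) - c.cutSymbol E R x

theorem isPrimitive_meanSymbol (hc : c.UniformBounds E M m τ R) :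
    IsPrimitive (meanSymbol c E R) (meanSymbolDeriv c E R) :=
  isPrimitive_integral_add hc.locallyIntegrable_cutSymbol 1

theorem intervalIntegrable_cutSymbol (hc : c.UniformBounds E M m τ R) (a b : ℝ) :
    IntervalIntegrable (c.cutSymbol E R) volume a b :=
  (isPrimitive_intervalIntegral hc.locallyIntegrable_cutSymbol 0).1 a b

theorem meanSymbol_ge (hc : c.UniformBounds E M m τ R) (x : ℝ) :
    min τ 1 ≤ meanSymbol c E R x := by
  have h1 := intervalIntegral.integral_mono_on (by linarith : x ≤ x + 1)
    (intervalIntegrable_const (c := min τ 1)) (hc.intervalIntegrable_cutSymbol x (x + 1))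
    fun t _ => hc.cutSymbol_ge t
  simpa [meanSymbol] using h1

theorem meanSymbol_le (hc : c.UniformBounds E M m τ R) (x : ℝ) :
    meanSymbol c E R x ≤ m⁻¹ * M * (2 * M) + M ^ 2 + 1 := by
  have h1 := intervalIntegral.integral_mono_ae (by linarith : x ≤ x + 1)
    (hc.intervalIntegrable_cutSymbol x (x + 1))
    (intervalIntegrable_const (c := m⁻¹ * M * (2 * M) + M ^ 2 + 1))
    (by filter_upwards [hc.ae_regular] with t ht using hc.cutSymbol_le ht)
  simpa [meanSymbol] using h1

theorem abs_meanSymbolDeriv_le (hc : c.UniformBounds E M m τ R) :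
    ∀ᵐ x, |meanSymbolDeriv c E R x| ≤ oscBound c M m R x := by
  -- Translation preserves null sets, so x + 1 is regular for almost every x.
  filter_upwards [hc.ae_regular, (measurePreserving_add_right volume
    (1 : ℝ)).quasiMeasurePreserving.ae hc.ae_regular] with x hx hx'
  exact hc.abs_cutSymbol_sub_le (by linarith) le_rfl hx hx'

theorem abs_meanSymbol_sub_le (hc : c.UniformBounds E M m τ R) {x : ℝ} (hx : c.Regular M x) :
    |meanSymbol c E R x - c.cutSymbol E R x| ≤ oscBound c M m R x := by
  have h1 : meanSymbol c E R x - c.cutSymbol E R x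
      = ∫ t in x..x + 1, (c.cutSymbol E R t - c.cutSymbol E R x) := by
    rw [intervalIntegral.integral_sub (hc.intervalIntegrable_cutSymbol _ _)
      intervalIntegrable_const]
    simp [meanSymbol]
  rw [h1, ← Real.norm_eq_abs]
  have h2 := intervalIntegral.norm_integral_le_of_norm_le_const_ae (a := x) (b := x + 1)
    (f := fun t => c.cutSymbol E R t - c.cutSymbol E R x) (C := oscBound c M m R x) (by
      filter_upwards [hc.ae_regular] with t ht ht'
      rw [uIoc_of_le (by linarith)] at ht'
      exact hc.abs_cutSymbol_sub_le ht'.1.le ht'.2 hx ht)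
  simpa using h2

/-- The error of averaging over (x, x + 1] plus the error of the cut, the latter supported in |x| <
R. Both are integrable with uniform bounds, which is why `symbol` may be traded for its mean. -/
theorem abs_symbol_sub_meanSymbol_le (hc : c.UniformBounds E M m τ R) {x : ℝ}
    (hx : c.Regular M x) : |c.symbol E x - meanSymbol c E R x| ≤ oscBound c M m R x
      + (Icc (-R - 1) R).indicator (fun _ => m⁻¹ * M * (2 * M) + M ^ 2 + 1) x := by
  have hM := hc.M_pos
  have hm := hc.m_pos
  have h1 := hc.abs_meanSymbol_sub_le hx
  have h2 : |c.symbol E x - c.cutSymbol E R x| ≤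
      (Icc (-R - 1) R).indicator (fun _ => m⁻¹ * M * (2 * M) + M ^ 2 + 1) x := by
    rw [cutSymbol]
    split_ifs with hR
    · rw [sub_self, abs_zero]
      exact indicator_nonneg (fun _ _ => by positivity) _
    · rw [not_le, abs_lt] at hR
      rw [indicator_of_mem (show x ∈ Icc (-R - 1) R from ⟨by linarith, hR.2.le⟩)]
      refine (abs_sub _ _).trans ?_
      rw [abs_one]
      linarith [hc.abs_symbol_le hx]
  have h3 : c.symbol E x - meanSymbol c E R x = (c.symbol E x - c.cutSymbol E R x)
      - (meanSymbol c E R x - c.cutSymbol E R x) := by ring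
  rw [h3]
  refine (abs_sub _ _).trans ?_
  linarith

end UniformBounds

end MagSchro.Coefficients

/-! ### Uniform bounds for the short range terms and for the system. -/

namespace MagSchro.Coefficients

variable {c : Coefficients} {E M m τ R h : ℝ}

namespace UniformBounds

theorem withDensity_inv_β_univ_le (hc : c.UniformBounds E M m τ R) (μ : Measure ℝ)
    [IsFiniteMeasure μ] :
    (μ.withDensity fun x => ENNReal.ofReal (c.β x)⁻¹).real univ ≤ m⁻¹ * μ.real univ := by
  have hm := inv_pos.2 hc.m_pos
  have h1 : (μ.withDensity fun x => ENNReal.ofReal (c.β x)⁻¹) univ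
      ≤ ENNReal.ofReal m⁻¹ * μ univ := by
    rw [withDensity_apply _ MeasurableSet.univ, Measure.restrict_univ, ← lintegral_const]
    exact lintegral_mono fun x => ENNReal.ofReal_le_ofReal (hc.inv_β_le x)
  refine (ENNReal.toReal_mono (ENNReal.mul_ne_top ENNReal.ofReal_ne_top (measure_ne_top _ _))
    h1).trans (le_of_eq ?_)
  rw [ENNReal.toReal_mul, ENNReal.toReal_ofReal hm.le]
  rfl

theorem measure_univ_le (hc : c.UniformBounds E M m τ R) :
    c.posMeasure.real univ + c.negMeasure.real univ ≤ m⁻¹ * M := by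
  have h1 := hc.V₀_le
  rw [SignedMeasure.totalVariation, measureReal_add_apply] at h1
  refine (add_le_add (hc.withDensity_inv_β_univ_le _) (hc.withDensity_inv_β_univ_le _)).trans ?_
  rw [← mul_add]
  exact mul_le_mul_of_nonneg_left h1 (inv_pos.2 hc.m_pos).le

/-- The mass that `|V₀| / β` gives to `(x, x + h²]`. -/
noncomputable def localMass (c : Coefficients) (h x : ℝ) : ℝ :=
  c.posMeasure.real (Ioc x (x + h ^ 2)) + c.negMeasure.real (Ioc x (x + h ^ 2))

theorem localMass_nonneg (x : ℝ) : 0 ≤ localMass c h x :=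
  add_nonneg measureReal_nonneg measureReal_nonneg

theorem integrable_localMass (hh : 0 < h) : Integrable (localMass c h) :=
  (integrable_real_Ioc _ (by positivity)).add (integrable_real_Ioc _ (by positivity))

theorem localMass_le (hc : c.UniformBounds E M m τ R) (x : ℝ) : localMass c h x ≤ m⁻¹ * M :=
  (add_le_add (measureReal_mono (subset_univ _)) (measureReal_mono (subset_univ _))).trans
    hc.measure_univ_le

/-- The window length h² appears as a factor. Divided by h this makes `wiggle` of order h in L¹;
divided by h² it makes the averaged density of order one. -/
theorem integral_localMass_le (hc : c.UniformBounds E M m τ R) (hh : 0 < h) :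
    ∫ x, localMass c h x ≤ h ^ 2 * (m⁻¹ * M) := by
  have hδ : 0 < h ^ 2 := by positivity
  simp only [localMass]
  rw [integral_add (integrable_real_Ioc _ hδ) (integrable_real_Ioc _ hδ),
    integral_real_Ioc _ hδ, integral_real_Ioc _ hδ, ← mul_add]
  exact mul_le_mul_of_nonneg_left hc.measure_univ_le hδ.le

theorem integrable_wiggle (hh : 0 < h) : Integrable (c.wiggle h) :=
  ((integrable_localMass hh).div_const h).mono' (measurable_wiggle h).aestronglyMeasurable
    (Eventually.of_forall fun x => abs_wiggle_le hh x)

theorem integral_abs_wiggle_le (hc : c.UniformBounds E M m τ R) (hh : 0 < h) :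
    ∫ x, |c.wiggle h x| ≤ m⁻¹ * M * h := by
  refine (integral_mono (integrable_wiggle hh).abs ((integrable_localMass hh).div_const h)
    fun x => abs_wiggle_le hh x).trans ?_
  rw [integral_div, div_le_iff₀ hh]
  exact (hc.integral_localMass_le hh).trans (le_of_eq (by ring))

/-- One of the two factors of the local mass is bounded by the total mass; the other keeps h⁻² and
has integral of order one. -/
theorem wiggle_sq_le (hc : c.UniformBounds E M m τ R) (hh : 0 < h) (x : ℝ) :
    c.wiggle h x ^ 2 ≤ m⁻¹ * M * ((h ^ 2)⁻¹ * localMass c h x) := by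
  have h1 : |c.wiggle h x| ≤ localMass c h x / h := abs_wiggle_le hh x
  have h2 := localMass_nonneg (c := c) (h := h) x
  rw [← sq_abs]
  calc |c.wiggle h x| ^ 2 ≤ (localMass c h x / h) ^ 2 := by gcongr
    _ = localMass c h x * ((h ^ 2)⁻¹ * localMass c h x) := by field_simp
    _ ≤ _ := by gcongr; exact hc.localMass_le x

/-- A pointwise bound for the short range part of the potential in the system. -/
noncomputable def remainderBound (c : Coefficients) (M m R h x : ℝ) : ℝ :=
  m⁻¹ * (c.b₀ x ^ 2 + 2 * M * |c.b₀ x|) + m⁻¹ * (oscBound c M m R x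
      + (Icc (-R - 1) R).indicator (fun _ => m⁻¹ * M * (2 * M) + M ^ 2 + 1) x)
    + (1 + m⁻¹ * (m⁻¹ * M)) * ((h ^ 2)⁻¹ * localMass c h x)

/-- Expanding (b₀ + b₁)² lets b₁² join the electric term to form `symbol`, from which the mean is
subtracted. The other terms contain b₀ or V₀ and are short range. -/
theorem abs_remainder_le (hc : c.UniformBounds E M m τ R) (hh : 0 < h) :
    ∀ᵐ x, |(c.system h E (meanSymbol c E R) (meanSymbolDeriv c E R)).r x|
      ≤ remainderBound c M m R h x := by
  filter_upwards [hc.ae_regular] with x hx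
  have hm := inv_pos.2 hc.m_pos
  have hM := hc.M_pos
  have ha0 := inv_pos.2 (c.α_pos x)
  have ha := hc.inv_α_le x
  have hα := (c.α_pos x).ne'
  have key : (c.system h E (meanSymbol c E R) (meanSymbolDeriv c E R)).r x =
      (c.α x)⁻¹ * (c.b₀ x ^ 2 + 2 * c.b₁ x * c.b₀ x)
      + (c.α x)⁻¹ * (c.symbol E x - meanSymbol c E R x)
      + (-c.averagedDensity h x + (c.α x)⁻¹ * c.wiggle h x ^ 2) := by
    simp only [system, symbol, b]
    field_simp
    ring
  rw [key, remainderBound]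
  refine (abs_add_le _ _).trans (add_le_add ((abs_add_le _ _).trans (add_le_add ?_ ?_)) ?_)
  · rw [abs_mul, abs_of_pos ha0]
    refine mul_le_mul ha ((abs_add_le _ _).trans (add_le_add ?_ ?_)) (abs_nonneg _) hm.le
    · rw [abs_of_nonneg (sq_nonneg _)]
    · rw [abs_mul, abs_mul, abs_two]
      have := hx.b₁_le
      gcongr
  · rw [abs_mul, abs_of_pos ha0]
    exact mul_le_mul ha (hc.abs_symbol_sub_meanSymbol_le hx) (abs_nonneg _) hm.le
  · refine (abs_add_le _ _).trans ?_
    rw [add_mul, one_mul, abs_neg, abs_mul, abs_of_pos ha0,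
      abs_of_nonneg (sq_nonneg (c.wiggle h x)), mul_assoc m⁻¹]
    exact add_le_add (abs_averagedDensity_le x)
      (mul_le_mul ha (hc.wiggle_sq_le hh x) (sq_nonneg _) hm.le)

theorem integrable_b₀ : Integrable c.b₀ := memLp_one_iff_integrable.1 c.b₀_L1

theorem integrable_b₀_sq : Integrable fun x => c.b₀ x ^ 2 := c.b₀_L2.integrable_sq

theorem integrable_cutoff : Integrable
    ((Icc (-R - 1) R).indicator fun _ => m⁻¹ * M * (2 * M) + M ^ 2 + 1) :=
  (integrable_indicator_iff measurableSet_Icc).2 (integrableOn_const (by simp))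

theorem integrable_remainderBound (hh : 0 < h) : Integrable (remainderBound c M m R h) :=
  (((integrable_b₀_sq.add (integrable_b₀.abs.const_mul _)).const_mul _).add
    ((integrable_oscBound.add integrable_cutoff).const_mul _)).add
    (((integrable_localMass hh).const_mul _).const_mul _)

theorem integral_remainderBound_le (hc : c.UniformBounds E M m τ R) (hh : 0 < h) :
    ∫ x, remainderBound c M m R h x ≤ m⁻¹ * (M + 2 * M * M)
      + m⁻¹ * ((m⁻¹ * m⁻¹ * M * (2 * M) + m⁻¹ * (2 * M) + m⁻¹ * M + 2 * M) * M
      + (2 * R + 1) * (m⁻¹ * M * (2 * M) + M ^ 2 + 1)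
      + (2 * R + 1) * (m⁻¹ * M * (2 * M) + M ^ 2 + 1))
      + (1 + m⁻¹ * (m⁻¹ * M)) * (m⁻¹ * M) := by
  have hm := inv_pos.2 hc.m_pos
  have hM := hc.M_pos
  have hR := hc.R_pos
  have i1 : Integrable fun x => c.b₀ x ^ 2 := integrable_b₀_sq
  have i2 : Integrable fun x => 2 * M * |c.b₀ x| := integrable_b₀.abs.const_mul _
  have i3 : Integrable fun x => oscBound c M m R x
      + (Icc (-R - 1) R).indicator (fun _ => m⁻¹ * M * (2 * M) + M ^ 2 + 1) x :=
    integrable_oscBound.add integrable_cutoff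
  have i4 : Integrable fun x => (h ^ 2)⁻¹ * localMass c h x := (integrable_localMass hh).const_mul _
  have i12 : Integrable fun x => c.b₀ x ^ 2 + 2 * M * |c.b₀ x| := i1.add i2
  have i123 : Integrable fun x => m⁻¹ * (c.b₀ x ^ 2 + 2 * M * |c.b₀ x|)
      + m⁻¹ * (oscBound c M m R x
      + (Icc (-R - 1) R).indicator (fun _ => m⁻¹ * M * (2 * M) + M ^ 2 + 1) x) :=
    (i12.const_mul _).add (i3.const_mul _)
  simp only [remainderBound]
  rw [integral_add i123 (i4.const_mul _), integral_add (i12.const_mul _) (i3.const_mul _),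
    integral_const_mul, integral_const_mul, integral_const_mul, integral_const_mul,
    integral_add i1 i2, integral_const_mul, integral_add integrable_oscBound integrable_cutoff,
    integral_indicator measurableSet_Icc, setIntegral_const,
    Real.volume_real_Icc_of_le (by linarith), smul_eq_mul]
  have e1 := hc.b₀_L1_le
  have e2 := hc.b₀_L2_le
  have e3 := hc.integral_oscBound_le
  have e4 : (h ^ 2)⁻¹ * ∫ x, localMass c h x ≤ m⁻¹ * M := by
    rw [inv_mul_le_iff₀ (by positivity)]
    exact hc.integral_localMass_le hh
  have e5 : R - (-R - 1) = 2 * R + 1 := by ring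
  rw [e5]
  gcongr

end UniformBounds

/-- The system has coefficients with bounds that depend only on the uniform bounds. -/
theorem exists_system_bounded (M m τ R h₀ ε₀ : ℝ) : ∃ K, ε₀ ≤ K ∧ ∀ (c : Coefficients) (E h : ℝ),
    c.UniformBounds E M m τ R → 0 < h → h ≤ h₀ → ∃ P P', (c.system h E P P').Bounded h K := by
  set A := m⁻¹ * M * (2 * M) + M ^ 2 + 1 with hA
  set O := (m⁻¹ * m⁻¹ * M * (2 * M) + m⁻¹ * (2 * M) + m⁻¹ * M + 2 * M) * M + (2 * R + 1) * A with hO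
  set S := m⁻¹ * (M + 2 * M * M) + m⁻¹ * (O + (2 * R + 1) * A) + (1 + m⁻¹ * (m⁻¹ * M)) * (m⁻¹ * M)
    with hS
  -- The parameters have no sign until a coefficient with `UniformBounds` is given; absolute values
  -- make K dominate every summand regardless.
  set K := |ε₀| + |h₀| + 1 + |M| + |m⁻¹| + |(min τ 1)⁻¹| + |m⁻¹ * M| + |A| + |O| + |S| with hK
  have b1 := abs_nonneg ε₀
  have b2 := abs_nonneg h₀
  have b3 := abs_nonneg M
  have b4 := abs_nonneg m⁻¹
  have b5 := abs_nonneg (min τ 1)⁻¹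
  have b6 := abs_nonneg (m⁻¹ * M)
  have b7 := abs_nonneg A
  have b8 := abs_nonneg O
  have b9 := abs_nonneg S
  have a1 := le_abs_self ε₀
  have a2 := le_abs_self h₀
  have a3 := le_abs_self M
  have a4 := le_abs_self m⁻¹
  have a5 := le_abs_self (min τ 1)⁻¹
  have a6 := le_abs_self (m⁻¹ * M)
  have a7 := le_abs_self A
  have a8 := le_abs_self O
  have a9 := le_abs_self S
  refine ⟨K, by linarith, fun c E h hc hh hhh => ⟨UniformBounds.meanSymbol c E R,
    UniformBounds.meanSymbolDeriv c E R, ?_⟩⟩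
  have hm := hc.m_pos
  have hM := hc.M_pos
  have hτ : 0 < min τ 1 := lt_min hc.τ_pos one_pos
  have hKM : K⁻¹ ≤ M⁻¹ := inv_anti₀ hM (by linarith)
  have hKm : m⁻¹ ≤ K := by linarith
  have hKA : A ≤ K := by linarith
  have hKO : O ≤ K := by linarith
  have hKS : S ≤ K := by linarith
  have hKN : m⁻¹ * M ≤ K := by linarith
  have hKτ : K⁻¹ ≤ min τ 1 := inv_le_of_inv_le₀ hτ (by linarith)
  have hP' : Integrable (UniformBounds.meanSymbolDeriv c E R) :=
    UniformBounds.integrable_oscBound.mono'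
      ((UniformBounds.measurable_cutSymbol.comp (measurable_id.add_const 1)).sub
        UniformBounds.measurable_cutSymbol).aestronglyMeasurable hc.abs_meanSymbolDeriv_le
  have hPm : Measurable (UniformBounds.meanSymbol c E R) :=
    hc.isPrimitive_meanSymbol.continuous.measurable
  have hαm := c.α_bv.measurable
  have hβm := c.β_bv.measurable
  have hVm := c.V₁_bv.measurable
  have hbm : AEStronglyMeasurable c.b volume := c.b₀_L2.1.add c.b₁_bv.measurable.aestronglyMeasurable
  have hrm : AEStronglyMeasurable (c.system h E (UniformBounds.meanSymbol c E R)
      (UniformBounds.meanSymbolDeriv c E R)).r volume :=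
    ((((hαm.inv.aestronglyMeasurable.mul (hbm.pow 2)).add
      ((measurable_const.sub hVm).mul hβm.inv).aestronglyMeasurable).sub
      (measurable_averagedDensity hh).aestronglyMeasurable).add
      (hαm.inv.mul ((measurable_wiggle h).pow_const 2)).aestronglyMeasurable).sub
      (hαm.inv.mul hPm).aestronglyMeasurable
  have hri := (UniformBounds.integrable_remainderBound hh).mono' hrm (hc.abs_remainder_le hh)
  exact
    { one_le := by linarith
      h_pos := hh
      h_le := by linarith
      a_meas := hαm.inv
      γ_meas := hβm.inv
      a_ge := fun x => hKM.trans (inv_anti₀ (c.α_pos x) (hc.α_le x))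
      a_le := fun x => (hc.inv_α_le x).trans hKm
      γ_ge := fun x => hKM.trans (inv_anti₀ (c.β_pos x) (hc.β_le x))
      γ_le := fun x => (hc.inv_β_le x).trans hKm
      w_int := UniformBounds.integrable_wiggle hh
      w_le := (hc.integral_abs_wiggle_le hh).trans (mul_le_mul_of_nonneg_right hKN hh.le)
      P_prim := hc.isPrimitive_meanSymbol
      P'_int := hP'
      P'_le := ((integral_mono_ae hP'.abs UniformBounds.integrable_oscBound
        hc.abs_meanSymbolDeriv_le).trans hc.integral_oscBound_le).trans hKO
      P_ge := fun x => hKτ.trans (hc.meanSymbol_ge x)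
      P_le := fun x => (hc.meanSymbol_le x).trans hKA
      r_int := hri
      r_le := ((integral_mono_ae hri.abs (UniformBounds.integrable_remainderBound hh)
        (hc.abs_remainder_le hh)).trans (hc.integral_remainderBound_le hh)).trans hKS }

end MagSchro.Coefficients

/-! ### The solution operator of the system. -/

namespace SystemCoefficients

variable {q : SystemCoefficients} {h K ε : ℝ}

theorem IsSolution.congr {f g u Φ : ℝ → ℂ} (hs : q.IsSolution h ε f u Φ) (hfg : f =ᵐ[volume] g) :
    q.IsSolution h ε g u Φ where
  u_L2 := hs.u_L2
  Φ_L2 := hs.Φ_L2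
  u_prim := hs.u_prim
  Φ_prim := hs.Φ_prim.congr_deriv (by
    filter_upwards [hfg] with x hx
    simp only [rhsΦ, hx])

theorem IsSolution.add {f₁ f₂ u₁ u₂ Φ₁ Φ₂ : ℝ → ℂ} (hs₁ : q.IsSolution h ε f₁ u₁ Φ₁)
    (hs₂ : q.IsSolution h ε f₂ u₂ Φ₂) :
    q.IsSolution h ε (fun x => f₁ x + f₂ x) (fun x => u₁ x + u₂ x) (fun x => Φ₁ x + Φ₂ x) where
  u_L2 := hs₁.u_L2.add hs₂.u_L2
  Φ_L2 := hs₁.Φ_L2.add hs₂.Φ_L2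
  u_prim := (hs₁.u_prim.add hs₂.u_prim).congr_deriv (Eventually.of_forall fun x => by
    simp only [rhsU]; ring)
  Φ_prim := (hs₁.Φ_prim.add hs₂.Φ_prim).congr_deriv (Eventually.of_forall fun x => by
    simp only [rhsΦ]; ring)

theorem IsSolution.const_mul {f u Φ : ℝ → ℂ} (a : ℂ) (hs : q.IsSolution h ε f u Φ) :
    q.IsSolution h ε (fun x => a * f x) (fun x => a * u x) (fun x => a * Φ x) where
  u_L2 := hs.u_L2.const_mul a
  Φ_L2 := hs.Φ_L2.const_mul a
  u_prim := (hs.u_prim.clm_comp (ContinuousLinearMap.mul ℝ ℂ a)).congr_deriv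
    (Eventually.of_forall fun x => by
      simp only [rhsU, ContinuousLinearMap.mul_apply']; ring)
  Φ_prim := (hs.Φ_prim.clm_comp (ContinuousLinearMap.mul ℝ ℂ a)).congr_deriv
    (Eventually.of_forall fun x => by
      simp only [rhsΦ, ContinuousLinearMap.mul_apply']; ring)

theorem IsSolution.unique {f g u v Φ Ψ : ℝ → ℂ} (hq : q.Bounded h K) (hε : ε ≠ 0)
    (hs : q.IsSolution h ε f u Φ) (hs' : q.IsSolution h ε g v Ψ) (hfg : f =ᵐ[volume] g) :
    u = v := by
  have h1 := ((hs.sub hs').congr (g := fun _ => 0) (by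
    filter_upwards [hfg] with x hx
    rw [hx, sub_self])).eq_zero hq hε
  funext x
  exact sub_eq_zero.1 (congrFun h1 x)

/-- The resolvent of the system. -/
theorem exists_solution_operator (hq : q.Bounded h K) (hε : ε ≠ 0)
    (hex : ∀ f : L2, ∃ u Φ, q.IsSolution h ε f u Φ) :
    ∃ R : L2 →L[ℂ] L2, ∀ f : L2, ∃ u Φ, u =ᵐ[volume] R f ∧ q.IsSolution h ε f u Φ := by
  choose u Φ hs using hex
  have hK := hq.K_pos
  -- Solutions are chosen independently for each f; uniqueness makes the choice linear.
  let R₀ : L2 →ₗ[ℂ] L2 :=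
    { toFun := fun f => (hs f).u_L2.toLp
      map_add' := fun f g => by
        rw [← MemLp.toLp_add]
        refine MemLp.toLp_congr _ _ (Eventually.of_forall fun x => congrFun ?_ x)
        exact (hs (f + g)).unique hq hε ((hs f).add (hs g)) (Lp.coeFn_add f g)
      map_smul' := fun a f => by
        rw [RingHom.id_apply, ← MemLp.toLp_const_smul]
        refine MemLp.toLp_congr _ _ (Eventually.of_forall fun x => congrFun ?_ x)
        exact (hs (a • f)).unique hq hε ((hs f).const_mul a) (Lp.coeFn_smul a f) }
  refine ⟨R₀.mkContinuous (K ^ 2 / |ε|) fun f => ?_,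
    fun f => ⟨u f, Φ f, (hs f).u_L2.coeFn_toLp.symm, hs f⟩⟩
  set U : L2 := (hs f).u_L2.toLp with hU
  have hUu : U =ᵐ[volume] u f := (hs f).u_L2.coeFn_toLp
  change ‖U‖ ≤ K ^ 2 / |ε| * ‖f‖
  have hε' := abs_pos.2 hε
  -- The bound |ε|‖u‖² ≤ K²∫|f||u|, Cauchy-Schwarz and division by ‖u‖ give the operator norm.
  have h1 := (hs f).eps_mul_le hq (Lp.memLp f)
  have h2 : ∫ x, ‖u f x‖ ^ 2 = ‖U‖ ^ 2 := by
    rw [← integral_norm_sq_L2]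
    exact integral_congr_ae (by filter_upwards [hUu] with x hx; rw [hx])
  have h3 := integral_norm_mul_norm_le (Lp.memLp f) (hs f).u_L2
  rw [integral_norm_sq_L2, h2, Real.sqrt_sq (norm_nonneg _), Real.sqrt_sq (norm_nonneg _)] at h3
  rw [h2] at h1
  rcases (norm_nonneg U).eq_or_lt with h0 | h0
  · rw [← h0]; positivity
  · rw [div_mul_eq_mul_div, le_div_iff₀ hε']
    refine le_of_mul_le_mul_right ?_ h0
    calc ‖U‖ * |ε| * ‖U‖ = |ε| * ‖U‖ ^ 2 := by ring
      _ ≤ K ^ 2 * (‖f‖ * ‖U‖) := h1.trans (mul_le_mul_of_nonneg_left h3 (by positivity))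
      _ = _ := by ring

end SystemCoefficients

/-! ### Weights and the resolvent estimate. -/

namespace MagSchro

/-- ⟨x⟩^{-2s} is integrable because 2s > 1. One weight then maps L² into L¹ and the other maps L^∞
into L², which is what the bound on the system needs. -/
theorem weight_sq_memLp {s : ℝ} (hs : 1 / 2 < s) : MemLp (fun x => (weight s x : ℂ)) 2 := by
  have hm : Measurable (weight s) := by unfold weight; fun_prop
  have hreal : MemLp (weight s) 2 := by
    rw [memLp_two_iff_integrable_sq hm.aestronglyMeasurable]
    have h1 := integrable_rpow_neg_one_add_norm_sq (E := ℝ) (μ := volume) (r := 2 * s)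
      (by simp; linarith)
    refine h1.congr (Eventually.of_forall fun x => ?_)
    simp only [weight, Real.norm_eq_abs]
    have h2 : 0 ≤ 1 + |x| ^ 2 := by positivity
    rw [Real.sqrt_eq_rpow, ← Real.rpow_mul h2, ← Real.rpow_mul_natCast h2]
    congr 1
    push_cast
    ring
  exact hreal.ofReal

theorem coeFn_mulWeight {s : ℝ} (hs : 1 / 2 < s) (u : L2) :
    mulWeight hs u =ᵐ[volume] fun x => (weight s x : ℂ) * u x := by
  have h2 := (ContinuousLinearMap.mul ℂ ℂ).coeFn_holder (r := 2) (weight_memLp hs).toLp u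
  filter_upwards [h2, (weight_memLp hs).coeFn_toLp] with x hx hx'
  rw [← hx']
  exact hx

theorem integrable_mulWeight {s : ℝ} (hs : 1 / 2 < s) (g : L2) : Integrable (mulWeight hs g) := by
  have h1 : Integrable fun x => (weight s x : ℂ) * g x :=
    (weight_sq_memLp hs).integrable_mul (Lp.memLp g)
  exact h1.congr (coeFn_mulWeight hs g).symm

theorem integral_norm_mulWeight_le {s : ℝ} (hs : 1 / 2 < s) (g : L2) :
    ∫ x, ‖mulWeight hs g x‖ ≤ ‖(weight_sq_memLp hs).toLp‖ * ‖g‖ := by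
  have h1 := integral_norm_mul_norm_le (Lp.memLp (weight_sq_memLp hs).toLp) (Lp.memLp g)
  rw [integral_norm_sq_L2, integral_norm_sq_L2, Real.sqrt_sq (norm_nonneg _),
    Real.sqrt_sq (norm_nonneg _)] at h1
  refine le_trans (le_of_eq (integral_congr_ae ?_)) h1
  filter_upwards [coeFn_mulWeight hs g, (weight_sq_memLp hs).coeFn_toLp] with x hx hx'
  rw [hx, hx', norm_mul]

theorem norm_mulWeight_le {s : ℝ} (hs : 1 / 2 < s) {u : L2} {C : ℝ}
    (hu : ∀ᵐ x, ‖u x‖ ≤ C) : ‖mulWeight hs u‖ ≤ C * ‖(weight_sq_memLp hs).toLp‖ := by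
  refine Lp.norm_le_mul_norm_of_ae_le_mul ?_
  filter_upwards [coeFn_mulWeight hs u, (weight_sq_memLp hs).coeFn_toLp, hu] with x hx hx' hxu
  rw [hx, hx', norm_mul, mul_comm]
  gcongr

theorem abs_le_of_eLpNorm_top_le {f : ℝ → ℝ} {M : ℝ≥0} (hf : eLpNorm f ⊤ volume ≤ M) :
    ∀ᵐ x, |f x| ≤ M := by
  rw [eLpNorm_exponent_top] at hf
  filter_upwards [ae_le_eLpNormEssSup (f := f) (μ := volume)] with x hx
  exact enorm_le_coe.1 (hx.trans hf)

theorem integral_abs_le_of_eLpNorm_one_le {f : ℝ → ℝ} (hf : MemLp f 1 volume) {M : ℝ≥0}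
    (hM : eLpNorm f 1 volume ≤ M) : ∫ x, |f x| ≤ M := by
  have h1 := integral_norm_eq_lintegral_enorm hf.1
  rw [← eLpNorm_one_eq_lintegral_enorm] at h1
  exact h1.le.trans (ENNReal.toReal_le_coe_of_le_coe hM)

theorem integral_sq_le_of_eLpNorm_two_le {f : ℝ → ℝ} (hf : MemLp f 2 volume) {M : ℝ≥0}
    (hM : eLpNorm f 2 volume ≤ M) : ∫ x, f x ^ 2 ≤ M ^ 2 := by
  have h0 : MemLp (fun x => (f x : ℂ)) 2 volume := hf.ofReal
  have h1 : ‖h0.toLp‖ ≤ M := by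
    rw [Lp.norm_toLp]
    refine ENNReal.toReal_le_coe_of_le_coe (le_trans (le_of_eq ?_) hM)
    exact eLpNorm_congr_norm_ae (Eventually.of_forall fun x => Complex.norm_real _)
  have h2 : ∫ x, f x ^ 2 = ‖h0.toLp‖ ^ 2 := by
    rw [← integral_norm_sq_L2]
    refine integral_congr_ae ?_
    filter_upwards [h0.coeFn_toLp] with x hx
    rw [hx, Complex.norm_real, Real.norm_eq_abs, sq_abs]
  rw [h2]
  gcongr

/-- Existence of the resolvent and the weighted estimate from bounds for the system. -/
theorem Coefficients.exists_isResolvent {c : Coefficients} {h E ε K D s : ℝ} {P P' : ℝ → ℝ}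
    (hs : 1 / 2 < s) (hq : (c.system h E P P').Bounded h K) (hε : ε ≠ 0)
    (hD : ∀ f u Φ, MemLp f 2 → Integrable f → (c.system h E P P').IsSolution h ε f u Φ →
      ∀ x, ‖u x‖ ≤ Real.exp (D / h) * ∫ t, ‖f t‖) :
    ∃ R : L2 →L[ℂ] L2, c.IsResolvent h ((E : ℂ) + Complex.I * (ε : ℂ)) R ∧
      ‖mulWeight hs ∘L R ∘L mulWeight hs‖ ≤
        Real.exp (D / h) * ‖(weight_sq_memLp hs).toLp‖ ^ 2 := by
  obtain ⟨R, hR⟩ := SystemCoefficients.exists_solution_operator hq hε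
    (c.exists_isSolution hq.h_pos hε E P P')
  refine ⟨R, fun f u => ⟨?_, fun hG => ?_⟩, ?_⟩
  · rintro rfl
    obtain ⟨v, Φ, hv, hsol⟩ := hR f
    exact graph_of_isSolution hq hv hsol
  · obtain ⟨v, Φ, hv, hsol⟩ := hR f
    obtain ⟨v', Φ', hv', hsol'⟩ := hG.exists_isSolution (P := P) (P' := P') hq.h_pos
    have h1 : v = v' := hsol.unique hq hε hsol' (by rfl)
    refine Lp.ext ?_
    exact hv.symm.trans (h1 ▸ hv')
  · refine ContinuousLinearMap.opNorm_le_bound _ (by positivity) fun g => ?_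
    obtain ⟨v, Φ, hv, hsol⟩ := hR (mulWeight hs g)
    have h1 := hD _ v Φ (Lp.memLp _) (integrable_mulWeight hs g) hsol
    have h2 := integral_norm_mulWeight_le hs g
    refine (norm_mulWeight_le hs (u := R (mulWeight hs g))
      (C := Real.exp (D / h) * (‖(weight_sq_memLp hs).toLp‖ * ‖g‖)) ?_).trans (le_of_eq (by ring))
    filter_upwards [hv] with x hx
    rw [← hx]
    exact (h1 x).trans (by gcongr)

end MagSchro

open MagSchro in
theorem corollary3
    (s Emax h₀ ε₀ : ℝ) (hs : 1 / 2 < s) (hEmax : 0 < Emax) (hh₀ : 0 < h₀) (hε₀ : 0 < ε₀)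
    (E : ℝ → ℝ) (hE : ∀ h ∈ Set.Ioc 0 h₀, E h ∈ Set.Icc (-Emax) Emax)
    (P : ℝ → Coefficients)
    -- uniform bounds on the long range coefficients
    (hbound : ∃ M : ℝ≥0, ∀ h ∈ Set.Ioc 0 h₀,
      eLpNorm (P h).V₁ ∞ volume ≤ M ∧ totalMass (dBV (P h).V₁_bv) ≤ M ∧
      eLpNorm (P h).b₁ ∞ volume ≤ M ∧ totalMass (dBV (P h).b₁_bv) ≤ M ∧
      totalMass (dBV (P h).α_bv) ≤ M ∧ totalMass (dBV (P h).β_bv) ≤ M ∧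
      (∀ x, (P h).α x ≤ M) ∧ (∀ x, (P h).β x ≤ M))
    -- uniform positive lower bounds
    (hinf : ∃ m : ℝ, 0 < m ∧ ∀ h ∈ Set.Ioc 0 h₀, ∀ x, m ≤ (P h).α x ∧ m ≤ (P h).β x)
    -- uniform positivity near infinity
    (hτ : ∃ R₁ : ℝ, 0 < R₁ ∧ ∃ τ₁ : ℝ, 0 < τ₁ ∧ ∀ h ∈ Set.Ioc 0 h₀, ∀ x : ℝ, R₁ ≤ |x| →
      τ₁ ≤ ((P h).β x)⁻¹ * (P h).α x * (E h - (P h).V₁ x) + (P h).b₁ x ^ 2)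
    -- uniform bounds on the short range coefficients
    (hshort : ∃ M : ℝ≥0, ∀ h ∈ Set.Ioc 0 h₀,
      totalMass (P h).V₀ ≤ M ∧ eLpNorm (P h).b₀ 1 volume ≤ M ∧ eLpNorm (P h).b₀ 2 volume ≤ M) :
    ∃ C₁ : ℝ, 0 < C₁ ∧ ∀ h ∈ Set.Ioc 0 h₀, ∀ ε ∈ Set.Icc (-ε₀) ε₀, ε ≠ 0 →
      ∃ R : L2 →L[ℂ] L2, (P h).IsResolvent h ((E h : ℂ) + Complex.I * (ε : ℂ)) R ∧
        ‖mulWeight hs ∘L R ∘L mulWeight hs‖ ≤ Real.exp (C₁ / h) := by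
  obtain ⟨M₁, hM₁⟩ := hbound
  obtain ⟨m, hm, hmαβ⟩ := hinf
  obtain ⟨R₁, hR₁, τ₁, hτ₁, hsym⟩ := hτ
  obtain ⟨M₂, hM₂⟩ := hshort
  -- Four total variations are added, and the L² norm of b₀ enters squared.
  set M : ℝ := 4 * M₁ + M₂ + M₂ ^ 2 + Emax with hM
  have n1 : (0 : ℝ) ≤ M₁ := M₁.2
  have n2 : (0 : ℝ) ≤ M₂ := M₂.2
  have n3 : (0 : ℝ) ≤ (M₂ : ℝ) ^ 2 := by positivity
  have hU : ∀ h ∈ Ioc 0 h₀, (P h).UniformBounds (E h) M m τ₁ R₁ := by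
    intro h hh
    obtain ⟨e1, e2, e3, e4, e5, e6, e7, e8⟩ := hM₁ h hh
    obtain ⟨e9, e10, e11⟩ := hM₂ h hh
    have i1 := isFiniteMeasure_totalVariation (dBV (P h).α_bv)
    have i2 := isFiniteMeasure_totalVariation (dBV (P h).β_bv)
    have i3 := isFiniteMeasure_totalVariation (dBV (P h).V₁_bv)
    have i4 := isFiniteMeasure_totalVariation (dBV (P h).b₁_bv)
    have v : ∀ {μ : SignedMeasure ℝ} {N : ℝ≥0}, totalMass μ ≤ N →
        μ.totalVariation.real univ ≤ N := fun hμ => ENNReal.toReal_le_coe_of_le_coe hμ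
    exact
      { m_pos := hm
        τ_pos := hτ₁
        R_pos := hR₁
        α_ge := fun x => (hmαβ h hh x).1
        β_ge := fun x => (hmαβ h hh x).2
        α_le := fun x => (e7 x).trans (by linarith)
        β_le := fun x => (e8 x).trans (by linarith)
        V₁_le := by filter_upwards [abs_le_of_eLpNorm_top_le e1] with x hx; linarith
        b₁_le := by filter_upwards [abs_le_of_eLpNorm_top_le e3] with x hx; linarith
        variation_le := by
          rw [Coefficients.variationMeasure, measureReal_add_apply, measureReal_add_apply,
            measureReal_add_apply]
          linarith [v e2, v e4, v e5, v e6]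
        E_le := (abs_le.2 (hE h hh)).trans (by linarith)
        symbol_ge := hsym h hh
        V₀_le := (v e9).trans (by linarith)
        b₀_L1_le := (integral_abs_le_of_eLpNorm_one_le (P h).b₀_L1 e10).trans (by linarith)
        b₀_L2_le := (integral_sq_le_of_eLpNorm_two_le (P h).b₀_L2 e11).trans (by linarith) }
  obtain ⟨K, hεK, hK⟩ := Coefficients.exists_system_bounded M m τ₁ R₁ h₀ ε₀
  obtain ⟨D, hD, hDb⟩ := SystemCoefficients.exists_exp_bound K
  set κ := ‖(weight_sq_memLp hs).toLp‖ ^ 2 with hκ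
  have hκ0 : 0 ≤ κ := by positivity
  -- The factor κ from the two weights is at most exp(κh₀/h), since h ≤ h₀, and so fits into the
  -- exponent.
  refine ⟨D + κ * h₀, by positivity, fun h hh ε hε hε0 => ?_⟩
  obtain ⟨Q, Q', hq⟩ := hK (P h) (E h) h (hU h hh) hh.1 hh.2
  obtain ⟨R, hR, hRn⟩ := Coefficients.exists_isResolvent hs hq hε0
    (fun f u Φ hf hf1 hsol => hDb _ h ε f u Φ hq ((abs_le.2 hε).trans hεK) hf hf1 hsol)
  refine ⟨R, hR, hRn.trans ?_⟩
  rw [add_div, Real.exp_add]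
  have h1 : κ ≤ κ * h₀ / h := by
    rw [le_div_iff₀ hh.1]
    exact mul_le_mul_of_nonneg_left hh.2 hκ0
  have h2 : κ ≤ Real.exp (κ * h₀ / h) := h1.trans ((le_add_of_nonneg_right zero_le_one).trans
    (Real.add_one_le_exp _))
  gcongr
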